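/- Let $L$ be Lebesgue measure on $\mathbb{C}$, let $$\mathcal{E}=\{u(z)=e^{-|z|^2/2}f(z):\ f \text{ entire}\}\cap L^2(\mathbb{C})$$ be the Bargmann--Fock space, and let $\Pi$ be the orthogonal projection of $L^2(\mathbb{C})$ onto $\mathcal{E}$. Put $\langle z\rangle=(1+|z|^2)^{1/2}$ and, for an integer $k\ge 0$, let $L^{2,k}_{\mathcal{E}}=\{u\in\mathcal{E}:\ \langle z\rangle^k u\in L^2(\mathbb{C})\}$, with the norm $\|\langle z\rangle^k u\|_{L^2(\mathbb{C})}$. Consider the cubic lowest Landau level equation $$i\partial_t u=\Pi(|u|^2u),\qquad u(0,\cdot)=u_0. \qquad (\ast)$$ **Theorem.** There are constants $C_k>0$, depending only on the integer $k$, and a universal constant $C>0$ such that the following holds. Let $k\ge 1$ be an integer and let $u_0\in L^{2,k}_{\mathcal{E}}$. Then $(\ast)$ has a unique solution $u\in C^\infty(\mathbb{R},L^{2,k}_{\mathcal{E}})$, and for all $t\in\mathbb{R}$ $$\|\langle z\rangle^k u(t)\|_{L^2}\le \|\langle z\rangle^k u_0\|_{L^2}\,\bigl(1+C_k\|\langle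 z\rangle u_0\|_{L^2}^2|t|\bigr)^{\frac{k-1}{4}}\quad\text{if } k\ge 3,$$ $$\|\langle z\rangle^2 u(t)\|_{L^2}\le \|\langle z\rangle^2 u_0\|_{L^2}\,\bigl(1+C\|u_0\|_{L^2}^2|t|\bigr)^{\frac12}\quad\text{if } k=2.$$ Moreover, if $\langle z\rangle^3u_0\in L^2(\mathbb{C})$, then $\langle z\rangle^2u(t)\in L^2(\mathbb{C})$ and $$\|\langle z\rangle^2 u(t)\|_{L^2}\le \|\langle z\rangle^3 u_0\|_{L^2}\,\bigl(1+C\|\langle z\rangle u_0\|_{L^2}^2|t|\bigr)^{\frac14}\quad\text{for all } t\in\mathbb{R}.$$ -/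

import Mathlib

open MeasureTheory Filter Topology

open scoped ENNReal ContDiff

/-- The complex Hilbert space `L²(ℂ)`, for Lebesgue measure on `ℂ`. -/
abbrev L2C : Type := Lp ℂ 2 (volume : Measure ℂ)

/-- The Gaussian `e^{-|z|²/2}`. -/
noncomputable def gaussian (z : ℂ) : ℂ := ((Real.exp (-‖z‖ ^ 2 / 2) : ℝ) : ℂ)

/-- The Japanese bracket `⟨z⟩ = (1 + |z|²)^{1/2}`. -/
noncomputable def bracket (z : ℂ) : ℝ := Real.sqrt (1 + ‖z‖ ^ 2)

/-- The Bargmann-Fock space `𝓔`: the (classes of) square integrable functions of the form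
`e^{-|z|²/2} f(z)` with `f` entire. -/
noncomputable def bargmannFock : Submodule ℂ L2C where
  carrier := {u | ∃ f : ℂ → ℂ, Differentiable ℂ f ∧ u =ᵐ[volume] fun z => gaussian z * f z}
  add_mem' := by
    rintro u v ⟨f, hf, hu⟩ ⟨g, hg, hv⟩
    refine ⟨f + g, hf.add hg, ?_⟩
    filter_upwards [Lp.coeFn_add u v, hu, hv] with z h1 h2 h3
    simp only [h1, Pi.add_apply, h2, h3]
    ring
  zero_mem' := by
    refine ⟨0, differentiable_const 0, ?_⟩
    filter_upwards [Lp.coeFn_zero ℂ 2 (volume : Measure ℂ)] with z h1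
    simp
  smul_mem' := by
    rintro c u ⟨f, hf, hu⟩
    refine ⟨c • f, hf.const_smul c, ?_⟩
    filter_upwards [Lp.coeFn_smul c u, hu] with z h1 h2
    simp only [h1, Pi.smul_apply, h2, smul_eq_mul]
    ring

/-! ### Point evaluations on the Bargmann-Fock space are bounded -/

/-- Mean value inequality against the Gaussian weight. -/
theorem enorm_zero_le_lintegral {g : ℂ → ℂ} (hg : Differentiable ℂ g) :
    ‖g 0‖ₑ ≤ ∫⁻ w : ℂ, ‖g w‖ₑ * ENNReal.ofReal (Real.exp (1 - ‖w‖ ^ 2)) := by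
  have key : ∀ r : ℝ, 0 < r →
      ENNReal.ofReal (2 * Real.pi) * ‖g 0‖ₑ ≤
        ∫⁻ θ in Set.Ioo (-Real.pi) Real.pi, ‖g (circleMap 0 r θ)‖ₑ := by
    intro r hr
    have h1 : Real.circleAverage g 0 r = g 0 :=
      DiffContOnCl.circleAverage hg.diffContOnCl
    have hper : Function.Periodic (fun θ => g (circleMap 0 r θ)) (2 * Real.pi) :=
      (periodic_circleMap 0 r).comp g
    have h2 : ∫ θ in Set.Ioo (-Real.pi) Real.pi, g (circleMap 0 r θ)
        = (2 * Real.pi : ℝ) • g 0 := by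
      rw [← integral_Ioc_eq_integral_Ioo,
        ← intervalIntegral.integral_of_le (by linarith [Real.pi_pos])]
      have h3 := hper.intervalIntegral_add_eq (-Real.pi) 0
      rw [show -Real.pi + 2 * Real.pi = Real.pi by ring, zero_add] at h3
      rw [h3]
      conv_rhs => rw [← h1, Real.circleAverage_def, smul_smul,
        mul_inv_cancel₀ (by positivity), one_smul]
    calc ENNReal.ofReal (2 * Real.pi) * ‖g 0‖ₑ
        = ‖∫ θ in Set.Ioo (-Real.pi) Real.pi, g (circleMap 0 r θ)‖ₑ := by
          rw [h2, enorm_smul, Real.enorm_eq_ofReal (by positivity)]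
      _ ≤ _ := enorm_integral_le_lintegral_enorm _
  set F : ℂ → ℝ≥0∞ := fun w => ‖g w‖ₑ * ENNReal.ofReal (Real.exp (1 - ‖w‖ ^ 2)) with hF
  have hFm : Measurable F := by
    have := hg.continuous
    fun_prop
  rw [← Complex.lintegral_comp_polarCoord_symm F]
  have hsub : (Set.Ioo (0 : ℝ) 1) ×ˢ (Set.Ioo (-Real.pi) Real.pi) ⊆ polarCoord.target := by
    rintro ⟨r, θ⟩ ⟨h1, h2⟩
    exact ⟨h1.1, h2⟩
  refine le_trans ?_ (lintegral_mono_set hsub)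
  have hsymm : Measurable (fun p : ℝ × ℝ =>
      ENNReal.ofReal p.1 • F (Complex.polarCoord.symm p)) := by
    have h0 : Measurable (fun p : ℝ × ℝ => Complex.polarCoord.symm p) := by
      simp only [Complex.polarCoord_symm_apply]
      fun_prop
    exact (ENNReal.measurable_ofReal.comp measurable_fst).smul (hFm.comp h0)
  rw [Measure.volume_eq_prod, ← Measure.prod_restrict, lintegral_prod _ hsymm.aemeasurable]
  have hin : ∀ r ∈ Set.Ioo (0 : ℝ) 1,
      ENNReal.ofReal r * (ENNReal.ofReal (2 * Real.pi) * ‖g 0‖ₑ) ≤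
        ∫⁻ θ in Set.Ioo (-Real.pi) Real.pi,
          ENNReal.ofReal r • F (Complex.polarCoord.symm (r, θ)) := by
    intro r hr
    refine le_trans (mul_le_mul_right (key r hr.1) _) ?_
    rw [← lintegral_const_mul' _ _ ENNReal.ofReal_ne_top]
    refine lintegral_mono fun θ => ?_
    have e1 : Complex.polarCoord.symm (r, θ) = circleMap 0 r θ := by
      rw [Complex.polarCoord_symm_apply, circleMap_zero, Complex.exp_mul_I]
      push_cast
      ring
    have e2 : ‖circleMap 0 r θ‖ = r := by
      simp [abs_of_pos hr.1]
    simp only [hF, e1, e2, smul_eq_mul]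
    gcongr
    refine le_mul_of_one_le_right (zero_le) ?_
    rw [← ENNReal.ofReal_one]
    refine ENNReal.ofReal_le_ofReal (Real.one_le_exp ?_)
    nlinarith [hr.1, hr.2]
  refine le_trans ?_ (setLIntegral_mono' measurableSet_Ioo hin)
  rw [lintegral_mul_const _ (by fun_prop), ← ofReal_integral_eq_lintegral_ofReal]
  · have : ∫ r in Set.Ioo (0 : ℝ) 1, r = 1 / 2 := by
      rw [← integral_Ioc_eq_integral_Ioo, ← intervalIntegral.integral_of_le zero_le_one]
      simp
    rw [this, ← mul_assoc, ← ENNReal.ofReal_mul (by norm_num)]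
    refine le_mul_of_one_le_left (zero_le) ?_
    rw [← ENNReal.ofReal_one]
    refine ENNReal.ofReal_le_ofReal ?_
    linarith [Real.pi_gt_three]
  · exact (continuous_id.integrableOn_Icc).mono_set Set.Ioo_subset_Icc_self
  · filter_upwards [ae_restrict_mem measurableSet_Ioo] with r hr using hr.1.le

/-- Elements of the Bargmann-Fock space are bounded by their `L²` norm. -/
theorem norm_gaussian_mul_le {f : ℂ → ℂ} (hf : Differentiable ℂ f) {u : L2C}
    (hu : u =ᵐ[volume] fun z => gaussian z * f z) (z : ℂ) :
    ‖gaussian z * f z‖ ≤ Real.exp (1 / 2) * ‖u‖ := by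
  set h : ℂ → ℂ := fun w =>
    (f (z + w) * Complex.exp (-(starRingEnd ℂ z) * (z + w) + ((‖z‖ ^ 2 / 2 : ℝ) : ℂ))) ^ 2
  have hd : Differentiable ℂ h := by
    have : Differentiable ℂ fun w : ℂ => f (z + w) :=
      hf.comp ((differentiable_const z).add differentiable_id)
    fun_prop
  have hnorm : ∀ w : ℂ, ‖h w‖ * Real.exp (1 - ‖w‖ ^ 2)
      = Real.exp 1 * ‖gaussian (z + w) * f (z + w)‖ ^ 2 := by
    intro w
    have e : ‖z + w‖ ^ 2 = ‖z‖ ^ 2 + 2 * ((starRingEnd ℂ z) * w).re + ‖w‖ ^ 2 := by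
      simp only [Complex.sq_norm, Complex.normSq_apply, Complex.add_re, Complex.add_im,
        Complex.mul_re, Complex.conj_re, Complex.conj_im]
      ring
    have e' : (-(starRingEnd ℂ z) * (z + w) + ((‖z‖ ^ 2 / 2 : ℝ) : ℂ)).re
        = -‖z‖ ^ 2 / 2 - ((starRingEnd ℂ z) * w).re := by
      simp only [Complex.sq_norm, Complex.normSq_apply, Complex.add_re, Complex.add_im,
        Complex.mul_re, Complex.conj_re, Complex.conj_im, Complex.neg_re, Complex.neg_im,
        Complex.ofReal_re]
      ring
    simp only [h, gaussian, norm_pow, norm_mul, Complex.norm_exp, e', Complex.norm_real,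
      Real.norm_eq_abs, Real.abs_exp]
    rw [mul_pow, mul_pow, ← Real.exp_nat_mul, ← Real.exp_nat_mul, mul_assoc, ← Real.exp_add,
      ← mul_assoc, ← Real.exp_add, mul_comm, e]
    congr 2
    push_cast
    ring
  have h0 : ‖h 0‖ = ‖gaussian z * f z‖ ^ 2 := by
    have h1 := hnorm 0
    rw [norm_zero, add_zero] at h1
    have : Real.exp (1 - (0 : ℝ) ^ 2) = Real.exp 1 := by norm_num
    rw [this, mul_comm] at h1
    exact mul_left_cancel₀ (Real.exp_pos 1).ne' h1
  have hL : ∫⁻ w : ℂ, ‖h w‖ₑ * ENNReal.ofReal (Real.exp (1 - ‖w‖ ^ 2))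
      = ENNReal.ofReal (Real.exp 1) * ENNReal.ofReal (‖u‖ ^ 2) := by
    have e1 : ∀ w : ℂ, ‖h w‖ₑ * ENNReal.ofReal (Real.exp (1 - ‖w‖ ^ 2))
        = ENNReal.ofReal (Real.exp 1) * ‖gaussian (z + w) * f (z + w)‖ₑ ^ 2 := by
      intro w
      rw [← ofReal_norm, ← ENNReal.ofReal_mul (norm_nonneg _), hnorm,
        ENNReal.ofReal_mul (Real.exp_pos _).le, ENNReal.ofReal_pow (norm_nonneg _),
        ofReal_norm]
    simp_rw [e1]
    rw [lintegral_const_mul' _ _ ENNReal.ofReal_ne_top,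
      lintegral_add_left_eq_self (fun w => ‖gaussian w * f w‖ₑ ^ 2) z]
    congr 1
    have e2 : ∫⁻ w, ‖gaussian w * f w‖ₑ ^ 2 = ∫⁻ w, ‖u w‖ₑ ^ 2 := by
      refine lintegral_congr_ae ?_
      filter_upwards [hu] with w hw
      rw [hw]
    rw [e2, ENNReal.ofReal_pow (norm_nonneg _), ofReal_norm, Lp.enorm_def,
      eLpNorm_eq_lintegral_rpow_enorm_toReal (by norm_num) (by norm_num)]
    rw [← ENNReal.rpow_natCast, ← ENNReal.rpow_mul]
    simp
  have hmain := enorm_zero_le_lintegral hd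
  rw [hL, ← ofReal_norm, h0, ← ENNReal.ofReal_mul (Real.exp_pos _).le,
    ENNReal.ofReal_le_ofReal_iff (by positivity)] at hmain
  refine le_of_sq_le_sq ?_ (by positivity)
  rw [mul_pow, ← Real.exp_nat_mul]
  have h2 : ((2 : ℕ) : ℝ) * (1 / 2) = 1 := by norm_num
  rw [h2]
  exact hmain

theorem norm_le_of_mem_bargmannFock {u : L2C} (hu : u ∈ bargmannFock) :
    ∀ᵐ z : ℂ, ‖u z‖ ≤ Real.exp (1 / 2) * ‖u‖ := by
  obtain ⟨f, hf, hfu⟩ := hu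
  filter_upwards [hfu] with z hz
  rw [hz]
  exact norm_gaussian_mul_le hf hfu z

/-- The Bargmann-Fock space is closed in `L²(ℂ)`, so that the orthogonal projection exists. -/
theorem isClosed_bargmannFock : IsClosed (bargmannFock : Set L2C) := by
  refine IsSeqClosed.isClosed ?_
  intro u v hu huv
  choose f hf hfu using hu
  have hbd : ∀ m n z, ‖f m z - f n z‖
      ≤ Real.exp (‖z‖ ^ 2 / 2) * (Real.exp (1 / 2) * ‖u m - u n‖) := by
    intro m n z
    have h1 : (u m - u n : L2C) =ᵐ[volume] fun z => gaussian z * (f m - f n) z := by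
      filter_upwards [Lp.coeFn_sub (u m) (u n), hfu m, hfu n] with z h1 h2 h3
      simp only [h1, Pi.sub_apply, h2, h3]
      ring
    have h2 := norm_gaussian_mul_le ((hf m).sub (hf n)) h1 z
    rw [norm_mul, gaussian, Complex.norm_real, Real.norm_eq_abs, Real.abs_exp,
      Pi.sub_apply] at h2
    calc ‖f m z - f n z‖
        = Real.exp (‖z‖ ^ 2 / 2) * (Real.exp (-‖z‖ ^ 2 / 2) * ‖f m z - f n z‖) := by
          rw [← mul_assoc, ← Real.exp_add]
          simp [neg_div]
      _ ≤ _ := mul_le_mul_of_nonneg_left h2 (Real.exp_pos _).le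
  have hcu := huv.cauchySeq
  have hptC : ∀ z, CauchySeq fun n => f n z := by
    intro z
    rw [Metric.cauchySeq_iff] at hcu ⊢
    intro ε hε
    set K := Real.exp (‖z‖ ^ 2 / 2) * Real.exp (1 / 2)
    have hK : 0 < K := by positivity
    obtain ⟨N, hN⟩ := hcu (ε / K) (by positivity)
    refine ⟨N, fun m hm n hn => ?_⟩
    have h1 := hN m hm n hn
    rw [dist_eq_norm, lt_div_iff₀ hK] at h1
    rw [dist_eq_norm]
    refine lt_of_le_of_lt (hbd m n z) ?_
    rw [← mul_assoc, mul_comm]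
    exact h1
  choose F hF using fun z => cauchySeq_tendsto_of_complete (hptC z)
  have hlim : ∀ n z, ‖F z - f n z‖
      ≤ Real.exp (‖z‖ ^ 2 / 2) * (Real.exp (1 / 2) * ‖v - u n‖) := by
    intro n z
    refine le_of_tendsto_of_tendsto (((hF z).sub_const (f n z)).norm)
      (((huv.sub_const (u n)).norm.const_mul _).const_mul _) ?_
    exact Eventually.of_forall fun m => hbd m n z
  have hloc : TendstoLocallyUniformlyOn f F atTop Set.univ := by
    rw [tendstoLocallyUniformlyOn_iff_forall_isCompact isOpen_univ]
    intro K _ hK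
    obtain ⟨R, hR⟩ := hK.isBounded.exists_norm_le
    rw [Metric.tendstoUniformlyOn_iff]
    intro ε hε
    set A := Real.exp (R ^ 2 / 2) * Real.exp (1 / 2)
    have hA : 0 < A := by positivity
    have h1 := (Metric.tendsto_atTop.1 huv) (ε / A) (by positivity)
    obtain ⟨N, hN⟩ := h1
    filter_upwards [eventually_ge_atTop N] with n hn z hz
    have h2 := hN n hn
    rw [dist_comm, dist_eq_norm, lt_div_iff₀ hA] at h2
    rw [dist_eq_norm]
    refine lt_of_le_of_lt (hlim n z) ?_
    have h3 : Real.exp (‖z‖ ^ 2 / 2) ≤ Real.exp (R ^ 2 / 2) := by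
      have := hR z hz
      gcongr
    calc _ ≤ Real.exp (R ^ 2 / 2) * (Real.exp (1 / 2) * ‖v - u n‖) := by gcongr
      _ = ‖v - u n‖ * A := by ring
      _ < ε := h2
  have hFd : Differentiable ℂ F := by
    rw [← differentiableOn_univ]
    exact hloc.differentiableOn (Eventually.of_forall fun n => (hf n).differentiableOn)
      isOpen_univ
  obtain ⟨φ, hφ, hae⟩ := (tendstoInMeasure_of_tendsto_Lp huv).exists_seq_tendsto_ae
  refine ⟨F, hFd, ?_⟩
  have hall : ∀ᵐ z : ℂ, ∀ n, u n z = gaussian z * f n z := ae_all_iff.2 hfu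
  filter_upwards [hae, hall] with z h1 h2
  refine tendsto_nhds_unique h1 ?_
  simp_rw [h2]
  exact ((hF z).comp hφ.tendsto_atTop).const_mul _

instance instCompleteSpaceBargmannFock : CompleteSpace bargmannFock :=
  isClosed_bargmannFock.completeSpace_coe

/-- The orthogonal projection `Π` of `L²(ℂ)` on the Bargmann-Fock space. -/
noncomputable def fockProj : L2C →L[ℂ] L2C := bargmannFock.starProjection

/-- For `u ∈ 𝓔`, the function `|u|² u` is square integrable. -/
theorem memLp_cubic (u : bargmannFock) :
    MemLp (fun z : ℂ => ((‖(u : L2C) z‖ ^ 2 : ℝ) : ℂ) * (u : L2C) z) 2 volume := by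
  have hm : AEStronglyMeasurable (u : L2C) volume := (Lp.memLp (u : L2C)).1
  refine MemLp.of_le_mul (c := (Real.exp (1 / 2) * ‖(u : L2C)‖) ^ 2) (Lp.memLp (u : L2C)) ?_ ?_
  · exact (Complex.continuous_ofReal.comp_aestronglyMeasurable (hm.norm.pow 2)).mul hm
  · filter_upwards [norm_le_of_mem_bargmannFock u.2] with z hz
    rw [norm_mul, Complex.norm_real, norm_pow, norm_norm]
    gcongr

/-- The element `|u|² u` of `L²(ℂ)`, for `u ∈ 𝓔`. -/
noncomputable def cubic (u : bargmannFock) : L2C := (memLp_cubic u).toLp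

/-! ### The weighted spaces `L^{2,k}_𝓔` -/

/-- The norm `‖⟨z⟩^k g‖_{L²(ℂ)}`; meaningful when `⟨z⟩^k g` is square integrable. -/
noncomputable def weightedNorm (k : ℕ) (g : ℂ → ℂ) : ℝ :=
  (eLpNorm (fun z : ℂ => ((bracket z ^ k : ℝ) : ℂ) * g z) 2 volume).toReal

/-- The condition `⟨z⟩^k g ∈ L²(ℂ)`. -/
def MemWeighted (k : ℕ) (g : ℂ → ℂ) : Prop :=
  MemLp (fun z : ℂ => ((bracket z ^ k : ℝ) : ℂ) * g z) 2 volume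

/-- `L^{2,k}_𝓔` as a subspace of `𝓔`: the `u ∈ 𝓔` with `⟨z⟩^k u ∈ L²(ℂ)`. -/
noncomputable def weightedFockSubmodule (k : ℕ) : Submodule ℂ bargmannFock where
  carrier := {u | MemWeighted k (u : L2C)}
  add_mem' := by
    intro u v hu hv
    refine (MemLp.add hu hv).ae_eq ?_
    filter_upwards [Lp.coeFn_add (u : L2C) (v : L2C)] with z h1
    simp only [Pi.add_apply, Submodule.coe_add, h1]
    ring
  zero_mem' := by
    refine (MemLp.zero' (ε := ℂ)).ae_eq ?_
    filter_upwards [Lp.coeFn_zero ℂ 2 (volume : Measure ℂ)] with z h1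
    simp
  smul_mem' := by
    intro c u hu
    refine (MemLp.const_smul hu c).ae_eq ?_
    filter_upwards [Lp.coeFn_smul c (u : L2C)] with z h1
    simp only [Pi.smul_apply, Submodule.coe_smul, h1, smul_eq_mul]
    ring

/-- The space `L^{2,k}_𝓔`, to be equipped with the norm `‖⟨z⟩^k u‖_{L²(ℂ)}` (and not with the
norm of `L²(ℂ)`). -/
def WeightedFock (k : ℕ) : Type := weightedFockSubmodule k

namespace WeightedFock

noncomputable instance instAddCommGroup (k : ℕ) : AddCommGroup (WeightedFock k) :=
  inferInstanceAs (AddCommGroup (weightedFockSubmodule k))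

noncomputable instance instModule (k : ℕ) : Module ℂ (WeightedFock k) :=
  inferInstanceAs (Module ℂ (weightedFockSubmodule k))

/-- An element of `L^{2,k}_𝓔` as an element of `𝓔`. -/
def toFock {k : ℕ} (u : WeightedFock k) : bargmannFock := Subtype.val u

/-- An element of `L^{2,k}_𝓔` as a function on `ℂ` (defined almost everywhere). -/
noncomputable def toFun {k : ℕ} (u : WeightedFock k) : ℂ → ℂ := (u.toFock : L2C)

theorem memLp {k : ℕ} (u : WeightedFock k) :
    MemLp (fun z : ℂ => ((bracket z ^ k : ℝ) : ℂ) * u.toFun z) 2 volume := u.2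

/-- The linear map `u ↦ ⟨z⟩^k u` from `L^{2,k}_𝓔` to `L²(ℂ)`. -/
noncomputable def weightMap (k : ℕ) : WeightedFock k →ₗ[ℂ] L2C where
  toFun u := u.memLp.toLp
  map_add' u v := by
    refine Eq.trans ((MemLp.toLp_eq_toLp_iff _ (u.memLp.add v.memLp)).2 ?_)
      (MemLp.toLp_add u.memLp v.memLp)
    filter_upwards [Lp.coeFn_add (u.toFock : L2C) (v.toFock : L2C)] with z h1
    rw [Pi.add_apply, ← mul_add]
    exact congrArg _ h1
  map_smul' c u := by
    refine Eq.trans ((MemLp.toLp_eq_toLp_iff _ (u.memLp.const_smul c)).2 ?_)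
      (MemLp.toLp_const_smul c u.memLp)
    filter_upwards [Lp.coeFn_smul c (u.toFock : L2C)] with z h1
    rw [Pi.smul_apply, smul_eq_mul, mul_left_comm]
    exact congrArg _ h1

theorem weightMap_injective (k : ℕ) : Function.Injective (weightMap k) := by
  intro u v huv
  have h : (u.toFock : L2C) = (v.toFock : L2C) := by
    refine Lp.ext ?_
    filter_upwards [(MemLp.toLp_eq_toLp_iff u.memLp v.memLp).1 huv] with z hz
    refine mul_left_cancel₀ ?_ hz
    have : 0 < bracket z := Real.sqrt_pos.2 (by positivity)
    exact_mod_cast (pow_pos this k).ne'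
  exact Subtype.ext (Subtype.ext h)

noncomputable instance instNormedAddCommGroup (k : ℕ) : NormedAddCommGroup (WeightedFock k) :=
  NormedAddCommGroup.induced (WeightedFock k) L2C (weightMap k) (weightMap_injective k)

noncomputable instance instNormedSpace (k : ℕ) : NormedSpace ℂ (WeightedFock k) :=
  NormedSpace.induced ℂ (WeightedFock k) L2C (weightMap k)

theorem norm_eq {k : ℕ} (u : WeightedFock k) : ‖u‖ = weightedNorm k u.toFun :=
  Lp.norm_toLp _ u.memLp

end WeightedFock

/-- `u ∈ C^∞(ℝ, L^{2,k}_𝓔)` solves `i ∂_t u = Π(|u|² u)`, `u(0) = u₀`. -/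
structure IsLLLSolution (k : ℕ) (u₀ : WeightedFock k) (u : ℝ → WeightedFock k) : Prop where
  smooth : ContDiff ℝ ∞ u
  initial : u 0 = u₀
  equation : ∀ t : ℝ,
    Complex.I • ((deriv u t).toFock : L2C) = fockProj (cubic (u t).toFock)

/-! In the orthonormal basis of monomials, let c_n be the coefficients of u. Parseval against radial
weights gives `‖⟨z⟩^k u‖² = ∑ w_k(n) |c_n|²`, where `w_k = fockWeight k` is a polynomial of degree k
in n. The Taylor coefficients of a product become the convolution B(x,y)_s = ∑_{p+q=s} a(p,q) x_p
y_q, where a(p,q)² is the binomial law of parameter 1/2 on p+q=s. The n-th coefficient of 2π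
Π(|u|²u) is ∑_s conj(B(δ_n,c)_s) B(c,c)_s.

Along the flow, the derivative of ∑ w(n)|c_n|² is π⁻¹ ∑_s Im(conj(B(wc,c)_s) B(c,c)_s). The symmetry
p ↔ q replaces w(p) by (w(p)+w(q))/2, and any function g(p+q) can be subtracted because conj(B)B is
real (`im_conj_binomConv_mul`). If w is affine nothing remains, so the norms of order 0 and 1 are
conserved. If w = w_k with k = j+2 and g(s) is the value of the polynomial at s/2, a second
difference of size (p-q)² (p+q+1)^j remains. The binomial law concentrates on |p-q| ~ √s, so (p-q)²
costs one power of s and not two. Cauchy-Schwarz with moments and inverse moments of that law yields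
`|(‖u‖_k²)'| ≤ C ‖u‖_1² ‖u‖_{k-2}²` (`exists_abs_im_conj_binomConv_mul_le`,
`exists_abs_re_inner_fockField_le`).

For k = 2 the right side is conserved. For k ≥ 3, interpolating order k-2 between orders 1 and k
turns this into a bound for the derivative of `‖u‖_k^{2θ}`, θ = 2/(k-1), by a constant, whence the
exponent (k-1)/4. The last estimate combines `‖u‖_2² ≤ ‖u‖_1 ‖u‖_3` with the case k = 3.

For well-posedness, the sequence √w_k(n) c_n identifies the weighted space with ℓ², where the
equation is an ODE with a smooth cubic field. The field is bounded by `C ‖u‖_0² ‖u‖_k`, so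
conservation of the L² norm and Gronwall's inequality exclude blow-up. -/

/-! ### Parseval's identity on circles and against radial weights -/

theorem hasSum_mul_conj_prod {x : ℕ → ℂ} {s : ℂ} (h : HasSum x s) (hn : Summable fun n => ‖x n‖) :
    HasSum (fun p : ℕ × ℕ => x p.1 * starRingEnd ℂ (x p.2)) ((‖s‖ ^ 2 : ℝ) : ℂ) := by
  have h2 : HasSum (fun n => starRingEnd ℂ (x n)) (starRingEnd ℂ s) :=
    Complex.hasSum_conj'.2 h
  have hn2 : Summable fun n => ‖starRingEnd ℂ (x n)‖ := by
    simpa only [RCLike.norm_conj] using hn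
  rw [← Complex.normSq_eq_norm_sq, ← Complex.mul_conj]
  have h3 : Summable fun p : ℕ × ℕ => x p.1 * starRingEnd ℂ (x p.2) :=
    summable_mul_of_summable_norm (f := x) (g := fun n => starRingEnd ℂ (x n)) hn hn2
  exact HasSum.mul (f := x) (g := fun n => starRingEnd ℂ (x n)) h h2 h3

theorem integral_exp_sub_nat_mul_I (n m : ℕ) :
    ∫ θ in (-Real.pi)..Real.pi, Complex.exp (((n : ℂ) - m) * Complex.I * θ)
      = if n = m then 2 * (Real.pi : ℂ) else 0 := by
  split_ifs with h
  · subst h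
    simp
    ring
  · have hc : ((n : ℂ) - m) * Complex.I ≠ 0 :=
      mul_ne_zero (sub_ne_zero.2 (by exact_mod_cast h)) Complex.I_ne_zero
    rw [integral_exp_mul_complex hc, div_eq_zero_iff]
    left
    rw [sub_eq_zero, Complex.exp_eq_exp_iff_exists_int]
    refine ⟨(n : ℤ) - m, ?_⟩
    push_cast
    ring

/-- Parseval's identity on a circle, for an absolutely convergent power series. -/
theorem hasSum_norm_sq_circle {a : ℕ → ℂ} {r : ℝ} (hr : 0 ≤ r) {F : ℝ → ℂ}
    (hF : ∀ θ : ℝ, HasSum (fun n => a n * circleMap 0 r θ ^ n) (F θ))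
    (hs : Summable fun n => ‖a n‖ * r ^ n) :
    HasSum (fun n => 2 * Real.pi * (‖a n‖ ^ 2 * r ^ (2 * n)))
      (∫ θ in (-Real.pi)..Real.pi, ‖F θ‖ ^ 2) := by
  set G : ℕ × ℕ → C(ℝ, ℂ) := fun p =>
    ⟨fun θ => a p.1 * (starRingEnd ℂ (a p.2)) * r ^ (p.1 + p.2)
      * Complex.exp (((p.1 : ℂ) - p.2) * Complex.I * θ), by fun_prop⟩ with hG
  have hGn : ∀ p θ, ‖G p θ‖ = (‖a p.1‖ * r ^ p.1) * (‖a p.2‖ * r ^ p.2) := by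
    intro p θ
    simp only [hG, ContinuousMap.coe_mk, norm_mul, Complex.norm_exp, RCLike.norm_conj, norm_pow,
      Complex.norm_real, Real.norm_eq_abs, abs_of_nonneg hr]
    simp
    ring
  have hsum2 : Summable fun p : ℕ × ℕ => (‖a p.1‖ * r ^ p.1) * (‖a p.2‖ * r ^ p.2) :=
    hs.mul_of_nonneg hs (fun n => by positivity) (fun n => by positivity)
  have hpt : ∀ θ : ℝ, HasSum (fun p => G p θ) ((‖F θ‖ ^ 2 : ℝ) : ℂ) := by
    intro θ
    have h1 := hF θ
    have hn : Summable fun n => ‖a n * circleMap 0 r θ ^ n‖ := by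
      refine hs.congr fun n => ?_
      simp [abs_of_nonneg hr]
    have h3 := hasSum_mul_conj_prod h1 hn
    convert h3 using 2 with p
    simp only [hG, ContinuousMap.coe_mk, circleMap_zero, map_mul, map_pow, map_natCast,
      Complex.conj_ofReal, ← Complex.exp_conj, Complex.conj_I, mul_pow, ← Complex.exp_nat_mul]
    rw [show ((p.1 : ℂ) - p.2) * Complex.I * θ
      = (p.1 : ℂ) * (θ * Complex.I) + (p.2 : ℂ) * (θ * -Complex.I) by ring, Complex.exp_add]
    ring
  -- The double series for `‖F θ‖ ^ 2` is dominated by a summable family independent of θ, so it may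
  -- be integrated termwise; orthogonality of the characters then leaves the diagonal.
  have h4 : HasSum (fun p => ∫ θ in (-Real.pi)..Real.pi, G p θ)
      (∫ θ in (-Real.pi)..Real.pi, ((‖F θ‖ ^ 2 : ℝ) : ℂ)) := by
    refine intervalIntegral.hasSum_integral_of_dominated_convergence
      (fun p _ => (‖a p.1‖ * r ^ p.1) * (‖a p.2‖ * r ^ p.2))
      (fun p => (G p).continuous.aestronglyMeasurable)
      (fun p => ae_of_all _ fun θ _ => (hGn p θ).le)
      (ae_of_all _ fun θ _ => hsum2) ?_ (ae_of_all _ fun θ _ => hpt θ)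
    exact intervalIntegrable_const
  have h5 : ∀ p : ℕ × ℕ, ∫ θ in (-Real.pi)..Real.pi, G p θ
      = a p.1 * (starRingEnd ℂ (a p.2)) * r ^ (p.1 + p.2)
        * (if p.1 = p.2 then 2 * (Real.pi : ℂ) else 0) := by
    intro p
    rw [← integral_exp_sub_nat_mul_I, ← intervalIntegral.integral_const_mul]
    rfl
  simp_rw [h5] at h4
  have hinj : Function.Injective (fun n : ℕ => (n, n)) := fun n m h => (Prod.mk.inj h).1
  rw [← hinj.hasSum_iff, intervalIntegral.integral_ofReal] at h4
  · rw [← Complex.hasSum_ofReal]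
    convert h4 using 2 with n
    simp only [Function.comp, if_true]
    rw [Complex.mul_conj, Complex.normSq_eq_norm_sq]
    push_cast
    ring
  · rintro ⟨n, m⟩ h
    have : n ≠ m := fun e => h ⟨n, by simp [e]⟩
    simp [this]

theorem summable_norm_mul_pow_of_entire {f : ℂ → ℂ} {a : ℕ → ℂ}
    (ha : ∀ z, HasSum (fun n => a n * z ^ n) (f z)) (r : ℝ) :
    Summable fun n => ‖a n‖ * r ^ n := by
  have h := (ha ((|r| : ℝ) : ℂ)).summable.norm
  refine Summable.of_norm (h.congr fun n => ?_)
  simp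

theorem lintegral_norm_sq_circle {f : ℂ → ℂ} {a : ℕ → ℂ} (hf : Continuous f)
    (ha : ∀ z, HasSum (fun n => a n * z ^ n) (f z)) {r : ℝ} (hr : 0 ≤ r) :
    ∫⁻ θ in Set.Ioo (-Real.pi) Real.pi, ‖f (circleMap 0 r θ)‖ₑ ^ 2
      = ∑' n, ‖a n‖ₑ ^ 2 * ENNReal.ofReal (2 * Real.pi * r ^ (2 * n)) := by
  have hs := summable_norm_mul_pow_of_entire ha r
  have h := hasSum_norm_sq_circle hr (F := fun θ => f (circleMap 0 r θ))
    (fun θ => ha _) hs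
  have hc : Continuous fun θ => ‖f (circleMap 0 r θ)‖ ^ 2 := by fun_prop
  rw [intervalIntegral.integral_of_le (by linarith [Real.pi_pos]),
    integral_Ioc_eq_integral_Ioo] at h
  have e1 : ∀ θ, ‖f (circleMap 0 r θ)‖ₑ ^ 2 = ENNReal.ofReal (‖f (circleMap 0 r θ)‖ ^ 2) := by
    intro θ
    rw [ENNReal.ofReal_pow (norm_nonneg _), ofReal_norm]
  simp_rw [e1]
  rw [← ofReal_integral_eq_lintegral_ofReal
    ((hc.integrableOn_Icc).mono_set Set.Ioo_subset_Icc_self)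
    (ae_of_all _ fun θ => by positivity), ← h.tsum_eq,
    ENNReal.ofReal_tsum_of_nonneg (fun n => by positivity) h.summable]
  refine tsum_congr fun n => ?_
  rw [← ofReal_norm, ← ENNReal.ofReal_pow (norm_nonneg _), ← ENNReal.ofReal_mul (by positivity)]
  congr 1
  ring

theorem lintegral_norm_sq_mul_radial_aux {f : ℂ → ℂ} {a : ℕ → ℂ} (hf : Continuous f)
    (ha : ∀ z, HasSum (fun n => a n * z ^ n) (f z)) {ρ : ℝ → ℝ≥0∞} (hρ : Measurable ρ) :
    ∫⁻ z : ℂ, ‖f z‖ₑ ^ 2 * ρ ‖z‖ = ∑' n, ‖a n‖ₑ ^ 2 *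
      ∫⁻ r in Set.Ioi (0 : ℝ), ENNReal.ofReal (2 * Real.pi * r ^ (2 * n)) *
        (ENNReal.ofReal r * ρ r) := by
  rw [← Complex.lintegral_comp_polarCoord_symm, polarCoord_target]
  have hm : Measurable (fun p : ℝ × ℝ => ENNReal.ofReal p.1 •
      (‖f (Complex.polarCoord.symm p)‖ₑ ^ 2 * ρ ‖Complex.polarCoord.symm p‖)) := by
    have h0 : Measurable (fun p : ℝ × ℝ => Complex.polarCoord.symm p) := by
      simp only [Complex.polarCoord_symm_apply]
      fun_prop
    exact (ENNReal.measurable_ofReal.comp measurable_fst).smul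
      (((hf.measurable.comp h0).enorm.pow_const 2).mul (hρ.comp h0.norm))
  rw [Measure.volume_eq_prod, ← Measure.prod_restrict, lintegral_prod _ hm.aemeasurable]
  have hin : ∀ r ∈ Set.Ioi (0 : ℝ), ∫⁻ θ in Set.Ioo (-Real.pi) Real.pi,
      ENNReal.ofReal r • (‖f (Complex.polarCoord.symm (r, θ))‖ₑ ^ 2 *
        ρ ‖Complex.polarCoord.symm (r, θ)‖)
      = ∑' n, ‖a n‖ₑ ^ 2 * (ENNReal.ofReal (2 * Real.pi * r ^ (2 * n)) *
        (ENNReal.ofReal r * ρ r)) := by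
    intro r hr
    have e1 : ∀ θ : ℝ, Complex.polarCoord.symm (r, θ) = circleMap 0 r θ := by
      intro θ
      rw [Complex.polarCoord_symm_apply, circleMap_zero, Complex.exp_mul_I]
      push_cast
      ring
    have e2 : ∀ θ : ℝ, ‖circleMap 0 r θ‖ = r := by
      intro θ
      simp [abs_of_pos (Set.mem_Ioi.1 hr)]
    have e3 : ∀ θ : ℝ, ENNReal.ofReal r • (‖f (Complex.polarCoord.symm (r, θ))‖ₑ ^ 2 *
        ρ ‖Complex.polarCoord.symm (r, θ)‖)
        = ‖f (circleMap 0 r θ)‖ₑ ^ 2 * (ENNReal.ofReal r * ρ r) := by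
      intro θ
      rw [e1, e2, smul_eq_mul]
      ring
    simp_rw [e3]
    have hcm : Continuous fun θ => f (circleMap 0 r θ) := by fun_prop
    rw [lintegral_mul_const _ (hcm.measurable.enorm.pow_const 2),
      lintegral_norm_sq_circle hf ha (le_of_lt hr), ← ENNReal.tsum_mul_right]
    exact tsum_congr fun n => mul_assoc _ _ _
  rw [setLIntegral_congr_fun measurableSet_Ioi hin, lintegral_tsum]
  · refine tsum_congr fun n => ?_
    rw [lintegral_const_mul]
    fun_prop
  · intro n
    fun_prop

/-- Parseval's identity for an entire function, against a radial weight. -/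
theorem lintegral_norm_sq_mul_radial {f : ℂ → ℂ} {a : ℕ → ℂ} (hf : Continuous f)
    (ha : ∀ z, HasSum (fun n => a n * z ^ n) (f z)) {ρ : ℝ → ℝ≥0∞} (hρ : Measurable ρ) :
    ∫⁻ z : ℂ, ‖f z‖ₑ ^ 2 * ρ ‖z‖ = ∑' n, ‖a n‖ₑ ^ 2 * ∫⁻ z : ℂ, ‖z‖ₑ ^ (2 * n) * ρ ‖z‖ := by
  rw [lintegral_norm_sq_mul_radial_aux hf ha hρ]
  refine tsum_congr fun n => ?_
  congr 1
  -- The same identity for the single monomial z^n recognises the radial integral as a moment over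
  -- the plane.
  have h := lintegral_norm_sq_mul_radial_aux (f := fun z => z ^ n)
    (a := Pi.single n (1 : ℂ)) (continuous_pow n) (fun z => by
      convert hasSum_single n (f := fun m => (Pi.single n (1 : ℂ) : ℕ → ℂ) m * z ^ m) ?_ using 1
      · simp
      · intro m hm
        simp [hm]) hρ
  simp_rw [enorm_pow, ← pow_mul, mul_comm n 2] at h
  rw [h, tsum_eq_single n]
  · simp
  · intro m hm
    simp [hm]

theorem hasSum_norm_sq_mul_radial {f : ℂ → ℂ} {a : ℕ → ℂ} (hf : Continuous f)
    (ha : ∀ z, HasSum (fun n => a n * z ^ n) (f z)) {ρ : ℝ → ℝ} (hρ : Measurable ρ)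
    (hρ0 : ∀ r, 0 ≤ ρ r) {M : ℕ → ℝ} (hM0 : ∀ n, 0 ≤ M n)
    (hM : ∀ n, ∫⁻ z : ℂ, ‖z‖ₑ ^ (2 * n) * ENNReal.ofReal (ρ ‖z‖) = ENNReal.ofReal (M n))
    (hi : Integrable fun z => ‖f z‖ ^ 2 * ρ ‖z‖) :
    HasSum (fun n => ‖a n‖ ^ 2 * M n) (∫ z, ‖f z‖ ^ 2 * ρ ‖z‖) := by
  have h := lintegral_norm_sq_mul_radial hf ha hρ.ennreal_ofReal
  simp_rw [hM] at h
  have e1 : ∀ z, ‖f z‖ₑ ^ 2 * ENNReal.ofReal (ρ ‖z‖) = ENNReal.ofReal (‖f z‖ ^ 2 * ρ ‖z‖) := by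
    intro z
    rw [ENNReal.ofReal_mul (by positivity), ENNReal.ofReal_pow (norm_nonneg _), ofReal_norm]
  have e2 : ∀ n, ‖a n‖ₑ ^ 2 * ENNReal.ofReal (M n) = ENNReal.ofReal (‖a n‖ ^ 2 * M n) := by
    intro n
    rw [ENNReal.ofReal_mul (by positivity), ENNReal.ofReal_pow (norm_nonneg _), ofReal_norm]
  have hp : ∀ n, 0 ≤ ‖a n‖ ^ 2 * M n := fun n => mul_nonneg (by positivity) (hM0 n)
  have hq : ∀ z, 0 ≤ ‖f z‖ ^ 2 * ρ ‖z‖ := fun z => mul_nonneg (by positivity) (hρ0 _)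
  simp_rw [e1, e2] at h
  rw [← ofReal_integral_eq_lintegral_ofReal hi (ae_of_all _ hq)] at h
  have hne : ∑' n, ENNReal.ofReal (‖a n‖ ^ 2 * M n) ≠ ⊤ := by
    rw [← h]
    exact ENNReal.ofReal_ne_top
  have hs := ENNReal.summable_toReal hne
  simp_rw [ENNReal.toReal_ofReal (hp _)] at hs
  rw [← ENNReal.ofReal_tsum_of_nonneg hp hs,
    ENNReal.ofReal_eq_ofReal_iff (integral_nonneg hq) (tsum_nonneg hp)] at h
  rw [h]
  exact hs.hasSum

/-- Polarisation: the sesquilinear Parseval identity reduces to the quadratic one for f + c g, c a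
fourth root of unity. -/
theorem four_mul_conj_mul (x y : ℂ) :
    4 * (starRingEnd ℂ x * y) = ((‖x + y‖ ^ 2 : ℝ) : ℂ) - ((‖x + (-1) * y‖ ^ 2 : ℝ) : ℂ)
      - Complex.I * ((‖x + Complex.I * y‖ ^ 2 : ℝ) : ℂ)
      + Complex.I * ((‖x + (-Complex.I) * y‖ ^ 2 : ℝ) : ℂ) := by
  simp only [← Complex.normSq_eq_norm_sq, ← Complex.mul_conj, map_add, map_mul, map_neg, map_one,
    Complex.conj_I]
  linear_combination (2 * starRingEnd ℂ x * y + 2 * starRingEnd ℂ y * x * (-1)) *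
    Complex.I_sq

/-- Parseval's identity for a pair of entire functions, against a radial weight. -/
theorem hasSum_conj_mul_radial {f g : ℂ → ℂ} {a b : ℕ → ℂ} (hf : Continuous f) (hg : Continuous g)
    (ha : ∀ z, HasSum (fun n => a n * z ^ n) (f z)) (hb : ∀ z, HasSum (fun n => b n * z ^ n) (g z))
    {ρ : ℝ → ℝ} (hρ : Measurable ρ)
    (hρ0 : ∀ r, 0 ≤ ρ r) {M : ℕ → ℝ} (hM0 : ∀ n, 0 ≤ M n)
    (hM : ∀ n, ∫⁻ z : ℂ, ‖z‖ₑ ^ (2 * n) * ENNReal.ofReal (ρ ‖z‖) = ENNReal.ofReal (M n))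
    (hfi : Integrable fun z => ‖f z‖ ^ 2 * ρ ‖z‖) (hgi : Integrable fun z => ‖g z‖ ^ 2 * ρ ‖z‖) :
    HasSum (fun n => starRingEnd ℂ (a n) * b n * M n)
      (∫ z, starRingEnd ℂ (f z) * g z * (ρ ‖z‖ : ℝ)) := by
  have hint : ∀ c : ℂ, ‖c‖ = 1 → Integrable fun z => ‖f z + c * g z‖ ^ 2 * ρ ‖z‖ := by
    intro c hc
    refine Integrable.mono' ((hfi.add hgi).const_mul 2) ?_ (ae_of_all _ fun z => ?_)
    · exact ((hf.add (continuous_const.mul hg)).norm.pow 2).measurable.mul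
        (hρ.comp measurable_norm) |>.aestronglyMeasurable
    · rw [Real.norm_of_nonneg (mul_nonneg (by positivity) (hρ0 _)), Pi.add_apply, ← add_mul,
        ← mul_assoc]
      refine mul_le_mul_of_nonneg_right ?_ (hρ0 _)
      have h1 : ‖f z + c * g z‖ ≤ ‖f z‖ + ‖g z‖ := by
        refine (norm_add_le _ _).trans ?_
        rw [norm_mul, hc, one_mul]
      nlinarith [norm_nonneg (f z + c * g z), sq_nonneg (‖f z‖ - ‖g z‖)]
  have hsum : ∀ c : ℂ, ‖c‖ = 1 → HasSum (fun n => ((‖a n + c * b n‖ ^ 2 * M n : ℝ) : ℂ))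
      (∫ z, ((‖f z + c * g z‖ ^ 2 * ρ ‖z‖ : ℝ) : ℂ)) := by
    intro c hc
    rw [integral_complex_ofReal, Complex.hasSum_ofReal]
    refine hasSum_norm_sq_mul_radial (hf.add (continuous_const.mul hg)) (fun z => ?_) hρ hρ0 hM0 hM
      (hint c hc)
    have h := (ha z).add ((hb z).mul_left c)
    simp_rw [← mul_assoc, ← add_mul] at h
    exact h
  have e : ∀ x y : ℂ, ∀ t : ℝ, starRingEnd ℂ x * y * t = 4⁻¹ * (
      ((‖x + 1 * y‖ ^ 2 * t : ℝ) : ℂ) - ((‖x + (-1) * y‖ ^ 2 * t : ℝ) : ℂ)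
      - Complex.I * ((‖x + Complex.I * y‖ ^ 2 * t : ℝ) : ℂ)
      + Complex.I * ((‖x + (-Complex.I) * y‖ ^ 2 * t : ℝ) : ℂ)) := by
    intro x y t
    have := four_mul_conj_mul x y
    rw [one_mul]
    push_cast at this ⊢
    linear_combination (t / 4 : ℂ) * this
  simp_rw [e]
  have i1 := (hint 1 (by simp)).ofReal (𝕜 := ℂ)
  have i2 := (hint (-1) (by simp)).ofReal (𝕜 := ℂ)
  have i3 := (hint Complex.I (by simp)).ofReal (𝕜 := ℂ)
  have i4 := (hint (-Complex.I) (by simp)).ofReal (𝕜 := ℂ)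
  have hS := ((((hsum 1 (by simp)).sub (hsum (-1) (by simp))).sub
    ((hsum Complex.I (by simp)).mul_left Complex.I)).add
    ((hsum (-Complex.I) (by simp)).mul_left Complex.I)).mul_left 4⁻¹
  refine (congrArg (HasSum _) ?_).mpr hS
  rw [integral_const_mul, integral_add, integral_sub, integral_sub, integral_const_mul,
    integral_const_mul]
  · exact i1
  · exact i2
  · exact i1.sub i2
  · exact i3.const_mul _
  · exact (i1.sub i2).sub (i3.const_mul _)
  · exact i4.const_mul _

/-! ### Gaussian moments and the weights `fockWeight` -/

theorem integral_norm_pow_mul_exp (n : ℕ) {b : ℝ} (hb : 0 < b) :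
    ∫ z : ℂ, ‖z‖ ^ (2 * n) * Real.exp (-b * ‖z‖ ^ 2) = Real.pi * n.factorial / b ^ (n + 1) := by
  have h := Complex.integral_rpow_mul_exp_neg_mul_rpow (p := 2) (q := (2 * n : ℕ)) (by norm_num)
    (by have : (0 : ℝ) ≤ (2 * n : ℕ) := Nat.cast_nonneg _
        linarith) hb
  rw [show (((2 * n : ℕ) : ℝ) + 2) / 2 = n + 1 by push_cast; ring, Real.Gamma_nat_eq_factorial,
    show -(((2 * n : ℕ) : ℝ) + 2) / 2 = -((n + 1 : ℕ) : ℝ) by push_cast; ring,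
    Real.rpow_neg hb.le, Real.rpow_natCast] at h
  simp_rw [Real.rpow_natCast, Real.rpow_two] at h
  rw [h]
  field_simp

/-- A non-integrable function would have integral 0 by convention, whereas the computed value is
positive. -/
theorem integrable_norm_pow_mul_exp (n : ℕ) {b : ℝ} (hb : 0 < b) :
    Integrable fun z : ℂ => ‖z‖ ^ (2 * n) * Real.exp (-b * ‖z‖ ^ 2) := by
  by_contra h
  have h1 := integral_norm_pow_mul_exp n hb
  rw [integral_undef h] at h1
  have : 0 < Real.pi * n.factorial / b ^ (n + 1) := by positivity
  exact this.ne h1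

theorem lintegral_norm_pow_mul_exp (n : ℕ) {b : ℝ} (hb : 0 < b) :
    ∫⁻ z : ℂ, ‖z‖ₑ ^ (2 * n) * ENNReal.ofReal (Real.exp (-b * ‖z‖ ^ 2))
      = ENNReal.ofReal (Real.pi * n.factorial / b ^ (n + 1)) := by
  rw [← integral_norm_pow_mul_exp n hb, ofReal_integral_eq_lintegral_ofReal
    (integrable_norm_pow_mul_exp n hb) (ae_of_all _ fun z => by positivity)]
  refine lintegral_congr fun z => ?_
  rw [ENNReal.ofReal_mul (by positivity), ENNReal.ofReal_pow (norm_nonneg _), ofReal_norm]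

/-- The diagonal symbol of `⟨z⟩^{2k}` in the monomial basis of the Bargmann-Fock space. -/
noncomputable def fockWeight (k n : ℕ) : ℝ :=
  ∑ j ∈ Finset.range (k + 1), (k.choose j : ℝ) * ((n + 1).ascFactorial j : ℝ)

theorem fockWeight_nonneg (k n : ℕ) : 0 ≤ fockWeight k n :=
  Finset.sum_nonneg fun _ _ => by positivity

/-- Expanding (1+|z|²)^k by the binomial theorem produces the moments (n+j)! = n! (n+1)⋯(n+j). -/
theorem lintegral_norm_pow_mul_bracket (k n : ℕ) :
    ∫⁻ z : ℂ, ‖z‖ₑ ^ (2 * n) * ENNReal.ofReal ((1 + ‖z‖ ^ 2) ^ k * Real.exp (-‖z‖ ^ 2))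
      = ENNReal.ofReal (Real.pi * n.factorial * fockWeight k n) := by
  have e : ∀ z : ℂ, ‖z‖ₑ ^ (2 * n) * ENNReal.ofReal ((1 + ‖z‖ ^ 2) ^ k * Real.exp (-‖z‖ ^ 2))
      = ∑ j ∈ Finset.range (k + 1), (k.choose j : ℝ≥0∞) *
        (‖z‖ₑ ^ (2 * (n + j)) * ENNReal.ofReal (Real.exp (-1 * ‖z‖ ^ 2))) := by
    intro z
    rw [ENNReal.ofReal_mul (by positivity), add_comm, add_pow, ENNReal.ofReal_sum_of_nonneg
      (fun j _ => by positivity), Finset.sum_mul, Finset.mul_sum]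
    refine Finset.sum_congr rfl fun j _ => ?_
    rw [one_pow, mul_one, ENNReal.ofReal_mul (by positivity), ENNReal.ofReal_natCast, ← pow_mul,
      ENNReal.ofReal_pow (norm_nonneg _), ofReal_norm, neg_one_mul, mul_add, pow_add]
    ring
  simp_rw [e]
  rw [lintegral_finsetSum _ (fun j _ => by fun_prop), fockWeight, Finset.mul_sum,
    ENNReal.ofReal_sum_of_nonneg (fun j _ => by positivity)]
  refine Finset.sum_congr rfl fun j _ => ?_
  rw [lintegral_const_mul _ (by fun_prop), lintegral_norm_pow_mul_exp _ one_pos,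
    ← ENNReal.ofReal_natCast, ← ENNReal.ofReal_mul (by positivity)]
  congr 1
  rw [one_pow, div_one, ← Nat.factorial_mul_ascFactorial]
  push_cast
  ring

theorem norm_gaussian_sq (z : ℂ) : ‖gaussian z‖ ^ 2 = Real.exp (-‖z‖ ^ 2) := by
  rw [gaussian, Complex.norm_real, Real.norm_eq_abs, Real.abs_exp, ← Real.exp_nat_mul]
  congr 1
  push_cast
  ring

theorem conj_gaussian_mul_gaussian (z : ℂ) :
    starRingEnd ℂ (gaussian z) * gaussian z = (Real.exp (-‖z‖ ^ 2) : ℝ) := by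
  rw [mul_comm, Complex.mul_conj, Complex.normSq_eq_norm_sq, norm_gaussian_sq]

theorem continuous_gaussian : Continuous gaussian := by
  unfold gaussian
  fun_prop

/-! ### The monomial basis and the weighted norms in coefficients -/

/-- The normalised monomial `e^{-|z|²/2} z^n / √(π n!)`. -/
noncomputable def fockMonomial (n : ℕ) (z : ℂ) : ℂ :=
  gaussian z * ((Real.sqrt (Real.pi * n.factorial) : ℝ) : ℂ)⁻¹ * z ^ n

theorem memLp_fockMonomial (n : ℕ) : MemLp (fockMonomial n) 2 volume := by
  have hc : Continuous (fockMonomial n) := by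
    have := continuous_gaussian
    unfold fockMonomial
    fun_prop
  rw [memLp_two_iff_integrable_sq_norm hc.aestronglyMeasurable]
  refine ((integrable_norm_pow_mul_exp n one_pos).const_mul
    (‖((Real.sqrt (Real.pi * n.factorial) : ℝ) : ℂ)⁻¹‖ ^ 2)).congr (ae_of_all _ fun z => ?_)
  simp only [fockMonomial, norm_mul, mul_pow, norm_gaussian_sq, norm_pow, neg_mul, one_mul]
  ring

/-- The orthonormal basis of monomials of the Bargmann-Fock space. -/
noncomputable def fockBasis (n : ℕ) : L2C := (memLp_fockMonomial n).toLp

theorem coeFn_fockBasis (n : ℕ) : fockBasis n =ᵐ[volume] fun z =>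
    gaussian z * (((Real.sqrt (Real.pi * n.factorial) : ℝ) : ℂ)⁻¹ * z ^ n) := by
  filter_upwards [(memLp_fockMonomial n).coeFn_toLp] with z hz
  rw [fockBasis, hz, fockMonomial, mul_assoc]

theorem fockBasis_mem (n : ℕ) : fockBasis n ∈ bargmannFock :=
  ⟨_, by fun_prop, coeFn_fockBasis n⟩

theorem integrable_norm_sq_mul_exp {u : L2C} {f : ℂ → ℂ}
    (hu : u =ᵐ[volume] fun z => gaussian z * f z) :
    Integrable fun z => ‖f z‖ ^ 2 * Real.exp (-‖z‖ ^ 2) := by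
  refine (((memLp_two_iff_integrable_sq_norm (Lp.memLp u).1).1 (Lp.memLp u))).congr ?_
  filter_upwards [hu] with z hz
  rw [hz, norm_mul, mul_pow, norm_gaussian_sq, mul_comm]

theorem lintegral_norm_pow_mul_exp_neg (n : ℕ) :
    ∫⁻ z : ℂ, ‖z‖ₑ ^ (2 * n) * ENNReal.ofReal (Real.exp (-‖z‖ ^ 2))
      = ENNReal.ofReal (Real.pi * n.factorial) := by
  have h := lintegral_norm_pow_mul_exp n one_pos
  simpa only [neg_mul, one_mul, one_pow, div_one] using h

theorem hasSum_inner_fock {u v : L2C} {f g : ℂ → ℂ} {a b : ℕ → ℂ}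
    (hf : Continuous f) (hg : Continuous g)
    (ha : ∀ z, HasSum (fun n => a n * z ^ n) (f z)) (hb : ∀ z, HasSum (fun n => b n * z ^ n) (g z))
    (hu : u =ᵐ[volume] fun z => gaussian z * f z) (hv : v =ᵐ[volume] fun z => gaussian z * g z) :
    HasSum (fun n => starRingEnd ℂ (a n) * b n * (Real.pi * n.factorial : ℝ)) (inner ℂ u v) := by
  have h := hasSum_conj_mul_radial hf hg ha hb (ρ := fun r => Real.exp (-r ^ 2)) (by fun_prop)
    (fun r => (Real.exp_pos _).le) (M := fun n => Real.pi * n.factorial)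
    (fun n => by positivity) lintegral_norm_pow_mul_exp_neg (integrable_norm_sq_mul_exp hu)
    (integrable_norm_sq_mul_exp hv)
  convert h using 1
  rw [L2.inner_def]
  refine integral_congr_ae ?_
  filter_upwards [hu, hv] with z h1 h2
  rw [h1, h2, RCLike.inner_apply', map_mul, ← conj_gaussian_mul_gaussian]
  ring

theorem hasSum_single_mul_pow (n : ℕ) (c z : ℂ) :
    HasSum (fun m => (Pi.single n c : ℕ → ℂ) m * z ^ m) (c * z ^ n) := by
  convert hasSum_single n (f := fun m => (Pi.single n c : ℕ → ℂ) m * z ^ m) ?_ using 1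
  · simp
  · intro m hm
    simp [hm]

/-- The coefficient of `u` on the `n`-th normalised monomial. -/
noncomputable def fockCoeff (u : L2C) (n : ℕ) : ℂ := inner ℂ (fockBasis n) u

theorem fockCoeff_eq {u : L2C} {f : ℂ → ℂ} {a : ℕ → ℂ} (hf : Continuous f)
    (ha : ∀ z, HasSum (fun n => a n * z ^ n) (f z))
    (hu : u =ᵐ[volume] fun z => gaussian z * f z) (n : ℕ) :
    fockCoeff u n = (Real.sqrt (Real.pi * n.factorial) : ℝ) * a n := by
  have h := hasSum_inner_fock (by fun_prop) hf (hasSum_single_mul_pow n _) ha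
    (coeFn_fockBasis n) hu
  refine h.unique ?_
  convert hasSum_single n ?_ using 1
  · have h2 : ((Real.sqrt (Real.pi * n.factorial) : ℝ) : ℂ) ≠ 0 := by
      have : 0 < Real.sqrt (Real.pi * n.factorial) := Real.sqrt_pos.2 (by positivity)
      exact_mod_cast this.ne'
    have h3 : ((Real.pi * n.factorial : ℝ) : ℂ) = ((Real.sqrt (Real.pi * n.factorial) : ℝ) : ℂ)
        * ((Real.sqrt (Real.pi * n.factorial) : ℝ) : ℂ) := by
      rw [← Complex.ofReal_mul, Real.mul_self_sqrt (by positivity)]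
    rw [h3]
    simp only [Pi.single_eq_same, map_inv₀, Complex.conj_ofReal]
    field_simp
  · intro m hm
    simp [hm]

theorem exists_hasSum_of_mem_bargmannFock {u : L2C} (hu : u ∈ bargmannFock) :
    ∃ f : ℂ → ℂ, Differentiable ℂ f ∧ (u =ᵐ[volume] fun z => gaussian z * f z) ∧
      ∀ z, HasSum (fun n => fockCoeff u n / (Real.sqrt (Real.pi * n.factorial) : ℝ) * z ^ n)
        (f z) := by
  obtain ⟨f, hf, hfu⟩ := hu
  have ha : ∀ z, HasSum (fun n : ℕ => ((n.factorial : ℂ)⁻¹ * iteratedDeriv n f 0) * z ^ n) (f z) := by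
    intro z
    refine HasSum.congr_fun (f := fun n : ℕ => (n.factorial : ℂ)⁻¹ • (z - 0) ^ n • iteratedDeriv n f 0) (Complex.hasSum_taylorSeries_of_entire hf 0 z) fun n => ?_
    rw [sub_zero, smul_eq_mul, smul_eq_mul]
    ring
  refine ⟨f, hf, hfu, fun z => ?_⟩
  convert ha z using 3 with n
  rw [fockCoeff_eq hf.continuous ha hfu]
  have : 0 < Real.sqrt (Real.pi * n.factorial) := Real.sqrt_pos.2 (by positivity)
  rw [mul_div_cancel_left₀]
  exact_mod_cast this.ne'

theorem orthonormal_fockBasis : Orthonormal ℂ fockBasis := by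
  rw [orthonormal_iff_ite]
  intro n m
  have h := fockCoeff_eq (by fun_prop) (hasSum_single_mul_pow m _) (coeFn_fockBasis m) n
  rw [fockCoeff] at h
  rw [h]
  have : 0 < Real.sqrt (Real.pi * m.factorial) := Real.sqrt_pos.2 (by positivity)
  split_ifs with hnm
  · subst hnm
    rw [Pi.single_eq_same, mul_inv_cancel₀]
    exact_mod_cast this.ne'
  · rw [Pi.single_eq_of_ne hnm, mul_zero]

/-- The coefficients determine the Taylor series of the entire factor, hence the function: the
monomials are complete in the Bargmann-Fock space. -/
theorem fockCoeff_injOn {u v : L2C} (hu : u ∈ bargmannFock) (hv : v ∈ bargmannFock)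
    (h : ∀ n, fockCoeff u n = fockCoeff v n) : u = v := by
  obtain ⟨f, -, hfu, hf⟩ := exists_hasSum_of_mem_bargmannFock hu
  obtain ⟨g, -, hgv, hg⟩ := exists_hasSum_of_mem_bargmannFock hv
  have hfg : f = g := by
    funext z
    refine (hf z).unique ?_
    simp_rw [h]
    exact hg z
  refine Lp.ext ?_
  filter_upwards [hfu, hgv] with z h1 h2
  rw [h1, h2, hfg]

/-- Both sides are allowed to be infinite, so one identity gives the membership criterion and the
value of the norm. -/
theorem lintegral_bracket_pow_mul {u : L2C} (hu : u ∈ bargmannFock) (k : ℕ) :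
    ∫⁻ z : ℂ, ‖((bracket z ^ k : ℝ) : ℂ) * u z‖ₑ ^ 2
      = ∑' n, ENNReal.ofReal (fockWeight k n * ‖fockCoeff u n‖ ^ 2) := by
  obtain ⟨f, hfd, hfu, hf⟩ := exists_hasSum_of_mem_bargmannFock hu
  have h := lintegral_norm_sq_mul_radial hfd.continuous hf
    (ρ := fun r => ENNReal.ofReal ((1 + r ^ 2) ^ k * Real.exp (-r ^ 2))) (by fun_prop)
  simp_rw [lintegral_norm_pow_mul_bracket] at h
  have e1 : ∫⁻ z : ℂ, ‖((bracket z ^ k : ℝ) : ℂ) * u z‖ₑ ^ 2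
      = ∫⁻ z : ℂ, ‖f z‖ₑ ^ 2 * ENNReal.ofReal ((1 + ‖z‖ ^ 2) ^ k * Real.exp (-‖z‖ ^ 2)) := by
    refine lintegral_congr_ae ?_
    filter_upwards [hfu] with z hz
    rw [hz, ← ofReal_norm, ← ofReal_norm, ← ENNReal.ofReal_pow (norm_nonneg _),
      ← ENNReal.ofReal_pow (norm_nonneg _), ← ENNReal.ofReal_mul (by positivity)]
    congr 1
    have hb : bracket z ^ 2 = 1 + ‖z‖ ^ 2 := Real.sq_sqrt (by positivity)
    rw [norm_mul, norm_mul, mul_pow, mul_pow, norm_gaussian_sq, Complex.norm_real, Real.norm_eq_abs,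
      sq_abs, ← pow_mul, mul_comm k, pow_mul, hb]
    ring
  rw [e1, h]
  refine tsum_congr fun n => ?_
  rw [← ofReal_norm, ← ENNReal.ofReal_pow (norm_nonneg _), ← ENNReal.ofReal_mul (by positivity)]
  congr 1
  rw [norm_div, div_pow, Complex.norm_real, Real.norm_eq_abs, sq_abs, Real.sq_sqrt (by positivity)]
  field_simp

theorem memWeighted_iff_summable {u : L2C} (hu : u ∈ bargmannFock) (k : ℕ) :
    MemWeighted k u ↔ Summable fun n => fockWeight k n * ‖fockCoeff u n‖ ^ 2 := by
  have hm : AEStronglyMeasurable (fun z : ℂ => ((bracket z ^ k : ℝ) : ℂ) * u z) volume := by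
    have hb : Continuous fun z : ℂ => ((bracket z ^ k : ℝ) : ℂ) := by
      unfold bracket
      fun_prop
    exact hb.aestronglyMeasurable.mul (Lp.memLp u).1
  have hp : ∀ n, 0 ≤ fockWeight k n * ‖fockCoeff u n‖ ^ 2 :=
    fun n => mul_nonneg (fockWeight_nonneg k n) (by positivity)
  have h1 : MemWeighted k u ↔ ∫⁻ z : ℂ, ‖((bracket z ^ k : ℝ) : ℂ) * u z‖ₑ ^ 2 < ⊤ := by
    rw [MemWeighted, MemLp, and_iff_right hm,
      eLpNorm_lt_top_iff_lintegral_rpow_enorm_lt_top (by norm_num) (by norm_num)]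
    norm_num
  rw [h1, lintegral_bracket_pow_mul hu]
  constructor
  · intro h
    have hs := ENNReal.summable_toReal h.ne
    simpa only [ENNReal.toReal_ofReal (hp _)] using hs
  · intro h
    rw [← ENNReal.ofReal_tsum_of_nonneg hp h]
    exact ENNReal.ofReal_lt_top

theorem weightedNorm_sq {u : L2C} (hu : u ∈ bargmannFock) {k : ℕ}
    (h : Summable fun n => fockWeight k n * ‖fockCoeff u n‖ ^ 2) :
    weightedNorm k u ^ 2 = ∑' n, fockWeight k n * ‖fockCoeff u n‖ ^ 2 := by
  have hp : ∀ n, 0 ≤ fockWeight k n * ‖fockCoeff u n‖ ^ 2 :=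
    fun n => mul_nonneg (fockWeight_nonneg k n) (by positivity)
  have h2 := lintegral_bracket_pow_mul hu k
  rw [← ENNReal.ofReal_tsum_of_nonneg hp h] at h2
  rw [weightedNorm, eLpNorm_eq_lintegral_rpow_enorm_toReal (by norm_num) (by norm_num),
    ← ENNReal.toReal_pow, ← ENNReal.rpow_natCast, ← ENNReal.rpow_mul]
  have e : (1 / (2 : ℝ≥0∞).toReal) * ((2 : ℕ) : ℝ) = 1 := by norm_num
  rw [e, ENNReal.rpow_one, ENNReal.toReal_ofNat]
  simp_rw [ENNReal.rpow_ofNat]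
  rw [h2, ENNReal.toReal_ofReal (tsum_nonneg hp)]

/-! ### Products and the cubic term as binomial convolutions -/

theorem hasSum_mul_pow_antidiagonal {x y : ℂ} {a b : ℕ → ℂ} {z : ℂ}
    (ha : HasSum (fun n => a n * z ^ n) x) (hb : HasSum (fun n => b n * z ^ n) y) :
    HasSum (fun n => (∑ p ∈ Finset.HasAntidiagonal.antidiagonal n, a p.1 * b p.2) * z ^ n) (x * y) := by
  have h := summable_norm_sum_mul_antidiagonal_of_summable_norm ha.summable.norm hb.summable.norm
  have h2 := tsum_mul_tsum_eq_tsum_sum_antidiagonal_of_summable_norm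
    ha.summable.norm hb.summable.norm
  rw [ha.tsum_eq, hb.tsum_eq] at h2
  rw [h2]
  refine HasSum.congr_fun h.of_norm.hasSum fun n => ?_
  rw [Finset.sum_mul]
  refine Finset.sum_congr rfl fun p hp => ?_
  rw [← Finset.HasAntidiagonal.mem_antidiagonal.1 hp, pow_add]
  ring

/-- The square root of the binomial law of parameter `1/2`. -/
noncomputable def binomAmp (p q : ℕ) : ℝ := Real.sqrt ((p + q).choose p / 2 ^ (p + q))

/-- The convolution of sequences which encodes the product of two functions. -/
noncomputable def binomConv (x y : ℕ → ℂ) (s : ℕ) : ℂ :=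
  ∑ p ∈ Finset.HasAntidiagonal.antidiagonal s, (binomAmp p.1 p.2 : ℂ) * (x p.1 * y p.2)

/-- The binomial amplitude is the ratio of normalising constants: for p+q=s it equals π √(s!/2^s) /
(√(π p!) √(π q!)). Up to a factor depending on s only, the convolution is thus the Cauchy product of
the Taylor coefficients. -/
theorem binomConv_eq (x y : ℕ → ℂ) (s : ℕ) :
    binomConv x y s = ((Real.pi * Real.sqrt (s.factorial / 2 ^ s) : ℝ) : ℂ) *
      ∑ p ∈ Finset.HasAntidiagonal.antidiagonal s, (x p.1 / (Real.sqrt (Real.pi * p.1.factorial) : ℝ)) *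
        (y p.2 / (Real.sqrt (Real.pi * p.2.factorial) : ℝ)) := by
  rw [binomConv, Finset.mul_sum]
  refine Finset.sum_congr rfl fun p hp => ?_
  have hs := Finset.HasAntidiagonal.mem_antidiagonal.1 hp
  have h : binomAmp p.1 p.2 = Real.pi * Real.sqrt (s.factorial / 2 ^ s) /
      (Real.sqrt (Real.pi * p.1.factorial) * Real.sqrt (Real.pi * p.2.factorial)) := by
    rw [binomAmp, hs, ← Real.sqrt_mul (by positivity)]
    have e : Real.pi = Real.sqrt (Real.pi ^ 2) := (Real.sqrt_sq Real.pi_pos.le).symm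
    conv_rhs => rw [e, ← Real.sqrt_mul (by positivity), ← Real.sqrt_div (by positivity),
      Real.sqrt_sq Real.pi_pos.le]
    congr 1
    have h1 := Nat.add_choose_mul_factorial_mul_factorial p.1 p.2
    rw [← Nat.choose_symm_add, hs] at h1
    have h2 : (s.choose p.1 : ℝ) * p.1.factorial * p.2.factorial = s.factorial := by
      exact_mod_cast h1
    rw [← h2]
    field_simp
  rw [h]
  push_cast
  ring

/-- The coefficients of `Π(|u|² u)`. -/
theorem hasSum_fockCoeff_cubic (u : bargmannFock) (n : ℕ) :
    HasSum (fun s => starRingEnd ℂ (binomConv (Pi.single n 1) (fockCoeff u) s)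
        * binomConv (fockCoeff u) (fockCoeff u) s)
      (2 * Real.pi * fockCoeff (fockProj (cubic u)) n) := by
  obtain ⟨f, hfd, hfu, hf⟩ := exists_hasSum_of_mem_bargmannFock u.2
  set w : ℕ → ℂ := fun n => ((Real.sqrt (Real.pi * n.factorial) : ℝ) : ℂ) with hw
  set a : ℕ → ℂ := fun n => fockCoeff u n / w n with ha
  have hF : ∀ z, HasSum _ _ := fun z =>
    hasSum_mul_pow_antidiagonal (hasSum_single_mul_pow n (w n)⁻¹ z) (hf z)
  have hG : ∀ z, HasSum _ _ := fun z => hasSum_mul_pow_antidiagonal (hf z) (hf z)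
  have hexp2 : ∀ z : ℂ, Real.exp (-2 * ‖z‖ ^ 2) = ‖gaussian z‖ ^ 2 * ‖gaussian z‖ ^ 2 := by
    intro z
    rw [norm_gaussian_sq, ← Real.exp_add]
    congr 1
    ring
  have hgf : ∀ z, ‖gaussian z * f z‖ ≤ Real.exp (1 / 2) * ‖(u : L2C)‖ :=
    norm_gaussian_mul_le hfd hfu
  set K := Real.exp (1 / 2) * ‖(u : L2C)‖ with hK
  have hint : ∀ {g : ℂ → ℂ} {v : L2C}, Continuous g → (v =ᵐ[volume] fun z => gaussian z * g z) →
      Integrable fun z => ‖g z * f z‖ ^ 2 * Real.exp (-2 * ‖z‖ ^ 2) := by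
    intro g v hg hv
    have hfc := hfd.continuous
    refine ((integrable_norm_sq_mul_exp hv).const_mul (K ^ 2)).mono'
      (by fun_prop) (ae_of_all _ fun z => ?_)
    rw [Real.norm_of_nonneg (by positivity), hexp2, ← norm_gaussian_sq]
    have h1 : ‖gaussian z * f z‖ ^ 2 ≤ K ^ 2 := by
      have := hgf z
      gcongr
    calc ‖g z * f z‖ ^ 2 * (‖gaussian z‖ ^ 2 * ‖gaussian z‖ ^ 2)
        = ‖gaussian z * f z‖ ^ 2 * (‖g z‖ ^ 2 * ‖gaussian z‖ ^ 2) := by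
          simp only [norm_mul]
          ring
      _ ≤ _ := mul_le_mul_of_nonneg_right h1 (by positivity)
  -- The four factors in the integral carry the weight exp(-2|z|²), whose moments π s!/2^(s+1)
  -- account for the powers of 2 in the binomial law.
  have h := hasSum_conj_mul_radial (ρ := fun r => Real.exp (-2 * r ^ 2))
    (((continuous_const.mul (continuous_pow n)).mul hfd.continuous))
    (hfd.continuous.mul hfd.continuous) hF hG (by fun_prop)
    (fun r => (Real.exp_pos _).le) (M := fun n => Real.pi * n.factorial / 2 ^ (n + 1))
    (fun n => by positivity) (fun n => lintegral_norm_pow_mul_exp n two_pos)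
    (hint (by fun_prop) (coeFn_fockBasis n)) (hint hfd.continuous hfu)
  have hval : fockCoeff (fockProj (cubic u)) n = ∫ z : ℂ, starRingEnd ℂ ((w n)⁻¹ * z ^ n * f z) *
      (f z * f z) * ((Real.exp (-2 * ‖z‖ ^ 2) : ℝ) : ℂ) := by
    -- The projection is self-adjoint and fixes the basis vector, so it disappears from the pairing.
    rw [fockCoeff, fockProj, ← Submodule.inner_starProjection_left_eq_right,
      Submodule.starProjection_eq_self_iff.2 (fockBasis_mem n), L2.inner_def]
    refine integral_congr_ae ?_
    filter_upwards [hfu, coeFn_fockBasis n, (memLp_cubic u).coeFn_toLp] with z h1 h2 h3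
    rw [cubic, h3, h2, h1, RCLike.inner_apply', hexp2]
    simp only [← Complex.normSq_eq_norm_sq, Complex.ofReal_mul, ← Complex.mul_conj, map_mul]
    ring
  rw [hval]
  refine HasSum.congr_fun (h.mul_left (2 * Real.pi : ℂ)) fun s => ?_
  rw [binomConv_eq, binomConv_eq, map_mul, Complex.conj_ofReal]
  have e1 : ∀ p : ℕ × ℕ, (Pi.single n (1 : ℂ) : ℕ → ℂ) p.1 /
      (Real.sqrt (Real.pi * p.1.factorial) : ℝ) = (Pi.single n (w n)⁻¹ : ℕ → ℂ) p.1 := by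
    intro p
    rcases eq_or_ne p.1 n with h | h
    · rw [h]
      simp [hw]
    · simp [h]
  simp_rw [e1]
  have e2 : ((Real.pi * Real.sqrt (s.factorial / 2 ^ s) : ℝ) : ℂ) *
      ((Real.pi * Real.sqrt (s.factorial / 2 ^ s) : ℝ) : ℂ)
      = 2 * Real.pi * ((Real.pi * s.factorial / 2 ^ (s + 1) : ℝ) : ℂ) := by
    rw [← Complex.ofReal_mul, mul_mul_mul_comm, Real.mul_self_sqrt (by positivity)]
    push_cast
    rw [pow_succ]
    field_simp
  linear_combination (starRingEnd ℂ (∑ p ∈ Finset.HasAntidiagonal.antidiagonal s,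
    (Pi.single n (w n)⁻¹ : ℕ → ℂ) p.1 * (fockCoeff u p.2 / w p.2)) *
    ∑ p ∈ Finset.HasAntidiagonal.antidiagonal s, fockCoeff u p.1 / w p.1 * (fockCoeff u p.2 / w p.2)) * e2

/-! ### Growth and second differences of the weights -/

theorem fockWeight_zero (n : ℕ) : fockWeight 0 n = 1 := by
  simp [fockWeight]

theorem fockWeight_one (n : ℕ) : fockWeight 1 n = n + 2 := by
  simp [fockWeight, Finset.sum_range_succ, Nat.ascFactorial]
  ring

/-- The weights are moments of 1+|z|², hence log-convex in the order; here the difference is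
n³+6n²+12n+7. The constant 1 is what allows the last estimate of the theorem to have no constant in
front. -/
theorem fockWeight_two_sq_le (n : ℕ) :
    fockWeight 2 n ^ 2 ≤ fockWeight 1 n * fockWeight 3 n := by
  simp only [fockWeight, Finset.sum_range_succ, Nat.ascFactorial, Finset.range_zero,
    Finset.sum_empty, Nat.choose]
  push_cast
  rw [← sub_nonneg]
  ring_nf
  positivity

theorem pow_le_fockWeight (k n : ℕ) : ((n : ℝ) + 2) ^ k ≤ fockWeight k n := by
  rw [show (n : ℝ) + 2 = (n + 1 : ℝ) + 1 by ring, add_pow, fockWeight]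
  refine Finset.sum_le_sum fun j _ => ?_
  rw [one_pow, mul_one, mul_comm]
  refine mul_le_mul_of_nonneg_left ?_ (by positivity)
  exact_mod_cast Nat.pow_succ_le_ascFactorial (n + 1) j

theorem one_le_fockWeight (k n : ℕ) : 1 ≤ fockWeight k n :=
  le_trans (one_le_pow₀ (by linarith [(Nat.cast_nonneg n : (0 : ℝ) ≤ n)])) (pow_le_fockWeight k n)

theorem fockWeight_pos (k n : ℕ) : 0 < fockWeight k n :=
  zero_lt_one.trans_le (one_le_fockWeight k n)

theorem succ_pow_le_fockWeight (k n : ℕ) : ((n : ℝ) + 1) ^ k ≤ fockWeight k n :=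
  le_trans (by gcongr; norm_num) (pow_le_fockWeight k n)

theorem fockWeight_le_pow (k n : ℕ) :
    fockWeight k n ≤ 2 ^ k * k.factorial * ((n : ℝ) + 1) ^ k := by
  have h : ∀ j ∈ Finset.range (k + 1), (k.choose j : ℝ) * ((n + 1).ascFactorial j : ℝ)
      ≤ (k.choose j : ℝ) * (k.factorial * ((n : ℝ) + 1) ^ k) := by
    intro j hj
    have hjk : j ≤ k := Nat.lt_succ_iff.1 (Finset.mem_range.1 hj)
    refine mul_le_mul_of_nonneg_left ?_ (by positivity)
    calc ((n + 1).ascFactorial j : ℝ) ≤ j.factorial * ((n : ℝ) + 1) ^ j := by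
          exact_mod_cast Nat.ascFactorial_le_factorial_mul_pow (n + 1) j
      _ ≤ _ := by
          have h1 : (j.factorial : ℝ) ≤ k.factorial := by exact_mod_cast Nat.factorial_le hjk
          have h2 : ((n : ℝ) + 1) ^ j ≤ ((n : ℝ) + 1) ^ k :=
            pow_le_pow_right₀ (by linarith [(Nat.cast_nonneg n : (0 : ℝ) ≤ n)]) hjk
          gcongr
  refine (Finset.sum_le_sum h).trans ?_
  rw [← Finset.sum_mul, mul_assoc]
  have := Nat.sum_range_choose k
  rw [← Nat.cast_sum, this]
  push_cast
  rfl

theorem fockWeight_mono_right (k : ℕ) {n m : ℕ} (h : n ≤ m) : fockWeight k n ≤ fockWeight k m := by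
  refine Finset.sum_le_sum fun j _ => mul_le_mul_of_nonneg_left ?_ (by positivity)
  exact_mod_cast Nat.ascFactorial_le j (by omega : n + 1 ≤ m + 1)

theorem fockWeight_mono_left {j k : ℕ} (h : j ≤ k) (n : ℕ) : fockWeight j n ≤ fockWeight k n := by
  refine (Finset.sum_le_sum fun i _ => ?_).trans
    (Finset.sum_le_sum_of_subset_of_nonneg (Finset.range_mono (by omega : j + 1 ≤ k + 1))
      fun i _ _ => by positivity)
  refine mul_le_mul_of_nonneg_right ?_ (by positivity)
  exact_mod_cast Nat.choose_le_choose i h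

theorem fockWeight_add_le_mul (k n m : ℕ) :
    fockWeight k (n + m) ≤ 2 ^ k * k.factorial * (fockWeight k n * fockWeight k m) := by
  refine (fockWeight_le_pow k (n + m)).trans (mul_le_mul_of_nonneg_left ?_ (by positivity))
  refine le_trans ?_ (mul_le_mul (succ_pow_le_fockWeight k n) (succ_pow_le_fockWeight k m)
    (by positivity) (fockWeight_nonneg k n))
  rw [← mul_pow]
  refine pow_le_pow_left₀ (by positivity) ?_ k
  push_cast
  nlinarith [(Nat.cast_nonneg n : (0 : ℝ) ≤ n), (Nat.cast_nonneg m : (0 : ℝ) ≤ m)]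

/-- Unlike the submultiplicative bound, this one puts the weight on a single factor of a product, so
that the top norm enters product estimates linearly. The larger of n and m carries the weight. -/
theorem fockWeight_add_le_add (k n m : ℕ) :
    fockWeight k (n + m) ≤ 4 ^ k * k.factorial * (fockWeight k n + fockWeight k m) := by
  wlog h : n ≤ m generalizing n m
  · have := this m n (by omega)
    rwa [add_comm m n, add_comm (fockWeight k m)] at this
  refine (fockWeight_le_pow k (n + m)).trans ?_
  have h1 : (((n + m : ℕ) : ℝ) + 1) ^ k ≤ 2 ^ k * fockWeight k m := by
    refine le_trans ?_ (mul_le_mul_of_nonneg_left (succ_pow_le_fockWeight k m) (by positivity))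
    rw [← mul_pow]
    refine pow_le_pow_left₀ (by positivity) ?_ k
    have : (n : ℝ) ≤ m := by exact_mod_cast h
    push_cast
    linarith
  calc _ ≤ 2 ^ k * k.factorial * (2 ^ k * fockWeight k m) := by gcongr
    _ = 4 ^ k * k.factorial * fockWeight k m := by
        rw [show (4 : ℝ) = 2 * 2 by norm_num, mul_pow]
        ring
    _ ≤ _ := by
        refine mul_le_mul_of_nonneg_left ?_ (by positivity)
        linarith [fockWeight_nonneg k n]

open Polynomial in
theorem exists_polynomial_fockWeight (k : ℕ) :
    ∃ P : ℝ[X], P.natDegree ≤ k ∧ ∀ n : ℕ, fockWeight k n = P.eval (n : ℝ) := by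
  refine ⟨∑ j ∈ Finset.range (k + 1), C (k.choose j : ℝ) * (ascPochhammer ℝ j).comp (X + C 1),
    ?_, fun n => ?_⟩
  · refine natDegree_sum_le_of_forall_le _ _ fun j hj => ?_
    refine (natDegree_C_mul_le _ _).trans ?_
    rw [natDegree_comp, ascPochhammer_natDegree, natDegree_X_add_C, mul_one]
    exact Nat.lt_succ_iff.1 (Finset.mem_range.1 hj)
  · rw [eval_finsetSum, fockWeight]
    refine Finset.sum_congr rfl fun j _ => ?_
    have := ascPochhammer_nat_eq_ascFactorial (n + 1) j
    rw [eval_mul, eval_C, eval_comp, eval_add, eval_X, eval_C, ← this, ← Nat.cast_succ,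
      ascPochhammer_eval_cast]

/-- Since x+h and x-h are the roots of X² - 2xX + (x²-h²), the second differences obey a two-term
recurrence, which is why the induction carries the exponents i and i+1 together. The factor x² on
the left stands in for the exponent i-2, which may be negative. -/
theorem exists_abs_pow_second_difference_le (i : ℕ) : ∃ C : ℝ, 0 ≤ C ∧ ∀ x h : ℝ, |h| ≤ x →
    |(x + h) ^ i + (x - h) ^ i - 2 * x ^ i| * x ^ 2 ≤ C * h ^ 2 * x ^ i := by
  suffices H : ∃ C : ℝ, 0 ≤ C ∧ ∀ x h : ℝ, |h| ≤ x →
      |(x + h) ^ i + (x - h) ^ i - 2 * x ^ i| * x ^ 2 ≤ C * h ^ 2 * x ^ i ∧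
      |(x + h) ^ (i + 1) + (x - h) ^ (i + 1) - 2 * x ^ (i + 1)| * x ^ 2
        ≤ C * h ^ 2 * x ^ (i + 1) by
    obtain ⟨C, hC, H⟩ := H
    exact ⟨C, hC, fun x h hx => (H x h hx).1⟩
  induction i with
  | zero =>
    refine ⟨0, le_rfl, fun x h _ => ?_⟩
    rw [zero_mul, zero_mul, zero_mul, zero_add, pow_one, pow_one, pow_one, pow_zero, pow_zero,
      pow_zero, show x + h + (x - h) - 2 * x = 0 by ring, show (1 : ℝ) + 1 - 2 * 1 = 0 by norm_num]
    simp
  | succ i ih =>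
    obtain ⟨C, hC, H⟩ := ih
    -- The three terms of the recurrence contribute 2C, C and 2.
    refine ⟨3 * C + 2, by positivity, fun x h hx => ?_⟩
    obtain ⟨h1, h2⟩ := H x h hx
    have hx0 : 0 ≤ x := (abs_nonneg h).trans hx
    have hh : h ^ 2 ≤ x ^ 2 := sq_le_sq' (by linarith [neg_abs_le h]) (by linarith [le_abs_self h])
    have hp : 0 ≤ h ^ 2 * x ^ (i + 1) := by positivity
    refine ⟨h2.trans (by nlinarith), ?_⟩
    set T := (x + h) ^ i + (x - h) ^ i - 2 * x ^ i
    set T' := (x + h) ^ (i + 1) + (x - h) ^ (i + 1) - 2 * x ^ (i + 1)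
    have e : (x + h) ^ (i + 1 + 1) + (x - h) ^ (i + 1 + 1) - 2 * x ^ (i + 1 + 1)
        = 2 * x * T' - (x ^ 2 - h ^ 2) * T + 2 * h ^ 2 * x ^ i := by
      simp only [T, T']
      ring
    rw [e]
    have h3 : |2 * x * T' - (x ^ 2 - h ^ 2) * T + 2 * h ^ 2 * x ^ i|
        ≤ 2 * x * |T'| + x ^ 2 * |T| + 2 * h ^ 2 * x ^ i := by
      refine (abs_add_le _ _).trans (add_le_add ((abs_sub _ _).trans (add_le_add ?_ ?_)) ?_)
      · rw [abs_mul, abs_of_nonneg (by positivity : 0 ≤ 2 * x)]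
      · rw [abs_mul, abs_of_nonneg (by linarith : 0 ≤ x ^ 2 - h ^ 2)]
        exact mul_le_mul_of_nonneg_right (by nlinarith [sq_nonneg h]) (abs_nonneg _)
      · rw [abs_of_nonneg (by positivity)]
    calc _ ≤ (2 * x * |T'| + x ^ 2 * |T| + 2 * h ^ 2 * x ^ i) * x ^ 2 :=
          mul_le_mul_of_nonneg_right h3 (by positivity)
      _ = 2 * x * (|T'| * x ^ 2) + x ^ 2 * (|T| * x ^ 2) + 2 * h ^ 2 * x ^ i * x ^ 2 := by ring
      _ ≤ 2 * x * (C * h ^ 2 * x ^ (i + 1)) + x ^ 2 * (C * h ^ 2 * x ^ i)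
          + 2 * h ^ 2 * x ^ i * x ^ 2 := by gcongr
      _ = _ := by ring

/-- For i ≤ 1 the second difference vanishes; otherwise x² can be divided out, and x+1 ≥ 1 raises
the exponent i-2 to j. -/
theorem exists_abs_pow_second_difference_le' (i j : ℕ) (hij : i ≤ j + 2) :
    ∃ C : ℝ, 0 ≤ C ∧ ∀ x h : ℝ, |h| ≤ x →
      |(x + h) ^ i + (x - h) ^ i - 2 * x ^ i| ≤ C * h ^ 2 * (x + 1) ^ j := by
  obtain ⟨C, hC, H⟩ := exists_abs_pow_second_difference_le i
  refine ⟨C, hC, fun x h hx => ?_⟩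
  have hx0 : 0 ≤ x := (abs_nonneg h).trans hx
  rcases hx0.eq_or_lt with h0 | h0
  · have : h = 0 := by
      rw [← h0] at hx
      exact abs_eq_zero.1 (le_antisymm hx (abs_nonneg _))
    rw [this, add_zero, sub_zero, ← two_mul, sub_self, abs_zero]
    positivity
  · match i, hij, H with
    | 0, _, _ =>
      norm_num
      positivity
    | 1, _, _ =>
      rw [show (x + h) ^ 1 + (x - h) ^ 1 - 2 * x ^ 1 = 0 by ring, abs_zero]
      positivity
    | i + 2, hij, H =>
      have h1 := H x h hx
      rw [show C * h ^ 2 * x ^ (i + 2) = C * h ^ 2 * x ^ i * x ^ 2 by ring] at h1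
      refine (le_of_mul_le_mul_right h1 (by positivity)).trans ?_
      refine mul_le_mul_of_nonneg_left ?_ (by positivity)
      exact (pow_le_pow_left₀ hx0 (by linarith) i).trans
        (pow_le_pow_right₀ (by linarith) (by omega))

-- The function g is the polynomial at the midpoint (n+m)/2. With h = (n-m)/2 the left side is a
-- symmetric second difference, quadratic in n-m and two degrees lower in the size of n+m.
open Polynomial in
theorem exists_abs_fockWeight_second_difference_le (j : ℕ) : ∃ C : ℝ, 0 ≤ C ∧
    ∃ g : ℕ → ℝ, ∀ n m : ℕ,
      |fockWeight (j + 2) n + fockWeight (j + 2) m - 2 * g (n + m)|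
        ≤ C * ((n : ℝ) - m) ^ 2 * ((n : ℝ) + m + 1) ^ j := by
  obtain ⟨P, hP, hPw⟩ := exists_polynomial_fockWeight (j + 2)
  have hi : ∀ i : ℕ, ∃ C : ℝ, 0 ≤ C ∧ (i ≤ j + 2 → ∀ x h : ℝ, |h| ≤ x →
      |(x + h) ^ i + (x - h) ^ i - 2 * x ^ i| ≤ C * h ^ 2 * (x + 1) ^ j) := by
    intro i
    by_cases h : i ≤ j + 2
    · obtain ⟨C, h1, h2⟩ := exists_abs_pow_second_difference_le' i j h
      exact ⟨C, h1, fun _ => h2⟩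
    · exact ⟨0, le_rfl, fun h' => absurd h' h⟩
  choose C hC0 hC using hi
  have hD0 : 0 ≤ ∑ i ∈ Finset.range (j + 2 + 1), |P.coeff i| * C i :=
    Finset.sum_nonneg fun i _ => mul_nonneg (abs_nonneg _) (hC0 i)
  refine ⟨∑ i ∈ Finset.range (j + 2 + 1), |P.coeff i| * C i, hD0,
    fun s => P.eval ((s : ℝ) / 2), fun n m => ?_⟩
  set x : ℝ := ((n : ℝ) + m) / 2 with hx
  set h : ℝ := ((n : ℝ) - m) / 2 with hh
  have hn0 : (0 : ℝ) ≤ n := Nat.cast_nonneg n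
  have hm0 : (0 : ℝ) ≤ m := Nat.cast_nonneg m
  have hxh : |h| ≤ x := by
    rw [abs_le]
    constructor <;> simp only [hx, hh] <;> linarith
  have en : (n : ℝ) = x + h := by simp only [hx, hh]; ring
  have em : (m : ℝ) = x - h := by simp only [hx, hh]; ring
  have es : (((n + m : ℕ) : ℝ)) / 2 = x := by push_cast; rfl
  rw [hPw, hPw]
  dsimp only
  rw [es, en, em, show x + h + (x - h) + 1 = 2 * x + 1 by ring, show x + h - (x - h) = 2 * h by ring]
  simp only [eval_eq_sum_range' (Nat.lt_succ_of_le hP)]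
  rw [Finset.mul_sum, ← Finset.sum_add_distrib, ← Finset.sum_sub_distrib]
  calc _ ≤ ∑ i ∈ Finset.range (j + 2 + 1), |P.coeff i| * C i * (h ^ 2 * (x + 1) ^ j) := by
        refine (Finset.abs_sum_le_sum_abs _ _).trans (Finset.sum_le_sum fun i hi => ?_)
        rw [show P.coeff i * (x + h) ^ i + P.coeff i * (x - h) ^ i - 2 * (P.coeff i * x ^ i)
          = P.coeff i * ((x + h) ^ i + (x - h) ^ i - 2 * x ^ i) by ring, abs_mul, mul_assoc]
        refine mul_le_mul_of_nonneg_left ?_ (abs_nonneg _)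
        rw [← mul_assoc]
        exact hC i (Nat.lt_succ_iff.1 (Finset.mem_range.1 hi)) x h hxh
    _ ≤ _ := by
        rw [← Finset.sum_mul, mul_assoc]
        refine mul_le_mul_of_nonneg_left ?_ hD0
        have hx0 : 0 ≤ x := (abs_nonneg h).trans hxh
        refine mul_le_mul ?_ (pow_le_pow_left₀ (by linarith) (by linarith) j) (by positivity)
          (by positivity)
        nlinarith [sq_nonneg h]

/-! ### Moments and inverse moments of the binomial law -/

theorem binomAmp_sq (p q : ℕ) : binomAmp p q ^ 2 = (p + q).choose p / 2 ^ (p + q) :=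
  Real.sq_sqrt (by positivity)

theorem binomAmp_comm (p q : ℕ) : binomAmp p q = binomAmp q p := by
  rw [binomAmp, binomAmp, Nat.choose_symm_add, add_comm]

theorem sum_binomAmp_sq_mul (s : ℕ) (f : ℕ × ℕ → ℝ) :
    ∑ p ∈ Finset.HasAntidiagonal.antidiagonal s, binomAmp p.1 p.2 ^ 2 * f p
      = (∑ p ∈ Finset.HasAntidiagonal.antidiagonal s, s.choose p.1 * f p) / 2 ^ s := by
  rw [Finset.sum_div]
  refine Finset.sum_congr rfl fun p hp => ?_
  rw [binomAmp_sq, Finset.HasAntidiagonal.mem_antidiagonal.1 hp]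
  ring

/-- Under the binomial law p-q is a sum of s independent signs, each with Laplace transform cosh t.
-/
theorem sum_binomAmp_sq_mul_exp (s : ℕ) (t : ℝ) :
    ∑ p ∈ Finset.HasAntidiagonal.antidiagonal s,
      binomAmp p.1 p.2 ^ 2 * Real.exp (t * ((p.1 : ℝ) - p.2)) = Real.cosh t ^ s := by
  rw [sum_binomAmp_sq_mul, Real.cosh_eq, div_pow, (Commute.all (Real.exp t) (Real.exp (-t))).add_pow']
  congr 1
  refine Finset.sum_congr rfl fun p _ => ?_
  rw [nsmul_eq_mul, ← Real.exp_nat_mul, ← Real.exp_nat_mul, ← Real.exp_add]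
  congr 2
  ring

theorem sum_binomAmp_sq (s : ℕ) :
    ∑ p ∈ Finset.HasAntidiagonal.antidiagonal s, binomAmp p.1 p.2 ^ 2 = 1 := by
  have h := sum_binomAmp_sq_mul_exp s 0
  simpa using h

/-- The eighth moment of the centred binomial law. -/
theorem sum_binomAmp_sq_mul_pow_le (s : ℕ) :
    ∑ p ∈ Finset.HasAntidiagonal.antidiagonal s,
      binomAmp p.1 p.2 ^ 2 * ((p.1 : ℝ) - p.2) ^ 8
        ≤ 2 * Nat.factorial 8 * Real.exp (1 / 2) * ((s : ℝ) + 1) ^ 4 := by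
  -- At the scale t = (s+1)^(-1/2) the Laplace transform stays below exp(1/2), while t^8 accounts
  -- for the factor (s+1)^4; the shift by 1 covers s = 0.
  set t : ℝ := (Real.sqrt (s + 1))⁻¹ with ht
  have ht2 : t ^ 2 * ((s : ℝ) + 1) = 1 := by
    rw [ht, inv_pow, Real.sq_sqrt (by positivity), inv_mul_cancel₀ (by positivity)]
  have ht8 : t ^ 8 * ((s : ℝ) + 1) ^ 4 = 1 := by
    rw [show t ^ 8 * ((s : ℝ) + 1) ^ 4 = (t ^ 2 * ((s : ℝ) + 1)) ^ 4 by ring, ht2, one_pow]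
  have hcosh : Real.cosh t ^ s ≤ Real.exp (1 / 2) := by
    calc Real.cosh t ^ s ≤ Real.exp (t ^ 2 / 2) ^ s :=
          pow_le_pow_left₀ (Real.cosh_pos t).le (Real.cosh_le_exp_half_sq t) s
      _ = Real.exp (s * (t ^ 2 / 2)) := (Real.exp_nat_mul _ _).symm
      _ ≤ _ := by
          refine Real.exp_le_exp.2 ?_
          nlinarith [sq_nonneg t]
  have hpt : ∀ x : ℝ, (t * x) ^ 8 ≤ Nat.factorial 8 * (Real.exp (t * x) + Real.exp (-t * x)) := by
    intro x
    have h1 := Real.pow_div_factorial_le_exp |t * x| (abs_nonneg _) 8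
    rw [div_le_iff₀' (by positivity), (by decide : Even 8).pow_abs] at h1
    refine h1.trans (mul_le_mul_of_nonneg_left ?_ (by positivity))
    rcases abs_choice (t * x) with h | h <;> rw [h]
    · linarith [Real.exp_pos (-t * x)]
    · rw [neg_mul]
      linarith [Real.exp_pos (t * x)]
  calc _ = (∑ p ∈ Finset.HasAntidiagonal.antidiagonal s,
        binomAmp p.1 p.2 ^ 2 * (t * ((p.1 : ℝ) - p.2)) ^ 8) * ((s : ℝ) + 1) ^ 4 := by
        rw [Finset.sum_mul]
        refine Finset.sum_congr rfl fun p _ => ?_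
        rw [mul_pow]
        linear_combination (-(binomAmp p.1 p.2 ^ 2 * ((p.1 : ℝ) - p.2) ^ 8)) * ht8
    _ ≤ (∑ p ∈ Finset.HasAntidiagonal.antidiagonal s, binomAmp p.1 p.2 ^ 2 * (Nat.factorial 8 *
        (Real.exp (t * ((p.1 : ℝ) - p.2)) + Real.exp (-t * ((p.1 : ℝ) - p.2)))))
          * ((s : ℝ) + 1) ^ 4 := by
        gcongr with p _
        exact hpt _
    _ = Nat.factorial 8 * (Real.cosh t ^ s + Real.cosh (-t) ^ s) * ((s : ℝ) + 1) ^ 4 := by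
        rw [← sum_binomAmp_sq_mul_exp, ← sum_binomAmp_sq_mul_exp, ← Finset.sum_add_distrib,
          Finset.mul_sum]
        congr 1
        refine Finset.sum_congr rfl fun p _ => ?_
        ring
    _ ≤ _ := by
        rw [Real.cosh_neg, ← two_mul, ← mul_assoc]
        have : (Nat.factorial 8 : ℝ) * 2 * Real.cosh t ^ s
          ≤ 2 * Nat.factorial 8 * Real.exp (1 / 2) := by
          rw [mul_comm (Nat.factorial 8 : ℝ) 2]
          gcongr
        exact mul_le_mul_of_nonneg_right this (by positivity)

theorem sum_range_choose_add_le (s a b : ℕ) :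
    ∑ i ∈ Finset.range (s + 1), (s + a + b).choose (i + a) ≤ 2 ^ (s + a + b) := by
  rw [← Nat.sum_range_choose]
  have h : ∑ i ∈ Finset.range (s + 1), (s + a + b).choose (i + a)
      = ∑ i ∈ Finset.Ico a (a + (s + 1)), (s + a + b).choose i := by
    rw [Finset.sum_Ico_eq_sum_range, Nat.add_sub_cancel_left]
    exact Finset.sum_congr rfl fun i _ => by rw [add_comm i a]
  rw [h]
  refine Finset.sum_le_sum_of_subset fun i hi => ?_
  rw [Finset.mem_Ico] at hi
  rw [Finset.mem_range]
  omega

/-- Inverse moments of the binomial law. -/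
theorem sum_binomAmp_sq_div_le (s a b : ℕ) :
    ∑ p ∈ Finset.HasAntidiagonal.antidiagonal s,
      binomAmp p.1 p.2 ^ 2 * (((p.1 : ℝ) + 1) ^ a * ((p.2 : ℝ) + 1) ^ b)⁻¹
        ≤ a.factorial * b.factorial * 2 ^ (a + b) / ((s : ℝ) + 1) ^ (a + b) := by
  have hpt : ∀ p ∈ Finset.HasAntidiagonal.antidiagonal s,
      (s.choose p.1 : ℝ) * (((p.1 : ℝ) + 1) ^ a * ((p.2 : ℝ) + 1) ^ b)⁻¹
        ≤ a.factorial * b.factorial / ((s : ℝ) + 1) ^ (a + b)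
          * (s + a + b).choose (p.1 + a) := by
    rintro ⟨p, q⟩ hp
    have hs : p + q = s := Finset.HasAntidiagonal.mem_antidiagonal.1 hp
    dsimp only
    have h1 : ((p + 1).ascFactorial a : ℝ) ≤ a.factorial * ((p : ℝ) + 1) ^ a := by
      exact_mod_cast Nat.ascFactorial_le_factorial_mul_pow (p + 1) a
    have h2 : ((q + 1).ascFactorial b : ℝ) ≤ b.factorial * ((q : ℝ) + 1) ^ b := by
      exact_mod_cast Nat.ascFactorial_le_factorial_mul_pow (q + 1) b
    have h3 : ((s : ℝ) + 1) ^ (a + b) ≤ (s + 1).ascFactorial (a + b) := by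
      exact_mod_cast Nat.pow_succ_le_ascFactorial (s + 1) (a + b)
    have e1 : (p.factorial : ℝ) * (p + 1).ascFactorial a = (p + a).factorial := by
      exact_mod_cast Nat.factorial_mul_ascFactorial p a
    have e2 : (q.factorial : ℝ) * (q + 1).ascFactorial b = (q + b).factorial := by
      exact_mod_cast Nat.factorial_mul_ascFactorial q b
    have e3 : (s.factorial : ℝ) * (s + 1).ascFactorial (a + b) = (s + (a + b)).factorial := by
      exact_mod_cast Nat.factorial_mul_ascFactorial s (a + b)
    have e4 : (s.choose p : ℝ) * p.factorial * q.factorial = s.factorial := by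
      have := Nat.add_choose_mul_factorial_mul_factorial p q
      rw [← Nat.choose_symm_add, hs] at this
      exact_mod_cast this
    have e5 : ((s + a + b).choose (p + a) : ℝ) * (p + a).factorial * (q + b).factorial
        = (s + (a + b)).factorial := by
      have := Nat.add_choose_mul_factorial_mul_factorial (p + a) (q + b)
      rw [← Nat.choose_symm_add, show p + a + (q + b) = s + a + b by omega] at this
      rw [← add_assoc]
      exact_mod_cast this
    have hp0 : (0 : ℝ) < p.factorial := by positivity
    have hq0 : (0 : ℝ) < q.factorial := by positivity
    have hA : (0 : ℝ) < (p + 1).ascFactorial a := by exact_mod_cast Nat.ascFactorial_pos p a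
    have hB : (0 : ℝ) < (q + 1).ascFactorial b := by exact_mod_cast Nat.ascFactorial_pos q b
    -- Dividing by rising factorials shifts the binomial coefficient: C(s,p) / ((p+1)⋯(p+a)
    -- (q+1)⋯(q+b)) is C(s+a+b,p+a) / ((s+1)⋯(s+a+b)). The shifted coefficients lie in one row of
    -- Pascal's triangle, with sum at most 2^(s+a+b).
    have key : (s.choose p : ℝ) * (s + 1).ascFactorial (a + b)
        = (s + a + b).choose (p + a) * ((p + 1).ascFactorial a * (q + 1).ascFactorial b) := by
      have hne : (p.factorial : ℝ) * q.factorial ≠ 0 := by positivity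
      refine mul_right_cancel₀ hne ?_
      rw [← e1, ← e2, ← e3, ← e4] at e5
      linear_combination -e5
    rw [← div_eq_mul_inv, div_le_iff₀ (by positivity), div_mul_eq_mul_div, div_mul_eq_mul_div,
      le_div_iff₀ (by positivity)]
    calc (s.choose p : ℝ) * ((s : ℝ) + 1) ^ (a + b)
        ≤ (s.choose p : ℝ) * (s + 1).ascFactorial (a + b) := by gcongr
      _ = (s + a + b).choose (p + a) * ((p + 1).ascFactorial a * (q + 1).ascFactorial b) := key
      _ ≤ (s + a + b).choose (p + a) * ((a.factorial * ((p : ℝ) + 1) ^ a)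
          * (b.factorial * ((q : ℝ) + 1) ^ b)) := by gcongr
      _ = _ := by ring
  rw [sum_binomAmp_sq_mul, div_le_iff₀ (by positivity)]
  refine (Finset.sum_le_sum hpt).trans ?_
  rw [← Finset.mul_sum, Finset.Nat.sum_antidiagonal_eq_sum_range_succ_mk]
  have h : (∑ i ∈ Finset.range (s + 1), ((s + a + b).choose (i + a) : ℝ)) ≤ 2 ^ (s + a + b) := by
    exact_mod_cast sum_range_choose_add_le s a b
  calc _ ≤ a.factorial * b.factorial / ((s : ℝ) + 1) ^ (a + b) * (2 : ℝ) ^ (s + a + b) := by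
        gcongr
    _ = _ := by
        rw [add_assoc, pow_add 2 s]
        ring

/-! ### Resonant sums: symmetrisation, conservation, and the gain of two powers -/

/-- Cauchy-Schwarz with a free weight v: v stays with the coefficients, while D and 1/v are averaged
against the binomial law. -/
theorem norm_sum_binomAmp_sq_le (x : ℕ → ℂ) (s : ℕ) (D v : ℕ × ℕ → ℝ) (hv : ∀ p, 0 < v p) :
    ‖∑ p ∈ Finset.HasAntidiagonal.antidiagonal s,
        ((binomAmp p.1 p.2 * D p : ℝ) : ℂ) * (x p.1 * x p.2)‖ ^ 2
      ≤ (∑ p ∈ Finset.HasAntidiagonal.antidiagonal s, binomAmp p.1 p.2 ^ 2 * (D p ^ 2 * (v p)⁻¹))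
        * ∑ p ∈ Finset.HasAntidiagonal.antidiagonal s, v p * (‖x p.1‖ ^ 2 * ‖x p.2‖ ^ 2) := by
  refine (pow_le_pow_left₀ (norm_nonneg _) (norm_sum_le _ _) 2).trans ?_
  refine Finset.sum_sq_le_sum_mul_sum_of_sq_le_mul _ (fun p _ => ?_) (fun p _ => ?_)
    (fun p _ => ?_)
  · have := hv p
    positivity
  · have := hv p
    positivity
  · have := (hv p).ne'
    rw [norm_mul, norm_mul, Complex.norm_real, Real.norm_eq_abs, mul_pow, sq_abs]
    refine le_of_eq ?_
    field_simp

theorem sum_antidiagonal_swap' {M : Type*} [AddCommMonoid M] (s : ℕ) (f : ℕ × ℕ → M) :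
    ∑ p ∈ Finset.HasAntidiagonal.antidiagonal s, f p.swap
      = ∑ p ∈ Finset.HasAntidiagonal.antidiagonal s, f p :=
  Finset.Nat.sum_antidiagonal_swap (f := f)

/-- Symmetrisation of the resonant sum. -/
theorem im_conj_binomConv_mul (w g : ℕ → ℝ) (x : ℕ → ℂ) (s : ℕ) :
    (starRingEnd ℂ (binomConv (fun n => w n * x n) x s) * binomConv x x s).im
      = 2⁻¹ * (starRingEnd ℂ (∑ p ∈ Finset.HasAntidiagonal.antidiagonal s,
        ((binomAmp p.1 p.2 * (w p.1 + w p.2 - 2 * g (p.1 + p.2)) : ℝ) : ℂ) * (x p.1 * x p.2))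
          * binomConv x x s).im := by
  have h1 : binomConv (fun n => w n * x n) x s = ∑ p ∈ Finset.HasAntidiagonal.antidiagonal s,
      (binomAmp p.1 p.2 : ℂ) * (w p.2 * (x p.1 * x p.2)) := by
    rw [binomConv, ← sum_antidiagonal_swap']
    refine Finset.sum_congr rfl fun p _ => ?_
    rw [Prod.fst_swap, Prod.snd_swap, binomAmp_comm]
    ring
  -- Exchanging p and q averages the weight over the two indices, and on the antidiagonal g(p+q) =
  -- g(s) is a constant real multiple of the convolution.
  have h2 : ∑ p ∈ Finset.HasAntidiagonal.antidiagonal s,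
        ((binomAmp p.1 p.2 * (w p.1 + w p.2 - 2 * g (p.1 + p.2)) : ℝ) : ℂ) * (x p.1 * x p.2)
      = 2 * binomConv (fun n => w n * x n) x s - 2 * g s * binomConv x x s := by
    have h3 : 2 * binomConv (fun n => w n * x n) x s
        = ∑ p ∈ Finset.HasAntidiagonal.antidiagonal s,
          (binomAmp p.1 p.2 : ℂ) * ((w p.1 + w p.2) * (x p.1 * x p.2)) := by
      rw [two_mul]
      nth_rewrite 2 [h1]
      rw [binomConv, ← Finset.sum_add_distrib]
      refine Finset.sum_congr rfl fun p _ => ?_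
      ring
    rw [h3, binomConv, Finset.mul_sum, ← Finset.sum_sub_distrib]
    refine Finset.sum_congr rfl fun p hp => ?_
    rw [Finset.HasAntidiagonal.mem_antidiagonal.1 hp]
    push_cast
    ring
  rw [h2]
  simp only [map_sub, map_mul, map_ofNat, Complex.conj_ofReal, sub_mul, Complex.sub_im]
  have h3 : (2 * (g s : ℂ) * starRingEnd ℂ (binomConv x x s) * binomConv x x s).im = 0 := by
    rw [mul_assoc, mul_comm (starRingEnd ℂ _), Complex.mul_conj, ← Complex.ofReal_ofNat,
      ← Complex.ofReal_mul, ← Complex.ofReal_mul]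
    exact Complex.ofReal_im _
  rw [h3, mul_assoc, ← Complex.ofReal_ofNat, Complex.im_ofReal_mul]
  ring

/-- For an affine weight, w(p)+w(q) depends on p+q only, and g absorbs it entirely. This is the
source of the conservation laws of orders 0 and 1. -/
theorem im_conj_binomConv_mul_of_affine {w : ℕ → ℝ} {α β : ℝ} (hw : ∀ n, w n = α * n + β)
    (x : ℕ → ℂ) (s : ℕ) :
    (starRingEnd ℂ (binomConv (fun n => w n * x n) x s) * binomConv x x s).im = 0 := by
  rw [im_conj_binomConv_mul w (fun s => α * s / 2 + β), Finset.sum_eq_zero]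
  · simp
  · intro p _
    rw [hw, hw]
    push_cast
    ring

/-- The resonant sums lose two powers of the weight. -/
theorem exists_abs_im_conj_binomConv_mul_le (j : ℕ) : ∃ C : ℝ, 0 < C ∧ ∀ (x : ℕ → ℂ) (s : ℕ),
    |(starRingEnd ℂ (binomConv (fun n => fockWeight (j + 2) n * x n) x s) * binomConv x x s).im|
      ≤ C * ∑ p ∈ Finset.HasAntidiagonal.antidiagonal s,
        (((p.1 : ℝ) + 1) * ((p.2 : ℝ) + 1) ^ j) * (‖x p.1‖ ^ 2 * ‖x p.2‖ ^ 2) := by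
  obtain ⟨C₁, hC₁, g, hg⟩ := exists_abs_fockWeight_second_difference_le j
  set K₁ : ℝ := (Nat.factorial 1 * j.factorial * 2 ^ (1 + j) : ℝ) with hK₁
  set K₂ : ℝ := (Nat.factorial 2 * (2 * j).factorial * 2 ^ (2 + 2 * j) : ℝ) with hK₂
  set K₃ : ℝ := 2 * Nat.factorial 8 * Real.exp (1 / 2) with hK₃
  set K₄ : ℝ := 2⁻¹ * (C₁ ^ 4 * K₃ + K₂) with hK₄
  have p1 : 0 < K₁ := by positivity
  have p2 : 0 < K₂ := by positivity
  have p3 : 0 < K₃ := by positivity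
  have p4 : 0 < K₄ := by positivity
  refine ⟨Real.sqrt (K₁ * K₄), Real.sqrt_pos.2 (by positivity), fun x s => ?_⟩
  -- The weight is asymmetric, of order 1 in p and j in q, so that the final sum over s factors into
  -- the norms of orders 1 and j.
  set v : ℕ × ℕ → ℝ := fun p => ((p.1 : ℝ) + 1) * ((p.2 : ℝ) + 1) ^ j with hv
  have hv0 : ∀ p, 0 < v p := fun p => by positivity
  set D : ℕ × ℕ → ℝ := fun p =>
    fockWeight (j + 2) p.1 + fockWeight (j + 2) p.2 - 2 * g (p.1 + p.2) with hD
  set S := ∑ p ∈ Finset.HasAntidiagonal.antidiagonal s, v p * (‖x p.1‖ ^ 2 * ‖x p.2‖ ^ 2) with hS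
  have hS0 : 0 ≤ S := Finset.sum_nonneg fun p _ => mul_nonneg (hv0 p).le (by positivity)
  set σ : ℝ := (s : ℝ) + 1 with hσ
  have hσ0 : 0 < σ := by positivity
  set B := ∑ p ∈ Finset.HasAntidiagonal.antidiagonal s,
    ((binomAmp p.1 p.2 * D p : ℝ) : ℂ) * (x p.1 * x p.2) with hB
  have hA : ‖binomConv x x s‖ ^ 2 ≤ K₁ / σ ^ (1 + j) * S := by
    have h := norm_sum_binomAmp_sq_le x s (fun _ => 1) v hv0
    simp only [mul_one, one_pow, one_mul] at h
    refine h.trans (mul_le_mul_of_nonneg_right ?_ hS0)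
    have h2 := sum_binomAmp_sq_div_le s 1 j
    simpa only [pow_one] using h2
  have hBb : ‖B‖ ^ 2 ≤ K₄ * σ ^ (1 + j) * S := by
    refine (norm_sum_binomAmp_sq_le x s D v hv0).trans (mul_le_mul_of_nonneg_right ?_ hS0)
    -- The defect and the inverse weight are separated by 2ab ≤ a²/τ + τb², a = D² and b = 1/v. The
    -- choice τ = σ^(3(1+j)) balances the averages: D^4 is of order σ^(4j+4) by the eighth moment
    -- and 1/v² of order σ^(-2-2j), so both terms are of order σ^(1+j).
    have hpt : ∀ p ∈ Finset.HasAntidiagonal.antidiagonal s, D p ^ 2 * (v p)⁻¹ ≤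
        2⁻¹ * (C₁ ^ 4 * σ ^ (4 * j) / σ ^ (3 * (1 + j)) * ((p.1 : ℝ) - p.2) ^ 8
          + σ ^ (3 * (1 + j)) * (((p.1 : ℝ) + 1) ^ 2 * ((p.2 : ℝ) + 1) ^ (2 * j))⁻¹) := by
      intro p hp
      have hs : (p.1 : ℝ) + p.2 + 1 = σ := by
        rw [hσ, ← Finset.HasAntidiagonal.mem_antidiagonal.1 hp]
        push_cast
        ring
      have h1 := hg p.1 p.2
      rw [hs] at h1
      have h4 : D p ^ 4 ≤ C₁ ^ 4 * σ ^ (4 * j) * ((p.1 : ℝ) - p.2) ^ 8 := by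
        rw [← (by decide : Even 4).pow_abs]
        refine (pow_le_pow_left₀ (abs_nonneg _) h1 4).trans (le_of_eq ?_)
        ring
      have e : (((p.1 : ℝ) + 1) ^ 2 * ((p.2 : ℝ) + 1) ^ (2 * j))⁻¹ = (v p)⁻¹ ^ 2 := by
        rw [inv_pow, hv, mul_pow, ← pow_mul, mul_comm j 2]
      rw [e]
      set τ := σ ^ (3 * (1 + j)) with hτ
      have hτ0 : 0 < τ := by positivity
      have h5 : D p ^ 2 * (v p)⁻¹ ≤ 2⁻¹ * (D p ^ 4 / τ + τ * (v p)⁻¹ ^ 2) := by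
        generalize D p = d
        generalize (v p)⁻¹ = y
        have e2 : 2⁻¹ * (d ^ 4 / τ + τ * y ^ 2) - d ^ 2 * y = 2⁻¹ * (d ^ 2 - τ * y) ^ 2 / τ := by
          field_simp
          ring
        have e3 : 0 ≤ 2⁻¹ * (d ^ 2 - τ * y) ^ 2 / τ := by positivity
        linarith
      refine h5.trans ?_
      gcongr
      rw [div_mul_eq_mul_div]
      gcongr
    calc _ ≤ ∑ p ∈ Finset.HasAntidiagonal.antidiagonal s, binomAmp p.1 p.2 ^ 2 *
          (2⁻¹ * (C₁ ^ 4 * σ ^ (4 * j) / σ ^ (3 * (1 + j)) * ((p.1 : ℝ) - p.2) ^ 8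
          + σ ^ (3 * (1 + j)) * (((p.1 : ℝ) + 1) ^ 2 * ((p.2 : ℝ) + 1) ^ (2 * j))⁻¹)) :=
          Finset.sum_le_sum fun p hp => mul_le_mul_of_nonneg_left (hpt p hp) (sq_nonneg _)
      _ = 2⁻¹ * (C₁ ^ 4 * σ ^ (4 * j) / σ ^ (3 * (1 + j)) *
            (∑ p ∈ Finset.HasAntidiagonal.antidiagonal s,
              binomAmp p.1 p.2 ^ 2 * ((p.1 : ℝ) - p.2) ^ 8)
          + σ ^ (3 * (1 + j)) * ∑ p ∈ Finset.HasAntidiagonal.antidiagonal s,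
            binomAmp p.1 p.2 ^ 2 * (((p.1 : ℝ) + 1) ^ 2 * ((p.2 : ℝ) + 1) ^ (2 * j))⁻¹) := by
          simp only [Finset.mul_sum, ← Finset.sum_add_distrib]
          refine Finset.sum_congr rfl fun p _ => ?_
          ring
      _ ≤ 2⁻¹ * (C₁ ^ 4 * σ ^ (4 * j) / σ ^ (3 * (1 + j)) * (K₃ * σ ^ 4)
          + σ ^ (3 * (1 + j)) * (K₂ / σ ^ (2 + 2 * j))) := by
          gcongr
          · exact sum_binomAmp_sq_mul_pow_le s
          · exact sum_binomAmp_sq_div_le s 2 (2 * j)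
      _ = K₄ * σ ^ (1 + j) := by
          rw [hK₄, show σ ^ (3 * (1 + j)) = σ ^ (2 + 2 * j) * σ ^ (1 + j) by
            rw [← pow_add]; congr 1; omega]
          have e5 : σ ^ (4 * j) * σ ^ 4 = σ ^ (2 + 2 * j) * σ ^ (1 + j) * σ ^ (1 + j) := by
            simp only [← pow_add]
            congr 1
            omega
          field_simp
          linear_combination (C₁ ^ 4 * K₃) * e5
  -- The power σ^(1+j) lost on the defect sum is exactly the one gained on the plain convolution.
  have hprod : ‖B‖ * ‖binomConv x x s‖ ≤ Real.sqrt (K₁ * K₄) * S := by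
    refine le_of_sq_le_sq ?_ (by positivity)
    rw [mul_pow, mul_pow, Real.sq_sqrt (by positivity)]
    calc _ ≤ (K₄ * σ ^ (1 + j) * S) * (K₁ / σ ^ (1 + j) * S) := by gcongr
      _ = _ := by field_simp
  rw [im_conj_binomConv_mul _ g, abs_mul]
  have h6 : |(starRingEnd ℂ B * binomConv x x s).im| ≤ ‖B‖ * ‖binomConv x x s‖ := by
    refine (Complex.abs_im_le_norm _).trans ?_
    rw [norm_mul, RCLike.norm_conj]
  have h7 : |(2⁻¹ : ℝ)| = 2⁻¹ := abs_of_pos (by norm_num)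
  rw [h7]
  have h8 := abs_nonneg (starRingEnd ℂ B * binomConv x x s).im
  calc 2⁻¹ * |(starRingEnd ℂ B * binomConv x x s).im|
      ≤ |(starRingEnd ℂ B * binomConv x x s).im| := by linarith
    _ ≤ _ := h6.trans hprod

/-! ### Diagonal and convolution operators on ℓ² -/

/-- The Hilbert space `ℓ²(ℕ)`. -/
abbrev Ell2 : Type := lp (fun _ : ℕ => ℂ) 2

theorem Ell2.hasSum_norm_sq (x : Ell2) : HasSum (fun n => ‖x n‖ ^ 2) (‖x‖ ^ 2) := by
  have h := lp.hasSum_norm (p := 2) (by norm_num) x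
  simpa only [ENNReal.toReal_ofNat, Real.rpow_two] using h

theorem memℓp_two_of_summable {f : ℕ → ℂ} (h : Summable fun n => ‖f n‖ ^ 2) :
    Memℓp (E := fun _ : ℕ => ℂ) f 2 := by
  refine memℓp_gen ?_
  simpa only [ENNReal.toReal_ofNat, Real.rpow_two] using h

theorem Ell2.coe_smul (c : ℝ) (x : Ell2) : (c : ℂ) • x = c • x := by
  ext n
  exact Complex.coe_smul c (x n)

theorem abs_le_of_hasSum {f g : ℕ → ℝ} {F G : ℝ} (hf : HasSum f F) (hg : HasSum g G)
    (h : ∀ n, |f n| ≤ g n) : |F| ≤ G :=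
  abs_le.2 ⟨hasSum_le (fun n => (abs_le.1 (h n)).1) hg.neg hf,
    hasSum_le (fun n => (abs_le.1 (h n)).2) hf hg⟩

theorem Ell2.norm_sq_le {x : Ell2} {f : ℕ → ℝ} {S : ℝ} (hf : HasSum f S)
    (h : ∀ n, ‖x n‖ ^ 2 ≤ f n) : ‖x‖ ^ 2 ≤ S :=
  hasSum_le h x.hasSum_norm_sq hf

theorem hasSum_sum_mul_antidiagonal {f g : ℕ → ℝ} {F G : ℝ} (hf : HasSum f F) (hg : HasSum g G)
    (hf0 : ∀ n, 0 ≤ f n) (hg0 : ∀ n, 0 ≤ g n) :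
    HasSum (fun s => ∑ p ∈ Finset.HasAntidiagonal.antidiagonal s, f p.1 * g p.2) (F * G) := by
  have h : Summable fun p : ℕ × ℕ => f p.1 * g p.2 :=
    hf.summable.mul_of_nonneg hg.summable hf0 hg0
  rw [← hf.tsum_eq, ← hg.tsum_eq,
    hf.summable.tsum_mul_tsum_eq_tsum_sum_antidiagonal hg.summable h]
  exact (summable_sum_mul_antidiagonal_of_summable_mul h).hasSum

/-- The diagonal operator with real entries `m n ∈ [-1, 1]`. -/
noncomputable def diagOp (m : ℕ → ℝ) (hm : ∀ n, |m n| ≤ 1) : Ell2 →L[ℂ] Ell2 :=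
  have hle : ∀ (x : Ell2) n, ‖(m n : ℂ) * x n‖ ^ 2 ≤ ‖x n‖ ^ 2 := fun x n => by
    rw [norm_mul, Complex.norm_real, Real.norm_eq_abs]
    exact pow_le_pow_left₀ (by positivity) (mul_le_of_le_one_left (norm_nonneg _) (hm n)) 2
  LinearMap.mkContinuous
    { toFun := fun x => ⟨fun n => (m n : ℂ) * x n, memℓp_two_of_summable
        (x.hasSum_norm_sq.summable.of_nonneg_of_le (fun n => by positivity) (hle x))⟩
      map_add' := fun x y => by
        ext n
        exact mul_add _ _ _
      map_smul' := fun c x => by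
        ext n
        exact mul_left_comm _ _ _ } 1 fun x => by
    rw [one_mul]
    refine le_of_sq_le_sq ?_ (norm_nonneg _)
    exact Ell2.norm_sq_le x.hasSum_norm_sq (hle x)

@[simp]
theorem diagOp_apply (m : ℕ → ℝ) (hm : ∀ n, |m n| ≤ 1) (x : Ell2) (n : ℕ) :
    diagOp m hm x n = (m n : ℂ) * x n := rfl

theorem norm_diagOp_apply_le (m : ℕ → ℝ) (hm : ∀ n, |m n| ≤ 1) (x : Ell2) :
    ‖diagOp m hm x‖ ≤ ‖x‖ := by
  refine le_of_sq_le_sq (Ell2.norm_sq_le x.hasSum_norm_sq fun n => ?_) (norm_nonneg _)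
  rw [diagOp_apply, norm_mul, Complex.norm_real, Real.norm_eq_abs]
  exact pow_le_pow_left₀ (by positivity) (mul_le_of_le_one_left (norm_nonneg _) (hm n)) 2

theorem inner_diagOp (m : ℕ → ℝ) (hm : ∀ n, |m n| ≤ 1) (x y : Ell2) :
    inner ℂ (diagOp m hm x) y = inner ℂ x (diagOp m hm y) := by
  refine (lp.hasSum_inner _ _).unique (HasSum.congr_fun (lp.hasSum_inner _ _) fun n => ?_)
  rw [diagOp_apply, diagOp_apply, RCLike.inner_apply', RCLike.inner_apply', map_mul,
    Complex.conj_ofReal]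
  ring

/-- A weighted version of `binomConv`. -/
noncomputable def weightedConv (ρ : ℕ → ℕ → ℝ) (x y : ℕ → ℂ) (s : ℕ) : ℂ :=
  ∑ p ∈ Finset.HasAntidiagonal.antidiagonal s,
    ((binomAmp p.1 p.2 * ρ p.1 p.2 : ℝ) : ℂ) * (x p.1 * y p.2)

/-- The squared amplitudes sum to 1, so Cauchy-Schwarz costs no constant. -/
theorem norm_weightedConv_sq_le (ρ : ℕ → ℕ → ℝ) (x y : ℕ → ℂ) (s : ℕ) :
    ‖weightedConv ρ x y s‖ ^ 2 ≤ ∑ p ∈ Finset.HasAntidiagonal.antidiagonal s,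
      ρ p.1 p.2 ^ 2 * (‖x p.1‖ ^ 2 * ‖y p.2‖ ^ 2) := by
  refine (pow_le_pow_left₀ (norm_nonneg _) (norm_sum_le _ _) 2).trans ?_
  refine LE.le.trans ?_ (one_mul (∑ p ∈ Finset.HasAntidiagonal.antidiagonal s,
    ρ p.1 p.2 ^ 2 * (‖x p.1‖ ^ 2 * ‖y p.2‖ ^ 2))).le
  rw [← sum_binomAmp_sq s]
  refine Finset.sum_sq_le_sum_mul_sum_of_sq_le_mul _ (fun p _ => ?_) (fun p _ => ?_)
    (fun p _ => le_of_eq ?_)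
  · positivity
  · positivity
  · rw [norm_mul, norm_mul, Complex.norm_real, Real.norm_eq_abs, mul_pow, sq_abs]
    ring

theorem norm_weightedConv_sq_le_of_le {ρ : ℕ → ℕ → ℝ} {C : ℝ} (hρ : ∀ p q, |ρ p q| ≤ C)
    (x y : ℕ → ℂ) (s : ℕ) :
    ‖weightedConv ρ x y s‖ ^ 2 ≤ C ^ 2 * ∑ p ∈ Finset.HasAntidiagonal.antidiagonal s,
      ‖x p.1‖ ^ 2 * ‖y p.2‖ ^ 2 := by
  refine (norm_weightedConv_sq_le ρ x y s).trans ?_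
  rw [Finset.mul_sum]
  refine Finset.sum_le_sum fun p _ => mul_le_mul_of_nonneg_right ?_ (by positivity)
  rw [← sq_abs]
  exact pow_le_pow_left₀ (abs_nonneg _) (hρ _ _) 2

theorem hasSum_sum_norm_sq_mul (x y : Ell2) :
    HasSum (fun s => ∑ p ∈ Finset.HasAntidiagonal.antidiagonal s, ‖x p.1‖ ^ 2 * ‖y p.2‖ ^ 2)
      (‖x‖ ^ 2 * ‖y‖ ^ 2) :=
  hasSum_sum_mul_antidiagonal (f := fun n => ‖x n‖ ^ 2) (g := fun n => ‖y n‖ ^ 2)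
    x.hasSum_norm_sq y.hasSum_norm_sq (fun n => sq_nonneg ‖x n‖) (fun n => sq_nonneg ‖y n‖)

/-- The bounded bilinear operator on `ℓ²` given by `weightedConv`. -/
noncomputable def convOp (ρ : ℕ → ℕ → ℝ) (C : ℝ) (hρ : ∀ p q, |ρ p q| ≤ C) :
    Ell2 →L[ℂ] Ell2 →L[ℂ] Ell2 :=
  LinearMap.mkContinuous₂
    (LinearMap.mk₂ ℂ (fun x y : Ell2 => (⟨weightedConv ρ x y, memℓp_two_of_summable
        (((hasSum_sum_norm_sq_mul x y).summable.mul_left (C ^ 2)).of_nonneg_of_le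
          (fun n => by positivity) (norm_weightedConv_sq_le_of_le hρ x y))⟩ : Ell2))
      (fun x x' y => by
        ext s
        change weightedConv ρ (x + x' : Ell2) y s = weightedConv ρ x y s + weightedConv ρ x' y s
        simp only [weightedConv, ← Finset.sum_add_distrib, lp.coeFn_add, Pi.add_apply]
        exact Finset.sum_congr rfl fun p _ => by ring)
      (fun c x y => by
        ext s
        change weightedConv ρ (c • x : Ell2) y s = c * weightedConv ρ x y s
        simp only [weightedConv, Finset.mul_sum, lp.coeFn_smul, Pi.smul_apply, smul_eq_mul]
        exact Finset.sum_congr rfl fun p _ => by ring)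
      (fun x y y' => by
        ext s
        change weightedConv ρ x (y + y' : Ell2) s = weightedConv ρ x y s + weightedConv ρ x y' s
        simp only [weightedConv, ← Finset.sum_add_distrib, lp.coeFn_add, Pi.add_apply]
        exact Finset.sum_congr rfl fun p _ => by ring)
      (fun c x y => by
        ext s
        change weightedConv ρ x (c • y : Ell2) s = c * weightedConv ρ x y s
        simp only [weightedConv, Finset.mul_sum, lp.coeFn_smul, Pi.smul_apply, smul_eq_mul]
        exact Finset.sum_congr rfl fun p _ => by ring)) C fun x y => by
    have hC : 0 ≤ C := (abs_nonneg _).trans (hρ 0 0)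
    refine le_of_sq_le_sq ?_ (by positivity)
    rw [mul_pow, mul_pow, mul_assoc]
    exact Ell2.norm_sq_le ((hasSum_sum_norm_sq_mul x y).mul_left (C ^ 2))
      (norm_weightedConv_sq_le_of_le hρ x y)

@[simp]
theorem convOp_apply (ρ : ℕ → ℕ → ℝ) (C : ℝ) (hρ : ∀ p q, |ρ p q| ≤ C) (x y : Ell2) (s : ℕ) :
    convOp ρ C hρ x y s = weightedConv ρ x y s := rfl

/-! ### The vector field on weighted coefficients and its estimates -/

theorem sqrt_fockWeight_pos (k n : ℕ) : 0 < Real.sqrt (fockWeight k n) :=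
  Real.sqrt_pos.2 (fockWeight_pos k n)

theorem one_le_sqrt_fockWeight (k n : ℕ) : 1 ≤ Real.sqrt (fockWeight k n) :=
  Real.one_le_sqrt.2 (one_le_fockWeight k n)

/-- The sequence of coefficients encoded by an element of `ℓ²`. -/
noncomputable def unweight (k : ℕ) (d : ℕ → ℂ) (n : ℕ) : ℂ :=
  d n / (Real.sqrt (fockWeight k n) : ℝ)

theorem fockMul_bound (k p q : ℕ) :
    |Real.sqrt (fockWeight k (p + q)) / (Real.sqrt (fockWeight k p) * Real.sqrt (fockWeight k q))|
      ≤ Real.sqrt (2 ^ k * k.factorial) := by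
  have h1 := sqrt_fockWeight_pos k p
  have h2 := sqrt_fockWeight_pos k q
  rw [abs_of_nonneg (by positivity), div_le_iff₀ (by positivity),
    ← Real.sqrt_mul (fockWeight_nonneg k p), ← Real.sqrt_mul (by positivity)]
  exact Real.sqrt_le_sqrt (fockWeight_add_le_mul k p q)

theorem fockAct_bound (k p q : ℕ) :
    |Real.sqrt (fockWeight k p) / (Real.sqrt (fockWeight k (p + q)) * Real.sqrt (fockWeight k q))|
      ≤ 1 := by
  have h1 := sqrt_fockWeight_pos k (p + q)
  have h2 := sqrt_fockWeight_pos k q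
  rw [abs_of_nonneg (by positivity), div_le_one (by positivity)]
  have h3 : Real.sqrt (fockWeight k p) ≤ Real.sqrt (fockWeight k (p + q)) :=
    Real.sqrt_le_sqrt (fockWeight_mono_right k (Nat.le_add_right p q))
  nlinarith [one_le_sqrt_fockWeight k q]

theorem fockRatio_bound {j k : ℕ} (h : j ≤ k) (n : ℕ) :
    |Real.sqrt (fockWeight j n) / Real.sqrt (fockWeight k n)| ≤ 1 := by
  rw [abs_of_nonneg (by positivity), div_le_one (sqrt_fockWeight_pos k n)]
  exact Real.sqrt_le_sqrt (fockWeight_mono_left h n)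

theorem fockRatio_bound' (k p q : ℕ) :
    |Real.sqrt (fockWeight k p) / Real.sqrt (fockWeight k (p + q))| ≤ 1 := by
  rw [abs_of_nonneg (by positivity), div_le_one (sqrt_fockWeight_pos k _)]
  exact Real.sqrt_le_sqrt (fockWeight_mono_right k (Nat.le_add_right p q))

/-- The product of two functions, on weighted coefficients. -/
noncomputable def fockMul (k : ℕ) : Ell2 →L[ℂ] Ell2 →L[ℂ] Ell2 :=
  convOp (fun p q => Real.sqrt (fockWeight k (p + q)) /
    (Real.sqrt (fockWeight k p) * Real.sqrt (fockWeight k q))) _ (fockMul_bound k)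

/-- The product of a function of the dual weighted space with a function. -/
noncomputable def fockAct (k : ℕ) : Ell2 →L[ℂ] Ell2 →L[ℂ] Ell2 :=
  convOp (fun p q => Real.sqrt (fockWeight k p) /
    (Real.sqrt (fockWeight k (p + q)) * Real.sqrt (fockWeight k q))) 1 (fockAct_bound k)

/-- The inclusion of the weighted space of order `k` in the weighted space of order `j ≤ k`. -/
noncomputable def fockIncl {j k : ℕ} (h : j ≤ k) : Ell2 →L[ℂ] Ell2 :=
  diagOp (fun n => Real.sqrt (fockWeight j n) / Real.sqrt (fockWeight k n)) (fockRatio_bound h)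

theorem fockIncl_apply {j k : ℕ} (h : j ≤ k) (d : Ell2) (n : ℕ) :
    fockIncl h d n = (Real.sqrt (fockWeight j n) : ℝ) * unweight k d n := by
  rw [fockIncl, diagOp_apply, unweight]
  push_cast
  ring

theorem hasSum_fockIncl {j k : ℕ} (h : j ≤ k) (d : Ell2) :
    HasSum (fun n => fockWeight j n * ‖unweight k d n‖ ^ 2) (‖fockIncl h d‖ ^ 2) := by
  refine HasSum.congr_fun (fockIncl h d).hasSum_norm_sq fun n => ?_
  rw [fockIncl_apply, norm_mul, mul_pow, Complex.norm_real, Real.norm_eq_abs, sq_abs,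
    Real.sq_sqrt (fockWeight_nonneg j n)]

theorem fockIncl_self (k : ℕ) (d : Ell2) : fockIncl (le_refl k) d = d := by
  ext n
  have := (sqrt_fockWeight_pos k n).ne'
  rw [fockIncl_apply, unweight, mul_div_cancel₀]
  exact_mod_cast this

theorem norm_fockIncl_le {j k : ℕ} (h : j ≤ k) (d : Ell2) : ‖fockIncl h d‖ ≤ ‖d‖ :=
  norm_diagOp_apply_le _ _ d

theorem fockMul_apply (k : ℕ) (d : Ell2) (s : ℕ) :
    fockMul k d d s = (Real.sqrt (fockWeight k s) : ℝ) *
      binomConv (unweight k d) (unweight k d) s := by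
  rw [fockMul, convOp_apply, weightedConv, binomConv, Finset.mul_sum]
  refine Finset.sum_congr rfl fun p hp => ?_
  rw [Finset.HasAntidiagonal.mem_antidiagonal.1 hp, unweight, unweight]
  push_cast
  ring

theorem fockAct_apply (k : ℕ) (e d : Ell2) (s : ℕ) :
    fockAct k e d s = ((Real.sqrt (fockWeight k s) : ℝ) : ℂ)⁻¹ *
      binomConv (fun n => (Real.sqrt (fockWeight k n) : ℝ) * e n) (unweight k d) s := by
  rw [fockAct, convOp_apply, weightedConv, binomConv, Finset.mul_sum]
  refine Finset.sum_congr rfl fun p hp => ?_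
  rw [Finset.HasAntidiagonal.mem_antidiagonal.1 hp, unweight]
  push_cast
  ring

/-- The vector field of the equation, on weighted coefficients. -/
noncomputable def fockField (k : ℕ) (d : Ell2) : Ell2 :=
  (-(Complex.I / (2 * Real.pi)) : ℂ) •
    ContinuousLinearMap.adjoint ((fockAct k).flip d) (fockMul k d d)

theorem hasSum_inner_fockField (k : ℕ) (e d : Ell2) :
    HasSum (fun s => starRingEnd ℂ (binomConv (fun n => (Real.sqrt (fockWeight k n) : ℝ) * e n)
        (unweight k d) s) * binomConv (unweight k d) (unweight k d) s)
      (2 * Real.pi * Complex.I * inner ℂ e (fockField k d)) := by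
  have h := lp.hasSum_inner (𝕜 := ℂ) (fockAct k e d) (fockMul k d d)
  -- Pairing with the adjoint moves the action of `d` onto the test vector `e`; the factors √w_k(s)
  -- of the two operators then cancel.
  have e1 : 2 * Real.pi * Complex.I * inner ℂ e (fockField k d)
      = inner ℂ (fockAct k e d) (fockMul k d d) := by
    rw [fockField, inner_smul_right, ContinuousLinearMap.adjoint_inner_right,
      ContinuousLinearMap.flip_apply]
    have hpi : (Real.pi : ℂ) ≠ 0 := by exact_mod_cast Real.pi_pos.ne'
    field_simp
    rw [Complex.I_sq]
    ring
  rw [e1]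
  refine HasSum.congr_fun h fun s => ?_
  have h0 : ((Real.sqrt (fockWeight k s) : ℝ) : ℂ) ≠ 0 := by
    exact_mod_cast (sqrt_fockWeight_pos k s).ne'
  rw [fockAct_apply, fockMul_apply, RCLike.inner_apply', map_mul, map_inv₀, Complex.conj_ofReal]
  field_simp

/-- The energy identity for the norm of order j. The inclusion is self-adjoint, so the test vector
is `fockIncl` applied twice, which puts w_j(n) c_n in the first slot; the factor i turns the real
part into an imaginary part. -/
theorem hasSum_re_inner_fockField {j k : ℕ} (h : j ≤ k) (d : Ell2) :
    HasSum (fun s => (starRingEnd ℂ (binomConv (fun n => fockWeight j n * unweight k d n)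
        (unweight k d) s) * binomConv (unweight k d) (unweight k d) s).im)
      (2 * Real.pi * (inner ℂ (fockIncl h d) (fockIncl h (fockField k d))).re) := by
  rw [show inner ℂ (fockIncl h d) (fockIncl h (fockField k d))
    = inner ℂ (fockIncl h (fockIncl h d)) (fockField k d) from (inner_diagOp _ _ _ _).symm]
  have h1 := Complex.hasSum_im (hasSum_inner_fockField k (fockIncl h (fockIncl h d)) d)
  have e1 : (2 * Real.pi * Complex.I * inner ℂ (fockIncl h (fockIncl h d)) (fockField k d)).im
      = 2 * Real.pi * (inner ℂ (fockIncl h (fockIncl h d)) (fockField k d)).re := by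
    simp
  rw [e1] at h1
  refine HasSum.congr_fun h1 fun s => ?_
  congr 5
  funext n
  have h0 : ((Real.sqrt (fockWeight k n) : ℝ) : ℂ) ≠ 0 := by
    exact_mod_cast (sqrt_fockWeight_pos k n).ne'
  have h2 : (fockWeight j n : ℂ) = (Real.sqrt (fockWeight j n) : ℝ) *
      (Real.sqrt (fockWeight j n) : ℝ) := by
    rw [← Complex.ofReal_mul, Real.mul_self_sqrt (fockWeight_nonneg j n)]
  have h3 : fockIncl h (fockIncl h d) n =
      ((Real.sqrt (fockWeight j n) / Real.sqrt (fockWeight k n) : ℝ) : ℂ) *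
        (((Real.sqrt (fockWeight j n) / Real.sqrt (fockWeight k n) : ℝ) : ℂ) * d n) := rfl
  rw [h3, h2, unweight]
  push_cast
  field_simp

theorem re_inner_fockField_of_affine {j k : ℕ} (h : j ≤ k) {α β : ℝ}
    (hw : ∀ n, fockWeight j n = α * n + β) (d : Ell2) :
    (inner ℂ (fockIncl h d) (fockIncl h (fockField k d))).re = 0 := by
  have h1 := hasSum_re_inner_fockField h d
  simp_rw [im_conj_binomConv_mul_of_affine hw] at h1
  have h2 := h1.unique hasSum_zero
  have := Real.pi_pos
  have h3 : 2 * Real.pi ≠ 0 := by positivity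
  exact (mul_eq_zero.1 h2).resolve_left h3

/-- Summed over s, the resonant bound is a Cauchy product and splits into the norms of orders 1 and
j. This is the differential inequality behind every growth estimate. -/
theorem exists_abs_re_inner_fockField_le (j : ℕ) : ∃ C : ℝ, 0 < C ∧ ∀ d : Ell2,
    |(inner ℂ d (fockField (j + 2) d)).re|
      ≤ C * (‖fockIncl (by omega : 1 ≤ j + 2) d‖ ^ 2 *
        ‖fockIncl (Nat.le_add_right j 2) d‖ ^ 2) := by
  obtain ⟨C, hC, H⟩ := exists_abs_im_conj_binomConv_mul_le j
  refine ⟨C, hC, fun d => ?_⟩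
  have h1 := hasSum_re_inner_fockField (le_refl (j + 2)) d
  rw [fockIncl_self, fockIncl_self] at h1
  have h2 := (hasSum_sum_mul_antidiagonal (hasSum_fockIncl (by omega : 1 ≤ j + 2) d)
    (hasSum_fockIncl (Nat.le_add_right j 2) d)
    (fun n => mul_nonneg (fockWeight_nonneg _ _) (by positivity))
    (fun n => mul_nonneg (fockWeight_nonneg _ _) (by positivity))).mul_left C
  generalize unweight (j + 2) d = c at h1 h2
  have h3 : ∀ s, |(starRingEnd ℂ (binomConv (fun n => fockWeight (j + 2) n * c n) c s) *
      binomConv c c s).im| ≤ C * ∑ p ∈ Finset.HasAntidiagonal.antidiagonal s,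
        fockWeight 1 p.1 * ‖c p.1‖ ^ 2 * (fockWeight j p.2 * ‖c p.2‖ ^ 2) := by
    intro s
    refine (H c s).trans ?_
    refine mul_le_mul_of_nonneg_left (Finset.sum_le_sum fun p _ => ?_) hC.le
    have e1 : (p.1 : ℝ) + 1 ≤ fockWeight 1 p.1 := by
      rw [fockWeight_one]
      linarith
    have e2 := succ_pow_le_fockWeight j p.2
    have e3 := fockWeight_nonneg 1 p.1
    calc _ ≤ (fockWeight 1 p.1 * fockWeight j p.2) * (‖c p.1‖ ^ 2 * ‖c p.2‖ ^ 2) := by gcongr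
      _ = _ := by ring
  have h5 := abs_le_of_hasSum h1 h2 h3
  rw [abs_mul, abs_of_pos (by positivity)] at h5
  refine le_trans ?_ h5
  refine le_mul_of_one_le_left (abs_nonneg _) ?_
  linarith [Real.pi_gt_three]

/-- The denominator √w_k(q) removes the weight from `d`, and the remaining ratio of weights is at
most 1 because they increase; only the L² norm of `d` is left. -/
theorem norm_fockAct_flip_le (k : ℕ) (d : Ell2) :
    ‖(fockAct k).flip d‖ ≤ ‖fockIncl (Nat.zero_le k) d‖ := by
  refine ContinuousLinearMap.opNorm_le_bound _ (norm_nonneg _) fun e => ?_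
  have h : (fockAct k).flip d e = convOp (fun p q => Real.sqrt (fockWeight k p) /
      Real.sqrt (fockWeight k (p + q))) 1 (fockRatio_bound' k) e
        (fockIncl (Nat.zero_le k) d) := by
    ext s
    rw [ContinuousLinearMap.flip_apply, fockAct, convOp_apply, convOp_apply, weightedConv,
      weightedConv]
    refine Finset.sum_congr rfl fun p _ => ?_
    rw [fockIncl_apply, fockWeight_zero, Real.sqrt_one, unweight]
    push_cast
    ring
  rw [h]
  refine (ContinuousLinearMap.le_opNorm₂ _ _ _).trans ?_
  rw [mul_assoc, mul_comm ‖e‖]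
  refine mul_le_of_le_one_left (by positivity) ?_
  exact LinearMap.mkContinuous₂_norm_le _ zero_le_one _

theorem exists_norm_fockMul_le (k : ℕ) : ∃ C : ℝ, 0 ≤ C ∧ ∀ d : Ell2,
    ‖fockMul k d d‖ ≤ C * (‖fockIncl (Nat.zero_le k) d‖ * ‖d‖) := by
  set K : ℝ := 4 ^ k * k.factorial with hK
  have hK0 : 0 ≤ K := by positivity
  refine ⟨Real.sqrt (2 * K), Real.sqrt_nonneg _, fun d => ?_⟩
  refine le_of_sq_le_sq ?_ (by positivity)
  have h0 := hasSum_fockIncl (Nat.zero_le k) d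
  have hk := hasSum_fockIncl (le_refl k) d
  rw [fockIncl_self] at hk
  simp only [fockWeight_zero, one_mul] at h0
  have hp : ∀ n, 0 ≤ fockWeight k n * ‖unweight k d n‖ ^ 2 :=
    fun n => mul_nonneg (fockWeight_nonneg _ _) (by positivity)
  have hS := ((hasSum_sum_mul_antidiagonal hk h0 hp (fun n => by positivity)).add
    (hasSum_sum_mul_antidiagonal h0 hk (fun n => by positivity) hp)).mul_left K
  have e : K * (‖d‖ ^ 2 * ‖fockIncl (Nat.zero_le k) d‖ ^ 2 +
      ‖fockIncl (Nat.zero_le k) d‖ ^ 2 * ‖d‖ ^ 2)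
      = (Real.sqrt (2 * K) * (‖fockIncl (Nat.zero_le k) d‖ * ‖d‖)) ^ 2 := by
    rw [mul_pow, Real.sq_sqrt (by positivity)]
    ring
  rw [← e]
  refine Ell2.norm_sq_le hS fun s => ?_
  rw [fockMul, convOp_apply]
  refine (norm_weightedConv_sq_le _ _ _ s).trans ?_
  rw [← Finset.sum_add_distrib, Finset.mul_sum]
  refine Finset.sum_le_sum fun p _ => ?_
  have hd : ∀ n, ‖d n‖ ^ 2 = fockWeight k n * ‖unweight k d n‖ ^ 2 := by
    intro n
    have := (fockWeight_pos k n).ne'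
    rw [unweight, norm_div, div_pow, Complex.norm_real, Real.norm_eq_abs, sq_abs,
      Real.sq_sqrt (fockWeight_nonneg k n)]
    field_simp
  have h1 := fockWeight_pos k p.1
  have h2 := fockWeight_pos k p.2
  rw [hd, hd, div_pow, mul_pow, Real.sq_sqrt (fockWeight_nonneg _ _),
    Real.sq_sqrt (fockWeight_nonneg _ _), Real.sq_sqrt (fockWeight_nonneg _ _)]
  calc _ = fockWeight k (p.1 + p.2) * (‖unweight k d p.1‖ ^ 2 * ‖unweight k d p.2‖ ^ 2) := by
        field_simp
    _ ≤ K * (fockWeight k p.1 + fockWeight k p.2) *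
        (‖unweight k d p.1‖ ^ 2 * ‖unweight k d p.2‖ ^ 2) := by
        gcongr
        exact fockWeight_add_le_add k p.1 p.2
    _ = _ := by ring

/-- Two of the three factors are measured in L², which is conserved, so the bound is linear in the
top norm and Gronwall's inequality applies. -/
theorem exists_norm_fockField_le (k : ℕ) : ∃ C : ℝ, 0 ≤ C ∧ ∀ d : Ell2,
    ‖fockField k d‖ ≤ C * ‖fockIncl (Nat.zero_le k) d‖ ^ 2 * ‖d‖ := by
  obtain ⟨C, hC, H⟩ := exists_norm_fockMul_le k
  refine ⟨‖(-(Complex.I / (2 * Real.pi)) : ℂ)‖ * C, by positivity, fun d => ?_⟩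
  rw [fockField, norm_smul]
  calc _ ≤ ‖(-(Complex.I / (2 * Real.pi)) : ℂ)‖ * (‖fockIncl (Nat.zero_le k) d‖ *
        (C * (‖fockIncl (Nat.zero_le k) d‖ * ‖d‖))) := by
        gcongr
        refine (ContinuousLinearMap.le_opNorm _ _).trans ?_
        rw [LinearIsometryEquiv.norm_map]
        exact mul_le_mul (norm_fockAct_flip_le k d) (H d) (norm_nonneg _) (norm_nonneg _)
    _ = _ := by ring

theorem isBoundedBilinearMap_fockMul (k : ℕ) :
    IsBoundedBilinearMap ℝ fun p : Ell2 × Ell2 => fockMul k p.1 p.2 where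
  add_left x y z := by
    dsimp only
    rw [map_add, add_apply]
  smul_left c x y := by
    dsimp only
    rw [← Ell2.coe_smul c x, map_smul, smul_apply, Ell2.coe_smul]
  add_right x y z := map_add _ _ _
  smul_right c x y := by
    dsimp only
    rw [← Ell2.coe_smul c y, map_smul, Ell2.coe_smul]
  bound := ⟨‖fockMul k‖ + 1, by positivity, fun x y =>
    ((fockMul k).le_opNorm₂ x y).trans (by gcongr; linarith)⟩

/-- Taking adjoints is conjugate linear, so the map is bilinear over ℝ only; this is enough for real
smoothness. -/
theorem isBoundedBilinearMap_adjoint_fockAct (k : ℕ) : IsBoundedBilinearMap ℝ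
    fun p : Ell2 × Ell2 => ContinuousLinearMap.adjoint ((fockAct k).flip p.1) p.2 where
  add_left x y z := by
    dsimp only
    rw [map_add, map_add, add_apply]
  smul_left c x y := by
    dsimp only
    rw [← Ell2.coe_smul c x, map_smul, map_smulₛₗ, Complex.conj_ofReal,
      smul_apply, Ell2.coe_smul]
  add_right x y z := map_add _ _ _
  smul_right c x y := by
    dsimp only
    rw [← Ell2.coe_smul c y, map_smul, Ell2.coe_smul]
  bound := ⟨1, one_pos, fun x y => by
    refine (ContinuousLinearMap.le_opNorm _ _).trans ?_
    rw [LinearIsometryEquiv.norm_map, one_mul]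
    gcongr
    exact (norm_fockAct_flip_le k x).trans (norm_fockIncl_le _ x)⟩

theorem contDiff_fockField (k : ℕ) : ContDiff ℝ ∞ (fockField k) := by
  have hd : ContDiff ℝ ∞ fun d : Ell2 => (d, d) := contDiff_id.prodMk contDiff_id
  have hm : ContDiff ℝ ∞ fun p : Ell2 × Ell2 => fockMul k p.1 p.2 :=
    (isBoundedBilinearMap_fockMul k).contDiff
  have ha : ContDiff ℝ ∞ fun p : Ell2 × Ell2 =>
      ContinuousLinearMap.adjoint ((fockAct k).flip p.1) p.2 :=
    (isBoundedBilinearMap_adjoint_fockAct k).contDiff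
  have h0 : ContDiff ℝ ∞ fun d : Ell2 => fockMul k d d := by
    have := hm.comp hd
    exact this
  have h1 : ContDiff ℝ ∞ fun d : Ell2 => (d, fockMul k d d) := contDiff_id.prodMk h0
  have h2 : ContDiff ℝ ∞ fun d : Ell2 =>
      ContinuousLinearMap.adjoint ((fockAct k).flip d) (fockMul k d d) := by
    have := ha.comp h1
    exact this
  exact h2.const_smul (-(Complex.I / (2 * Real.pi)) : ℂ)

/-! ### Ordinary differential equations with locally Lipschitz fields -/

/-- Lipschitz continuity on all balls. -/
def LipschitzOnBalls {E F : Type*} [NormedAddCommGroup E] [NormedAddCommGroup F]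
    (f : E → F) : Prop :=
  ∀ R : ℝ, ∃ K : ℝ, 0 ≤ K ∧ ∀ x y : E, ‖x‖ ≤ R → ‖y‖ ≤ R → ‖f x - f y‖ ≤ K * ‖x - y‖

namespace LipschitzOnBalls

variable {E F G H : Type*} [NormedAddCommGroup E] [NormedAddCommGroup F]
  [NormedAddCommGroup G] [NormedAddCommGroup H]

theorem id : LipschitzOnBalls (fun x : E => x) := fun _ =>
  ⟨1, zero_le_one, fun x y _ _ => by rw [one_mul]⟩

theorem exists_bound {f : E → F} (hf : LipschitzOnBalls f) (R : ℝ) :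
    ∃ M : ℝ, 0 ≤ M ∧ ∀ x : E, ‖x‖ ≤ R → ‖f x‖ ≤ M := by
  obtain ⟨K, hK, h⟩ := hf |R|
  refine ⟨K * |R| + ‖f 0‖, by positivity, fun x hx => ?_⟩
  have hx' : ‖x‖ ≤ |R| := hx.trans (le_abs_self R)
  have h1 := h x 0 hx' (by simp)
  rw [sub_zero] at h1
  calc ‖f x‖ = ‖(f x - f 0) + f 0‖ := by rw [sub_add_cancel]
    _ ≤ ‖f x - f 0‖ + ‖f 0‖ := norm_add_le _ _
    _ ≤ K * |R| + ‖f 0‖ := by gcongr; exact h1.trans (by gcongr)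

theorem bilinear [NormedSpace ℝ F] [NormedSpace ℝ G] [NormedSpace ℝ H] {B : F × G → H}
    (hB : IsBoundedBilinearMap ℝ B) {f : E → F} {g : E → G} (hf : LipschitzOnBalls f)
    (hg : LipschitzOnBalls g) : LipschitzOnBalls fun x => B (f x, g x) := by
  intro R
  obtain ⟨C, hC, hb⟩ := hB.bound
  obtain ⟨Kf, hKf, h1⟩ := hf R
  obtain ⟨Kg, hKg, h2⟩ := hg R
  obtain ⟨Mf, hMf, h3⟩ := hf.exists_bound R
  obtain ⟨Mg, hMg, h4⟩ := hg.exists_bound R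
  refine ⟨C * Kf * Mg + C * Mf * Kg, by positivity, fun x y hx hy => ?_⟩
  have e : B (f x, g x) - B (f y, g y) = B (f x - f y, g x) + B (f y, g x - g y) := by
    rw [hB.map_sub_left, hB.map_sub_right]
    abel
  rw [e]
  calc _ ≤ C * ‖f x - f y‖ * ‖g x‖ + C * ‖f y‖ * ‖g x - g y‖ :=
        (norm_add_le _ _).trans (add_le_add (hb _ _) (hb _ _))
    _ ≤ C * (Kf * ‖x - y‖) * Mg + C * Mf * (Kg * ‖x - y‖) := by
        gcongr
        exacts [h1 x y hx hy, h4 x hx, h3 y hy, h2 x y hx hy]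
    _ = _ := by ring

end LipschitzOnBalls

theorem lipschitzOnBalls_fockField (k : ℕ) : LipschitzOnBalls (fockField k) := by
  have h0 : LipschitzOnBalls fun d : Ell2 => fockMul k d d := by
    have := LipschitzOnBalls.bilinear (isBoundedBilinearMap_fockMul k)
      LipschitzOnBalls.id LipschitzOnBalls.id
    exact this
  have h1 : LipschitzOnBalls fun d : Ell2 =>
      ContinuousLinearMap.adjoint ((fockAct k).flip d) (fockMul k d d) := by
    have := LipschitzOnBalls.bilinear (isBoundedBilinearMap_adjoint_fockAct k)
      LipschitzOnBalls.id h0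
    exact this
  intro R
  obtain ⟨K, hK, h⟩ := h1 R
  refine ⟨‖(-(Complex.I / (2 * Real.pi)) : ℂ)‖ * K, by positivity, fun x y hx hy => ?_⟩
  rw [fockField, fockField, ← smul_sub, norm_smul, mul_assoc]
  exact mul_le_mul_of_nonneg_left (h x y hx hy) (norm_nonneg _)

theorem LipschitzOnBalls.eqOn_Ioo {E : Type*} [NormedAddCommGroup E] [NormedSpace ℝ E] {X : E → E}
    (hX : LipschitzOnBalls X) {T : ℝ} {f g : ℝ → E}
    (hf : ∀ t ∈ Set.Ioo (-T) T, HasDerivAt f (X (f t)) t)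
    (hg : ∀ t ∈ Set.Ioo (-T) T, HasDerivAt g (X (g t)) t) (h0 : f 0 = g 0) :
    Set.EqOn f g (Set.Ioo (-T) T) := by
  intro t ht
  -- On a smaller compact interval both curves are bounded, so one Lipschitz constant serves for
  -- both.
  obtain ⟨S, htS, hST⟩ := exists_between (abs_lt.2 ht)
  have hS : 0 < S := (abs_nonneg t).trans_lt htS
  have hsub : Set.Icc (-S) S ⊆ Set.Ioo (-T) T := fun s hs =>
    ⟨by linarith [hs.1], by linarith [hs.2]⟩
  obtain ⟨R₁, h1⟩ := (isCompact_Icc (a := -S) (b := S)).exists_bound_of_continuousOn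
    fun s hs => (hf s (hsub hs)).continuousAt.continuousWithinAt
  obtain ⟨R₂, h2⟩ := (isCompact_Icc (a := -S) (b := S)).exists_bound_of_continuousOn
    fun s hs => (hg s (hsub hs)).continuousAt.continuousWithinAt
  obtain ⟨K, hK, hL⟩ := hX (max R₁ R₂)
  have hL' : LipschitzOnWith ⟨K, hK⟩ X {x | ‖x‖ ≤ max R₁ R₂} := by
    refine LipschitzOnWith.of_dist_le_mul fun x hx y hy => ?_
    rw [dist_eq_norm, dist_eq_norm]
    exact hL x y hx hy
  refine ODE_solution_unique_of_mem_Ioo (v := fun _ => X) (s := fun _ => {x | ‖x‖ ≤ max R₁ R₂})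
    (t₀ := 0) (a := -S) (b := S) (fun _ _ => hL') ⟨by linarith, hS⟩ (fun s hs => ?_)
    (fun s hs => ?_) h0 (abs_lt.1 htS)
  · have hs' := Set.Ioo_subset_Icc_self hs
    exact ⟨hf s (hsub hs'), (h1 s hs').trans (le_max_left _ _)⟩
  · have hs' := Set.Ioo_subset_Icc_self hs
    exact ⟨hg s (hsub hs'), (h2 s hs').trans (le_max_right _ _)⟩

theorem LipschitzOnBalls.eq_of_hasDerivAt {E : Type*} [NormedAddCommGroup E] [NormedSpace ℝ E]
    {X : E → E} (hX : LipschitzOnBalls X) {f g : ℝ → E} (hf : ∀ t, HasDerivAt f (X (f t)) t)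
    (hg : ∀ t, HasDerivAt g (X (g t)) t) (h0 : f 0 = g 0) : f = g := by
  funext t
  exact hX.eqOn_Ioo (T := |t| + 1) (fun s _ => hf s) (fun s _ => hg s) h0
    (abs_lt.1 (lt_add_one _))

/-- A field bounded by M moves a point by at most MT in time T, so Picard-Lindelöf on the ball of
radius MT covers the whole interval at once. -/
theorem LipschitzOnBalls.exists_hasDerivAt_of_bounded {E : Type*} [NormedAddCommGroup E]
    [NormedSpace ℝ E] [CompleteSpace E] {X : E → E} (hX : LipschitzOnBalls X) {M : ℝ}
    (hM : ∀ x, ‖X x‖ ≤ M) (x₀ : E) {T : ℝ} (hT : 0 < T) :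
    ∃ γ : ℝ → E, γ 0 = x₀ ∧ ∀ t ∈ Set.Ioo (-T) T, HasDerivAt γ (X (γ t)) t := by
  have hM0 : 0 ≤ M := (norm_nonneg _).trans (hM x₀)
  obtain ⟨K, hK, hL⟩ := hX (‖x₀‖ + M * T)
  have hpl : IsPicardLindelof (fun _ => X) (tmin := -T) (tmax := T) ⟨0, by simp [hT.le]⟩ x₀
      ⟨M * T, by positivity⟩ 0 ⟨M, hM0⟩ ⟨K, hK⟩ := by
    refine IsPicardLindelof.of_time_independent (fun x _ => hM x) ?_ ?_
    · refine LipschitzOnWith.of_dist_le_mul fun x hx y hy => ?_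
      have key : ∀ z ∈ Metric.closedBall x₀ (M * T), ‖z‖ ≤ ‖x₀‖ + M * T := fun z hz => by
        rw [mem_closedBall_iff_norm] at hz
        calc ‖z‖ = ‖x₀ + (z - x₀)‖ := by rw [add_sub_cancel]
          _ ≤ _ := (norm_add_le _ _).trans (by gcongr)
      rw [dist_eq_norm, dist_eq_norm]
      exact hL x y (key x hx) (key y hy)
    · simp only [sub_zero, zero_sub, neg_neg, max_self, NNReal.coe_zero]
      exact le_rfl
  obtain ⟨γ, h0, h⟩ := hpl.exists_eq_forall_mem_Icc_hasDerivWithinAt₀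
  exact ⟨γ, h0, fun t ht => (h t (Set.Ioo_subset_Icc_self ht)).hasDerivAt
    (Icc_mem_nhds ht.1 ht.2)⟩

/-- Global solutions of an autonomous equation with a locally Lipschitz right-hand side, under a
bound for the solutions of all its truncations. -/
theorem LipschitzOnBalls.exists_global {E : Type*} [NormedAddCommGroup E]
    [NormedSpace ℝ E] [CompleteSpace E] {X : E → E} (hX : LipschitzOnBalls X) (x₀ : E)
    (hap : ∀ T : ℝ, 0 < T → ∃ R : ℝ, ∀ χ : E → ℝ, (∀ x, 0 ≤ χ x ∧ χ x ≤ 1) → ∀ γ : ℝ → E,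
      γ 0 = x₀ → (∀ t ∈ Set.Ioo (-T) T, HasDerivAt γ (χ (γ t) • X (γ t)) t) →
      ∀ t ∈ Set.Ioo (-T) T, ‖γ t‖ ≤ R) :
    ∃ γ : ℝ → E, γ 0 = x₀ ∧ ∀ t, HasDerivAt γ (X (γ t)) t := by
  have hloc : ∀ n : ℕ, ∃ γ : ℝ → E, γ 0 = x₀ ∧
      ∀ t ∈ Set.Ioo (-((n : ℝ) + 1)) ((n : ℝ) + 1), HasDerivAt γ (X (γ t)) t := by
    intro n
    have hT : (0 : ℝ) < (n : ℝ) + 1 := by positivity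
    obtain ⟨R, hR⟩ := hap _ hT
    -- The cut-off is 1 on the ball of radius R and 0 outside radius R+1. As R does not depend on
    -- the cut-off, the truncated solution stays where χ = 1 and solves the original equation.
    set χ : E → ℝ := fun x => max 0 (min 1 (R + 1 - ‖x‖)) with hχ
    have hχ01 : ∀ x, 0 ≤ χ x ∧ χ x ≤ 1 := fun x =>
      ⟨le_max_left _ _, max_le zero_le_one (min_le_left _ _)⟩
    have hχL : LipschitzOnBalls χ := fun _ => ⟨1, zero_le_one, fun x y _ _ => by
      rw [one_mul, Real.norm_eq_abs]
      calc |χ x - χ y| ≤ |min 1 (R + 1 - ‖x‖) - min 1 (R + 1 - ‖y‖)| := by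
            simpa [hχ] using abs_max_sub_max_le_max 0 (min 1 (R + 1 - ‖x‖)) 0
              (min 1 (R + 1 - ‖y‖))
        _ ≤ |(R + 1 - ‖x‖) - (R + 1 - ‖y‖)| := by
            simpa using abs_min_sub_min_le_max 1 (R + 1 - ‖x‖) 1 (R + 1 - ‖y‖)
        _ = |‖y‖ - ‖x‖| := by congr 1; ring
        _ ≤ ‖x - y‖ := by
            rw [norm_sub_rev]
            exact abs_norm_sub_norm_le y x⟩
    have hY : LipschitzOnBalls fun x => χ x • X x := by
      have := LipschitzOnBalls.bilinear (isBoundedBilinearMap_smul (𝕜 := ℝ) (A := ℝ) (E := E))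
        hχL hX
      exact this
    obtain ⟨M, hM, hb⟩ := hX.exists_bound (R + 1)
    have hYb : ∀ x, ‖χ x • X x‖ ≤ M := by
      intro x
      rw [norm_smul, Real.norm_of_nonneg (hχ01 x).1]
      by_cases hx : ‖x‖ ≤ R + 1
      · exact (mul_le_of_le_one_left (norm_nonneg _) (hχ01 x).2).trans (hb x hx)
      · have : χ x = 0 := max_eq_left ((min_le_right _ _).trans (by linarith))
        rw [this, zero_mul]
        exact hM
    obtain ⟨γ, h0, h⟩ := hY.exists_hasDerivAt_of_bounded hYb x₀ hT
    refine ⟨γ, h0, fun t ht => ?_⟩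
    have h1 := hR χ hχ01 γ h0 h t ht
    have h2 : χ (γ t) = 1 := by
      simp only [hχ]
      rw [min_eq_left (by linarith), max_eq_right zero_le_one]
    have h3 := h t ht
    rwa [h2, one_smul] at h3
  choose α hα0 hα using hloc
  -- By uniqueness the solutions on growing intervals agree, so the one of index ⌈|t|⌉ defines a
  -- global curve.
  have hcompat : ∀ m n : ℕ, m ≤ n →
      Set.EqOn (α m) (α n) (Set.Ioo (-((m : ℝ) + 1)) ((m : ℝ) + 1)) := by
    intro m n hmn
    have hmn' : (m : ℝ) ≤ n := by exact_mod_cast hmn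
    exact hX.eqOn_Ioo (hα m)
      (fun t ht => hα n t ⟨by linarith [ht.1], by linarith [ht.2]⟩) ((hα0 m).trans (hα0 n).symm)
  have hmem : ∀ t : ℝ, t ∈ Set.Ioo (-((⌈|t|⌉₊ : ℝ) + 1)) ((⌈|t|⌉₊ : ℝ) + 1) := fun t =>
    abs_lt.1 ((Nat.le_ceil |t|).trans_lt (lt_add_one _))
  have heq : ∀ (n : ℕ) (t : ℝ), |t| < n → α ⌈|t|⌉₊ t = α n t := fun n t ht =>
    hcompat _ n (Nat.ceil_le.2 ht.le) (hmem t)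
  refine ⟨fun t => α ⌈|t|⌉₊ t, by simpa using hα0 0, fun t => ?_⟩
  obtain ⟨n, hn⟩ := exists_nat_gt |t|
  have hev : (fun s => α ⌈|s|⌉₊ s) =ᶠ[𝓝 t] α n := by
    filter_upwards [(isOpen_lt continuous_abs continuous_const).mem_nhds hn] with s hs
    exact heq n s hs
  change HasDerivAt _ (X (α ⌈|t|⌉₊ t)) t
  rw [heq n t hn]
  exact (hα n t (abs_lt.1 (hn.trans (lt_add_one _)))).congr_of_eventuallyEq hev

theorem contDiff_infty_of_hasDerivAt {E : Type*} [NormedAddCommGroup E] [NormedSpace ℝ E]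
    {X : E → E} (hX : ContDiff ℝ ∞ X) {γ : ℝ → E} (hγ : ∀ t, HasDerivAt γ (X (γ t)) t) :
    ContDiff ℝ ∞ γ := by
  rw [contDiff_infty]
  intro n
  induction n with
  | zero => exact contDiff_zero.2 (continuous_iff_continuousAt.2 fun t => (hγ t).continuousAt)
  | succ n ih =>
    have h : deriv γ = fun t => X (γ t) := funext fun t => (hγ t).deriv
    rw [show ((n + 1 : ℕ) : WithTop ℕ∞) = (n : WithTop ℕ∞) + 1 by push_cast; rfl,
      contDiff_succ_iff_deriv]
    refine ⟨fun t => (hγ t).differentiableAt, by simp, ?_⟩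
    rw [h]
    exact (contDiff_infty.1 hX n).comp ih

theorem norm_le_mul_exp_of_hasDerivAt {E : Type*} [NormedAddCommGroup E] [NormedSpace ℝ E]
    {γ γ' : ℝ → E} {T M : ℝ} (hM : 0 ≤ M)
    (hγ : ∀ t ∈ Set.Ioo (-T) T, HasDerivAt γ (γ' t) t)
    (hb : ∀ t ∈ Set.Ioo (-T) T, ‖γ' t‖ ≤ M * ‖γ t‖) {t : ℝ} (ht : t ∈ Set.Ioo (-T) T) :
    ‖γ t‖ ≤ ‖γ 0‖ * Real.exp (M * T) := by
  have key : ∀ {γ γ' : ℝ → E} (_ : ∀ t ∈ Set.Ioo (-T) T, HasDerivAt γ (γ' t) t)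
      (_ : ∀ t ∈ Set.Ioo (-T) T, ‖γ' t‖ ≤ M * ‖γ t‖) {t : ℝ} (_ : t ∈ Set.Ioo (-T) T)
      (_ : 0 ≤ t), ‖γ t‖ ≤ ‖γ 0‖ * Real.exp (M * T) := by
    intro γ γ' hγ hb t ht h0
    have hsub : Set.Icc 0 t ⊆ Set.Ioo (-T) T := fun s hs =>
      ⟨by linarith [hs.1, ht.2], hs.2.trans_lt ht.2⟩
    have h := norm_le_gronwallBound_of_norm_deriv_right_le (f := γ) (f' := γ') (δ := ‖γ 0‖)
      (K := M) (ε := 0) (a := 0) (b := t)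
      (fun s hs => (hγ s (hsub hs)).continuousAt.continuousWithinAt)
      (fun s hs => (hγ s (hsub (Set.Ico_subset_Icc_self hs))).hasDerivWithinAt) le_rfl
      (fun s hs => by simpa using hb s (hsub (Set.Ico_subset_Icc_self hs))) t ⟨h0, le_rfl⟩
    rw [gronwallBound_ε0, sub_zero] at h
    refine h.trans ?_
    have := ht.2.le
    gcongr
  rcases le_total 0 t with h0 | h0
  · exact key hγ hb ht h0
  -- Negative times are reached by reversing time, since Gronwall's inequality runs forwards.
  · have h := key (γ := fun s => γ (-s)) (γ' := fun s => -γ' (-s))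
      (fun s hs => by
        have := (hγ (-s) ⟨by linarith [hs.2], by linarith [hs.1]⟩).scomp s (hasDerivAt_neg s)
        simpa using! this)
      (fun s hs => by
        rw [norm_neg]
        exact hb (-s) ⟨by linarith [hs.2], by linarith [hs.1]⟩)
      (t := -t) ⟨by linarith [ht.2], by linarith [ht.1]⟩ (by linarith)
    simpa using h

/-! ### Conserved norms and the global flow -/

theorem hasDerivAt_norm_sq {E : Type*} [NormedAddCommGroup E] [InnerProductSpace ℂ E]
    [NormedSpace ℝ E] {γ : ℝ → E} {v : E} {t : ℝ} (h : HasDerivAt γ v t) :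
    HasDerivAt (fun s => ‖γ s‖ ^ 2) (2 * (inner ℂ (γ t) v).re) t := by
  have h1 := h.inner ℂ h
  have h2 := (Complex.reCLM.hasFDerivAt.comp_hasDerivAt t h1)
  refine (h2.congr_deriv ?_).congr_of_eventuallyEq (Eventually.of_forall fun s => ?_)
  · have : inner ℂ v (γ t) = starRingEnd ℂ (inner ℂ (γ t) v) := (inner_conj_symm _ _).symm
    simp only [Complex.reCLM_apply, Complex.add_re, this, Complex.conj_re]
    ring
  · simp only [Function.comp_def, Complex.reCLM_apply]
    rw [inner_self_eq_norm_sq_to_K (𝕜 := ℂ)]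
    norm_cast

theorem HasDerivAt.fockIncl {j k : ℕ} (h : j ≤ k) {γ : ℝ → Ell2} {v : Ell2} {t : ℝ}
    (hγ : HasDerivAt γ v t) :
    HasDerivAt (fun s => _root_.fockIncl h (γ s)) (_root_.fockIncl h v) t :=
  ((_root_.fockIncl h).restrictScalars ℝ).hasFDerivAt.comp_hasDerivAt t hγ

/-- A real factor χ only rescales a derivative that is already zero. Truncated equations therefore
conserve the same norms, as the a priori bound in `LipschitzOnBalls.exists_global` requires. -/
theorem norm_fockIncl_eq_of_affine {j k : ℕ} (h : j ≤ k) {α β : ℝ}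
    (hw : ∀ n : ℕ, fockWeight j n = α * n + β) {χ : Ell2 → ℝ} {γ : ℝ → Ell2} {T : ℝ}
    (hγ : ∀ t ∈ Set.Ioo (-T) T, HasDerivAt γ (χ (γ t) • fockField k (γ t)) t)
    {t : ℝ} (ht : t ∈ Set.Ioo (-T) T) : ‖fockIncl h (γ t)‖ = ‖fockIncl h (γ 0)‖ := by
  have hd : ∀ s ∈ Set.Ioo (-T) T, HasDerivAt (fun s => ‖fockIncl h (γ s)‖ ^ 2) 0 s := by
    intro s hs
    refine (hasDerivAt_norm_sq ((hγ s hs).fockIncl h)).congr_deriv ?_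
    rw [← Ell2.coe_smul, map_smul, inner_smul_right, Complex.re_ofReal_mul,
      re_inner_fockField_of_affine h hw]
    simp
  have hT : 0 < T := by linarith [ht.1, ht.2]
  have h1 := isOpen_Ioo.is_const_of_deriv_eq_zero isPreconnected_Ioo
    (f := fun s => ‖fockIncl h (γ s)‖ ^ 2)
    (fun s hs => (hd s hs).differentiableAt.differentiableWithinAt)
    (fun s hs => (hd s hs).deriv) ht ⟨by linarith, hT⟩
  exact (sq_eq_sq₀ (norm_nonneg _) (norm_nonneg _)).1 h1

theorem exists_global_fockField (k : ℕ) (d : Ell2) :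
    ∃ γ : ℝ → Ell2, γ 0 = d ∧ ∀ t, HasDerivAt γ (fockField k (γ t)) t := by
  refine (lipschitzOnBalls_fockField k).exists_global d fun T hT => ?_
  obtain ⟨C, hC, hb⟩ := exists_norm_fockField_le k
  refine ⟨‖d‖ * Real.exp (C * ‖fockIncl (Nat.zero_le k) d‖ ^ 2 * T),
    fun χ hχ γ h0 hγ t ht => ?_⟩
  rw [← h0]
  refine norm_le_mul_exp_of_hasDerivAt (by positivity) hγ (fun s hs => ?_) ht
  rw [← norm_fockIncl_eq_of_affine (Nat.zero_le k) (α := 0) (β := 1)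
    (fun n => by rw [fockWeight_zero]; ring) hγ hs, norm_smul, Real.norm_of_nonneg (hχ _).1]
  exact (mul_le_of_le_one_left (norm_nonneg _) (hχ _).2).trans (hb _)

section Growth

variable {k : ℕ} {γ : ℝ → Ell2}

theorem norm_fockIncl_zero_eq (hγ : ∀ t, HasDerivAt γ (fockField k (γ t)) t) (t : ℝ) :
    ‖fockIncl (Nat.zero_le k) (γ t)‖ = ‖fockIncl (Nat.zero_le k) (γ 0)‖ :=
  norm_fockIncl_eq_of_affine (Nat.zero_le k) (α := 0) (β := 1)
    (fun n => by rw [fockWeight_zero]; ring) (χ := fun _ => 1) (T := |t| + 1)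
    (fun s _ => by simpa only [one_smul] using hγ s) (abs_lt.1 (lt_add_one _))

theorem norm_fockIncl_one_eq (hk : 1 ≤ k) (hγ : ∀ t, HasDerivAt γ (fockField k (γ t)) t)
    (t : ℝ) : ‖fockIncl hk (γ t)‖ = ‖fockIncl hk (γ 0)‖ :=
  norm_fockIncl_eq_of_affine hk (α := 1) (β := 2)
    (fun n => by rw [fockWeight_one]; ring) (χ := fun _ => 1) (T := |t| + 1)
    (fun s _ => by simpa only [one_smul] using hγ s) (abs_lt.1 (lt_add_one _))

end Growth

/-! ### Interpolation and growth of the weighted norms -/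

theorem le_add_mul_abs_of_abs_deriv_le {f f' : ℝ → ℝ} {B : ℝ} (hf : ∀ t, HasDerivAt f (f' t) t)
    (hb : ∀ t, |f' t| ≤ B) (t : ℝ) : f t ≤ f 0 + B * |t| := by
  have h := Convex.norm_image_sub_le_of_norm_hasDerivWithin_le (s := Set.univ) (x := 0) (y := t)
    (fun s _ => (hf s).hasDerivWithinAt) (fun s _ => hb s) convex_univ trivial trivial
  rw [sub_zero, Real.norm_eq_abs, Real.norm_eq_abs] at h
  linarith [(abs_le.1 h).2]

/-- Splitting at level Λ: for x = n+1 ≤ Λ one has x^(m+1) ≤ Λ^m x, and for x ≥ Λ one has x^(m+1) ≤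
Λ^(-2) x^(m+3). -/
theorem norm_fockIncl_sq_le_interp (m : ℕ) (d : Ell2) {Λ : ℝ} (hΛ : 0 < Λ) :
    ‖fockIncl (by omega : m + 1 ≤ m + 3) d‖ ^ 2 ≤ 2 ^ (m + 1) * (m + 1).factorial *
      (Λ ^ m * ‖fockIncl (by omega : 1 ≤ m + 3) d‖ ^ 2 + (Λ ^ 2)⁻¹ * ‖d‖ ^ 2) := by
  have h1 := hasSum_fockIncl (by omega : m + 1 ≤ m + 3) d
  have h2 := hasSum_fockIncl (by omega : 1 ≤ m + 3) d
  have h3 := hasSum_fockIncl (le_refl (m + 3)) d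
  rw [fockIncl_self] at h3
  refine hasSum_le (fun n => ?_) h1
    (((h2.mul_left (Λ ^ m)).add (h3.mul_left (Λ ^ 2)⁻¹)).mul_left
      ((2 : ℝ) ^ (m + 1) * (m + 1).factorial))
  have hx : (0 : ℝ) < (n : ℝ) + 1 := by positivity
  have key : ((n : ℝ) + 1) ^ (m + 1) ≤ Λ ^ m * ((n : ℝ) + 1)
      + (Λ ^ 2)⁻¹ * ((n : ℝ) + 1) ^ (m + 3) := by
    rcases le_total ((n : ℝ) + 1) Λ with h | h
    · refine le_add_of_le_of_nonneg ?_ (by positivity)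
      rw [pow_succ]
      gcongr
    · refine le_add_of_nonneg_of_le (by positivity) ?_
      rw [inv_mul_eq_div, le_div_iff₀ (by positivity),
        show ((n : ℝ) + 1) ^ (m + 3) = ((n : ℝ) + 1) ^ (m + 1) * ((n : ℝ) + 1) ^ 2 by ring]
      gcongr
  have e1 : (n : ℝ) + 1 ≤ fockWeight 1 n := by rw [fockWeight_one]; linarith
  have e2 := succ_pow_le_fockWeight (m + 3) n
  calc fockWeight (m + 1) n * ‖unweight (m + 3) d n‖ ^ 2
      ≤ (2 ^ (m + 1) * (m + 1).factorial * (Λ ^ m * fockWeight 1 n +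
          (Λ ^ 2)⁻¹ * fockWeight (m + 3) n)) * ‖unweight (m + 3) d n‖ ^ 2 := by
        gcongr
        refine (fockWeight_le_pow (m + 1) n).trans ?_
        gcongr
        refine key.trans ?_
        gcongr
    _ = _ := by ring

theorem norm_fockIncl_sq_le_rpow (m : ℕ) (d : Ell2) (hd : 0 < ‖d‖)
    (hq : 0 < ‖fockIncl (by omega : 1 ≤ m + 3) d‖) :
    ‖fockIncl (by omega : m + 1 ≤ m + 3) d‖ ^ 2 ≤ 2 ^ (m + 2) * (m + 1).factorial *
      (‖d‖ ^ 2 * (‖fockIncl (by omega : 1 ≤ m + 3) d‖ ^ 2 / ‖d‖ ^ 2) ^ ((2 : ℝ) / (m + 2))) := by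
  generalize hQ : ‖fockIncl (by omega : 1 ≤ m + 3) d‖ ^ 2 = q
  have hq' : 0 < q := by rw [← hQ]; positivity
  generalize hY : ‖d‖ ^ 2 = y
  have hy : 0 < y := by rw [← hY]; positivity
  set r := q / y with hr
  have hr0 : 0 < r := by positivity
  have hqr : q = r * y := by rw [hr, div_mul_cancel₀ _ hy.ne']
  -- The level Λ = (q/y)^(-1/(m+2)) makes the two terms of the interpolation equal.
  have h := norm_fockIncl_sq_le_interp m d (Real.rpow_pos_of_pos hr0 (-1 / ((m : ℝ) + 2)))
  rw [hQ, hY] at h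
  have e1 : (r ^ (-1 / ((m : ℝ) + 2))) ^ m * q = y * r ^ ((2 : ℝ) / (m + 2)) := by
    rw [hqr, ← Real.rpow_natCast, ← Real.rpow_mul hr0.le]
    nth_rewrite 2 [← Real.rpow_one r]
    rw [← mul_assoc, ← Real.rpow_add hr0, mul_comm]
    congr 2
    field_simp
    ring
  have e2 : ((r ^ (-1 / ((m : ℝ) + 2))) ^ 2)⁻¹ * y = y * r ^ ((2 : ℝ) / (m + 2)) := by
    rw [← Real.rpow_natCast, ← Real.rpow_mul hr0.le, ← Real.rpow_neg hr0.le, mul_comm]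
    congr 2
    push_cast
    ring
  rw [e1, e2] at h
  refine h.trans (le_of_eq ?_)
  ring

/-- With j = 0 the differential inequality involves only the conserved norms of orders 1 and 0.
Bounding the initial norm of order 1 by that of order 2 produces the prefactor. -/
theorem exists_growth_two : ∃ C : ℝ, 0 < C ∧ ∀ γ : ℝ → Ell2,
    (∀ t, HasDerivAt γ (fockField 2 (γ t)) t) → ∀ t,
      ‖γ t‖ ≤ ‖γ 0‖ * (1 + C * ‖fockIncl (Nat.zero_le 2) (γ 0)‖ ^ 2 * |t|) ^ ((1 : ℝ) / 2) := by
  obtain ⟨C, hC, hb⟩ := exists_abs_re_inner_fockField_le 0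
  refine ⟨2 * C, by positivity, fun γ hγ t => ?_⟩
  have h := le_add_mul_abs_of_abs_deriv_le (fun s => hasDerivAt_norm_sq (hγ s))
    (B := ‖γ 0‖ ^ 2 * (2 * C * ‖fockIncl (Nat.zero_le 2) (γ 0)‖ ^ 2)) (fun s => ?_) t
  · refine le_of_sq_le_sq ?_ (by positivity)
    rw [mul_pow, ← Real.sqrt_eq_rpow, Real.sq_sqrt (by positivity)]
    refine h.trans (le_of_eq ?_)
    ring
  · rw [abs_mul, abs_two]
    have h1 := hb (γ s)
    have h2 : ‖fockIncl (by omega : 1 ≤ 0 + 2) (γ s)‖ = ‖fockIncl (by omega : 1 ≤ 2) (γ 0)‖ :=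
      norm_fockIncl_one_eq (by omega : 1 ≤ 2) hγ s
    have h3 : ‖fockIncl (Nat.le_add_right 0 2) (γ s)‖ = ‖fockIncl (Nat.zero_le 2) (γ 0)‖ :=
      norm_fockIncl_zero_eq hγ s
    rw [h2, h3] at h1
    have h4 := norm_fockIncl_le (by omega : 1 ≤ 2) (γ 0)
    calc 2 * |(inner ℂ (γ s) (fockField 2 (γ s))).re|
        ≤ 2 * (C * (‖fockIncl (by omega : 1 ≤ 2) (γ 0)‖ ^ 2 *
          ‖fockIncl (Nat.zero_le 2) (γ 0)‖ ^ 2)) := by gcongr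
      _ ≤ 2 * (C * (‖γ 0‖ ^ 2 * ‖fockIncl (Nat.zero_le 2) (γ 0)‖ ^ 2)) := by gcongr
      _ = _ := by ring

theorem exists_growth_add_three (m : ℕ) : ∃ C : ℝ, 0 < C ∧ ∀ γ : ℝ → Ell2,
    (∀ t, HasDerivAt γ (fockField (m + 3) (γ t)) t) → ∀ t,
      ‖γ t‖ ≤ ‖γ 0‖ * (1 + C * ‖fockIncl (by omega : 1 ≤ m + 3) (γ 0)‖ ^ 2 * |t|) ^
        (((m : ℝ) + 2) / 4) := by
  obtain ⟨C, hC, hb⟩ := exists_abs_re_inner_fockField_le (m + 1)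
  -- With y the squared top norm and q the conserved norm of order 1, interpolation gives |y'| ≲ q²
  -- y (q²/y)^θ. Hence the derivative of y^θ is bounded by a constant multiple of (q²)^(1+θ), and
  -- (q²)^θ ≤ y(0)^θ.
  set θ : ℝ := 2 / ((m : ℝ) + 2) with hθ
  have hθ0 : 0 < θ := by positivity
  set c : ℝ := 2 ^ (m + 2) * (m + 1).factorial with hc
  have hc0 : 0 < c := by positivity
  refine ⟨2 * θ * C * c, by positivity, fun γ hγ t => ?_⟩
  have hcons1 := norm_fockIncl_one_eq (by omega : 1 ≤ m + 3) hγ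
  generalize hQ : ‖fockIncl (by omega : 1 ≤ m + 3) (γ 0)‖ = q at hcons1 ⊢
  have hq0 : 0 ≤ q := hQ ▸ norm_nonneg _
  -- If q = 0 the solution vanishes identically. This case is set apart because y^θ is
  -- differentiated and divided by y below.
  rcases hq0.eq_or_lt with hq | hq
  · have hz : ∀ d : Ell2, ‖fockIncl (by omega : 1 ≤ m + 3) d‖ = 0 → ‖d‖ = 0 := by
      intro d hd
      have h1 := hasSum_fockIncl (by omega : 1 ≤ m + 3) d
      rw [hd, zero_pow two_ne_zero, hasSum_zero_iff_of_nonneg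
        fun n => mul_nonneg (fockWeight_nonneg _ _) (sq_nonneg _)] at h1
      have h3 := hasSum_fockIncl (le_refl (m + 3)) d
      rw [fockIncl_self] at h3
      have h4 : HasSum (fun n => fockWeight (m + 3) n * ‖unweight (m + 3) d n‖ ^ 2) 0 := by
        refine HasSum.congr_fun hasSum_zero fun n => ?_
        have h5 := congrFun h1 n
        rcases mul_eq_zero.1 h5 with h6 | h6
        · exact absurd h6 (fockWeight_pos 1 n).ne'
        · rw [h6, mul_zero]
      exact pow_eq_zero_iff two_ne_zero |>.1 (h3.unique h4)
    rw [hz (γ t) (by rw [hcons1, ← hq])]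
    positivity
  have hpos : ∀ s, 0 < ‖γ s‖ := fun s => (hcons1 s ▸ hq).trans_le (norm_fockIncl_le _ _)
  have hd : ∀ s, HasDerivAt (fun s => (‖γ s‖ ^ 2) ^ θ)
      (2 * (inner ℂ (γ s) (fockField (m + 3) (γ s))).re * θ * (‖γ s‖ ^ 2) ^ (θ - 1)) s :=
    fun s => (hasDerivAt_norm_sq (hγ s)).rpow_const (Or.inl (pow_pos (hpos s) 2).ne')
  have hle : ∀ s, |2 * (inner ℂ (γ s) (fockField (m + 3) (γ s))).re * θ *
      (‖γ s‖ ^ 2) ^ (θ - 1)| ≤ 2 * θ * C * c * q ^ 2 * (‖γ 0‖ ^ 2) ^ θ := by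
    intro s
    have h1 : |(inner ℂ (γ s) (fockField (m + 3) (γ s))).re| ≤ C *
      (‖fockIncl (by omega : 1 ≤ m + 3) (γ s)‖ ^ 2 *
        ‖fockIncl (by omega : m + 1 ≤ m + 3) (γ s)‖ ^ 2) := hb (γ s)
    have h2 := norm_fockIncl_sq_le_rpow m (γ s) (hpos s) (by rw [hcons1]; exact hq)
    rw [hcons1] at h1 h2
    have hy := pow_pos (hpos s) 2
    have hq2 : q ^ 2 ≤ ‖γ 0‖ ^ 2 := by
      rw [← hQ]
      have := norm_fockIncl_le (by omega : 1 ≤ m + 3) (γ 0)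
      gcongr
    generalize ‖γ s‖ ^ 2 = y at h2 hy ⊢
    have e : y * (q ^ 2 / y) ^ θ * y ^ (θ - 1) = (q ^ 2) ^ θ := by
      rw [Real.div_rpow (by positivity) hy.le, Real.rpow_sub_one hy.ne']
      have := (Real.rpow_pos_of_pos hy θ).ne'
      field_simp
    rw [abs_mul, abs_mul, abs_mul, abs_two, abs_of_pos hθ0,
      abs_of_pos (Real.rpow_pos_of_pos hy _)]
    have hyθ := Real.rpow_pos_of_pos hy (θ - 1)
    calc _ ≤ 2 * (C * (q ^ 2 * (c * (y * (q ^ 2 / y) ^ θ)))) * θ * y ^ (θ - 1) := by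
          gcongr
          exact h1.trans (by gcongr)
      _ = 2 * θ * C * c * q ^ 2 * (y * (q ^ 2 / y) ^ θ * y ^ (θ - 1)) := by ring
      _ ≤ _ := by
          rw [e]
          gcongr
  have h := le_add_mul_abs_of_abs_deriv_le hd hle t
  have h' : (‖γ t‖ ^ 2) ^ θ ≤ (‖γ 0‖ ^ 2) ^ θ * (1 + 2 * θ * C * c * q ^ 2 * |t|) :=
    h.trans (le_of_eq (by ring))
  -- The final exponent (m+2)/4 is 1/(2θ), which undoes the square and the power θ.
  have hexp : ∀ x : ℝ, 0 ≤ x → ((x ^ 2) ^ θ) ^ (((m : ℝ) + 2) / 4) = x := by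
    intro x hx
    rw [← Real.rpow_mul (by positivity), ← Real.rpow_natCast, ← Real.rpow_mul hx]
    convert Real.rpow_one x
    rw [hθ]
    push_cast
    field_simp
    norm_num
  have h3 := Real.rpow_le_rpow (by positivity) h' (by positivity : 0 ≤ ((m : ℝ) + 2) / 4)
  rwa [Real.mul_rpow (by positivity) (by positivity), hexp _ (norm_nonneg _),
    hexp _ (norm_nonneg _)] at h3

/-- Cauchy-Schwarz on finite partial sums, with the log-convexity of the weights. -/
theorem norm_fockIncl_two_sq_le (d : Ell2) :
    ‖fockIncl (by omega : 2 ≤ 3) d‖ ^ 2 ≤ ‖fockIncl (by omega : 1 ≤ 3) d‖ * ‖d‖ := by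
  have h1 := hasSum_fockIncl (by omega : 1 ≤ 3) d
  have h2 := hasSum_fockIncl (by omega : 2 ≤ 3) d
  have h3 := hasSum_fockIncl (le_refl 3) d
  rw [fockIncl_self] at h3
  refine le_of_tendsto h2 (Eventually.of_forall fun s => ?_)
  have hn : ∀ i n, 0 ≤ fockWeight i n * ‖unweight 3 d n‖ ^ 2 := fun i n =>
    mul_nonneg (fockWeight_nonneg _ _) (sq_nonneg _)
  refine le_of_sq_le_sq ?_ (by positivity)
  rw [mul_pow]
  refine (Finset.sum_sq_le_sum_mul_sum_of_sq_le_mul s (fun n _ => hn 1 n) (fun n _ => hn 3 n)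
    (fun n _ => ?_)).trans (mul_le_mul (sum_le_hasSum s (fun n _ => hn 1 n) h1)
      (sum_le_hasSum s (fun n _ => hn 3 n) h3) (Finset.sum_nonneg fun n _ => hn 3 n) (sq_nonneg _))
  calc _ = fockWeight 2 n ^ 2 * (‖unweight 3 d n‖ ^ 2) ^ 2 := by ring
    _ ≤ fockWeight 1 n * fockWeight 3 n * (‖unweight 3 d n‖ ^ 2) ^ 2 := by
        gcongr
        exact fockWeight_two_sq_le n
    _ = _ := by ring

/-! ### Compatibility of the orders and transfer to the Bargmann-Fock space -/

theorem binomConv_const_mul_left (c : ℂ) (x y : ℕ → ℂ) (s : ℕ) :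
    binomConv (fun n => c * x n) y s = c * binomConv x y s := by
  simp only [binomConv, Finset.mul_sum]
  exact Finset.sum_congr rfl fun p _ => by ring

/-- Testing against the n-th unit vector gives a formula for the unweighted coefficients in which k
no longer appears. It both identifies the field with the cubic term and makes the fields of
different orders compatible. -/
theorem hasSum_fockField_apply (k : ℕ) (d : Ell2) (n : ℕ) :
    HasSum (fun s => starRingEnd ℂ (binomConv (Pi.single n 1) (unweight k d) s)
        * binomConv (unweight k d) (unweight k d) s)
      (2 * Real.pi * Complex.I * unweight k (fockField k d) n) := by
  have h := hasSum_inner_fockField k (lp.single 2 n (1 : ℂ)) d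
  have hw : (Real.sqrt (fockWeight k n) : ℂ) ≠ 0 := by
    exact_mod_cast (Real.sqrt_pos.2 (fockWeight_pos k n)).ne'
  have e1 : (fun m => (Real.sqrt (fockWeight k m) : ℂ) * (lp.single 2 n (1 : ℂ) : Ell2) m)
      = fun m => (Real.sqrt (fockWeight k n) : ℂ) * (Pi.single n 1 : ℕ → ℂ) m := by
    funext m
    rw [lp.coeFn_single]
    by_cases hm : m = n
    · subst hm; rfl
    · rw [Pi.single_eq_of_ne hm]
      simp
  rw [e1, lp.inner_single_left] at h
  have h2 := h.mul_left ((Real.sqrt (fockWeight k n) : ℂ)⁻¹)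
  have e2 : (Real.sqrt (fockWeight k n) : ℂ)⁻¹ *
      (2 * Real.pi * Complex.I * inner ℂ (1 : ℂ) (fockField k d n))
      = 2 * Real.pi * Complex.I * unweight k (fockField k d) n := by
    rw [unweight, show inner ℂ (1 : ℂ) (fockField k d n) = fockField k d n by simp]
    ring
  rw [e2] at h2
  refine HasSum.congr_fun h2 fun s => ?_
  rw [binomConv_const_mul_left, map_mul, Complex.conj_ofReal, ← mul_assoc, ← mul_assoc,
    inv_mul_cancel₀ hw, one_mul]

theorem unweight_fockIncl {j k : ℕ} (h : j ≤ k) (d : Ell2) :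
    unweight j (fockIncl h d) = unweight k d := by
  funext n
  have hw : (Real.sqrt (fockWeight j n) : ℂ) ≠ 0 := by
    exact_mod_cast (Real.sqrt_pos.2 (fockWeight_pos j n)).ne'
  rw [unweight, fockIncl_apply, mul_div_cancel_left₀ _ hw]

theorem unweight_injective (k : ℕ) : Function.Injective fun d : Ell2 => unweight k d := by
  intro d e h
  ext n
  have hw : (Real.sqrt (fockWeight k n) : ℂ) ≠ 0 := by
    exact_mod_cast (Real.sqrt_pos.2 (fockWeight_pos k n)).ne'
  exact (div_left_inj' hw).1 (congrFun h n)

theorem fockIncl_fockField {j k : ℕ} (h : j ≤ k) (d : Ell2) :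
    fockIncl h (fockField k d) = fockField j (fockIncl h d) := by
  refine unweight_injective j (funext fun n => ?_)
  have h1 := hasSum_fockField_apply k d n
  have h2 := hasSum_fockField_apply j (fockIncl h d) n
  rw [unweight_fockIncl] at h2
  dsimp only
  rw [unweight_fockIncl]
  exact mul_left_cancel₀ Complex.two_pi_I_ne_zero (h1.unique h2)

namespace WeightedFock

variable {k : ℕ}

theorem summable_fockWeight (u : WeightedFock k) :
    Summable fun n => fockWeight k n * ‖fockCoeff u.toFock n‖ ^ 2 :=
  (memWeighted_iff_summable u.toFock.2 k).1 u.2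

theorem norm_sq_sqrt_fockWeight_mul (k n : ℕ) (c : ℂ) :
    ‖(Real.sqrt (fockWeight k n) : ℂ) * c‖ ^ 2 = fockWeight k n * ‖c‖ ^ 2 := by
  rw [norm_mul, mul_pow, Complex.norm_real, Real.norm_eq_abs, sq_abs,
    Real.sq_sqrt (fockWeight_nonneg k n)]

/-- The weighted coefficients in the basis of monomials. -/
noncomputable def toSeq (k : ℕ) : WeightedFock k →ₗᵢ[ℂ] Ell2 where
  toFun u := ⟨fun n => (Real.sqrt (fockWeight k n) : ℂ) * fockCoeff u.toFock n,
    memℓp_two_of_summable (by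
      simpa only [norm_sq_sqrt_fockWeight_mul] using u.summable_fockWeight)⟩
  map_add' u v := by
    ext n
    change _ * inner ℂ _ ((u.toFock : L2C) + (v.toFock : L2C)) = _ * inner ℂ _ _ + _ * inner ℂ _ _
    rw [inner_add_right, mul_add]
  map_smul' c u := by
    ext n
    change _ * inner ℂ _ (c • (u.toFock : L2C)) = c * (_ * inner ℂ _ _)
    rw [inner_smul_right, mul_left_comm]
  norm_map' u := by
    refine (sq_eq_sq₀ (norm_nonneg _) (norm_nonneg _)).1 ?_
    rw [norm_eq, toFun, weightedNorm_sq u.toFock.2 u.summable_fockWeight]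
    refine ((Ell2.hasSum_norm_sq _).tsum_eq.symm).trans (tsum_congr fun n => ?_)
    exact norm_sq_sqrt_fockWeight_mul k n _

theorem unweight_toSeq (u : WeightedFock k) : unweight k (toSeq k u) = fockCoeff u.toFock := by
  funext n
  have hw : (Real.sqrt (fockWeight k n) : ℂ) ≠ 0 := by
    exact_mod_cast (Real.sqrt_pos.2 (fockWeight_pos k n)).ne'
  exact mul_div_cancel_left₀ _ hw

theorem toFock_injective : Function.Injective (toFock : WeightedFock k → bargmannFock) :=
  Subtype.val_injective

/-- The orthonormal series with the prescribed unweighted coefficients converges in L², its sum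
stays in the closed Bargmann-Fock space, and square summability of the weighted coefficients gives
the decay. -/
theorem toSeq_surjective (k : ℕ) : Function.Surjective (toSeq k) := by
  intro d
  have hs := orthonormal_fockBasis.orthogonalFamily.hasSum_linearIsometry
    (fockIncl (Nat.zero_le k) d)
  generalize orthonormal_fockBasis.orthogonalFamily.linearIsometry (fockIncl (Nat.zero_le k) d)
    = u at hs
  have hs' : HasSum (fun n => unweight k d n • fockBasis n) u := by
    refine HasSum.congr_fun hs fun n => ?_
    rw [LinearIsometry.toSpanSingleton_apply, fockIncl_apply, fockWeight_zero, Real.sqrt_one,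
      Complex.ofReal_one, one_mul]
  have hu : u ∈ bargmannFock := by
    refine isClosed_bargmannFock.mem_of_tendsto hs' (Eventually.of_forall fun s => ?_)
    exact Submodule.sum_mem _ fun n _ => Submodule.smul_mem _ _ (fockBasis_mem n)
  have hc : ∀ n, fockCoeff u n = unweight k d n := by
    intro n
    have h1 := hs'.mapL (innerSL ℂ (fockBasis n))
    refine h1.unique (HasSum.congr_fun (hasSum_ite_eq n (unweight k d n)) fun m => ?_)
    rw [innerSL_apply_apply, inner_smul_right, orthonormal_iff_ite.1 orthonormal_fockBasis]
    by_cases hm : m = n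
    · subst hm; simp
    · simp [hm, Ne.symm hm]
  have hk := hasSum_fockIncl (le_refl k) d
  have hmem : MemWeighted k u := by
    rw [memWeighted_iff_summable hu]
    simpa only [hc] using hk.summable
  exact ⟨⟨⟨u, hu⟩, hmem⟩, unweight_injective k ((unweight_toSeq _).trans (funext hc))⟩

/-- The isometry of `WeightedFock k` with `ℓ²`, over the reals. -/
noncomputable def equivSeq (k : ℕ) : WeightedFock k ≃L[ℝ] Ell2 :=
  (LinearIsometryEquiv.ofSurjective
    (⟨(toSeq k).toLinearMap.restrictScalars ℝ, (toSeq k).norm_map⟩ : WeightedFock k →ₗᵢ[ℝ] Ell2)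
    (toSeq_surjective k)).toContinuousLinearEquiv

theorem equivSeq_apply (u : WeightedFock k) : equivSeq k u = toSeq k u := rfl

theorem toSeq_equivSeq_symm (d : Ell2) : toSeq k ((equivSeq k).symm d) = d :=
  (equivSeq k).apply_symm_apply d

theorem memWeighted_of_le {j : ℕ} (h : j ≤ k) (u : WeightedFock k) : MemWeighted j u.toFun := by
  refine (memWeighted_iff_summable u.toFock.2 j).2 ?_
  have := (hasSum_fockIncl h (toSeq k u)).summable
  rwa [unweight_toSeq] at this

theorem norm_fockIncl_toSeq {j : ℕ} (h : j ≤ k) (u : WeightedFock k) :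
    ‖fockIncl h (toSeq k u)‖ = weightedNorm j u.toFun := by
  have h1 := hasSum_fockIncl h (toSeq k u)
  rw [unweight_toSeq] at h1
  refine (sq_eq_sq₀ (norm_nonneg _) ENNReal.toReal_nonneg).1 ?_
  rw [← h1.tsum_eq]
  exact (weightedNorm_sq u.toFock.2 h1.summable).symm

theorem norm_toSeq (u : WeightedFock k) : ‖toSeq k u‖ = weightedNorm k u.toFun := by
  rw [LinearIsometry.norm_map, norm_eq]

theorem equation_iff (u v : WeightedFock k) :
    Complex.I • (v.toFock : L2C) = fockProj (cubic u.toFock) ↔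
      toSeq k v = fockField k (toSeq k u) := by
  have hp : fockProj (cubic u.toFock) ∈ bargmannFock :=
    Submodule.starProjection_apply_mem _ _
  have hv : Complex.I • (v.toFock : L2C) ∈ bargmannFock := Submodule.smul_mem _ _ v.toFock.2
  have hI : ∀ n, fockCoeff (Complex.I • (v.toFock : L2C)) n
      = Complex.I * fockCoeff v.toFock n := fun n => inner_smul_right _ _ _
  have hf : ∀ n, fockCoeff (fockProj (cubic u.toFock)) n
      = Complex.I * unweight k (fockField k (toSeq k u)) n := by
    intro n
    have h1 := hasSum_fockField_apply k (toSeq k u) n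
    rw [unweight_toSeq] at h1
    have h2 := (hasSum_fockCoeff_cubic u.toFock n).unique h1
    have h3 : (2 * Real.pi : ℂ) ≠ 0 := by
      exact_mod_cast Real.two_pi_pos.ne'
    refine mul_left_cancel₀ h3 (h2.trans ?_)
    ring
  constructor
  · intro h
    refine unweight_injective k (funext fun n => ?_)
    dsimp only
    rw [unweight_toSeq]
    refine mul_left_cancel₀ Complex.I_ne_zero ?_
    rw [← hI, ← hf, h]
  · intro h
    refine fockCoeff_injOn hv hp fun n => ?_
    rw [hI, hf, ← h, unweight_toSeq]

end WeightedFock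

-- Smoothness is absent from the right side because it follows by bootstrapping from the smoothness
-- of the field.
open WeightedFock in
theorem isLLLSolution_iff (k : ℕ) (u₀ : WeightedFock k) (u : ℝ → WeightedFock k) :
    IsLLLSolution k u₀ u ↔ u 0 = u₀ ∧
      ∀ t, HasDerivAt (fun s => toSeq k (u s)) (fockField k (toSeq k (u t))) t := by
  constructor
  · intro h
    refine ⟨h.initial, fun t => ?_⟩
    have h1 : HasDerivAt u (deriv u t) t :=
      (h.smooth.differentiable (by simp)).differentiableAt.hasDerivAt
    have h2 := (equivSeq k).hasFDerivAt.comp_hasDerivAt t h1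
    exact h2.congr_deriv ((equation_iff _ _).1 (h.equation t))
  · rintro ⟨h0, h⟩
    have hs : ContDiff ℝ ∞ fun s => toSeq k (u s) :=
      contDiff_infty_of_hasDerivAt (contDiff_fockField k) h
    have hu : (fun s => (equivSeq k).symm (toSeq k (u s))) = u :=
      funext fun s => (equivSeq k).symm_apply_apply (u s)
    have hsm : ContDiff ℝ ∞ u := by
      rw [← hu]
      exact (equivSeq k).symm.contDiff.comp hs
    refine ⟨hsm, h0, fun t => (equation_iff _ _).2 ?_⟩
    have h1 : HasDerivAt u (deriv u t) t :=
      (hsm.differentiable (by simp)).differentiableAt.hasDerivAt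
    exact ((equivSeq k).hasFDerivAt.comp_hasDerivAt t h1).unique (h t)

/-! ### The theorem -/

/-- The squared norm of order 2 is at most the conserved norm of order 1 times the norm of order 3.
The latter grows with exponent 1/2, which the square root halves. -/
theorem exists_growth_two_of_three : ∃ C : ℝ, 0 < C ∧ ∀ γ : ℝ → Ell2,
    (∀ t, HasDerivAt γ (fockField 3 (γ t)) t) → ∀ t,
      ‖fockIncl (by omega : 2 ≤ 3) (γ t)‖ ≤ ‖γ 0‖ *
        (1 + C * ‖fockIncl (by omega : 1 ≤ 3) (γ 0)‖ ^ 2 * |t|) ^ ((1 : ℝ) / 4) := by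
  obtain ⟨C, hC, H⟩ := exists_growth_add_three 0
  refine ⟨C, hC, fun γ hγ t => ?_⟩
  have h1 : ‖γ t‖ ≤ ‖γ 0‖ * (1 + C * ‖fockIncl (by omega : 1 ≤ 3) (γ 0)‖ ^ 2 * |t|) ^
      (((0 : ℕ) + 2 : ℝ) / 4) := H γ hγ t
  have h2 := norm_fockIncl_two_sq_le (γ t)
  rw [norm_fockIncl_one_eq (by omega : 1 ≤ 3) hγ t] at h2
  have h3 := norm_fockIncl_le (by omega : 1 ≤ 3) (γ 0)
  refine le_of_sq_le_sq ?_ (by positivity)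
  refine h2.trans ((mul_le_mul h3 h1 (norm_nonneg _) (norm_nonneg _)).trans (le_of_eq ?_))
  rw [mul_pow, ← Real.rpow_mul_natCast (by positivity), ← mul_assoc, ← sq]
  congr 2
  norm_num

/-- Solutions in two of the weighted spaces with the same initial value coincide. -/
theorem IsLLLSolution.toFock_eq {j k : ℕ} {u₀ : WeightedFock k} {v₀ : WeightedFock j}
    {u : ℝ → WeightedFock k} {v : ℝ → WeightedFock j} (hu : IsLLLSolution k u₀ u)
    (hv : IsLLLSolution j v₀ v) (h0 : u₀.toFock = v₀.toFock) (t : ℝ) :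
    (u t).toFock = (v t).toFock := by
  obtain ⟨hu0, hu'⟩ := (isLLLSolution_iff _ _ _).1 hu
  obtain ⟨hv0, hv'⟩ := (isLLLSolution_iff _ _ _).1 hv
  -- Both curves are mapped to the space of order 0, where they solve the same equation and
  -- uniqueness applies.
  have h := (lipschitzOnBalls_fockField 0).eq_of_hasDerivAt
    (f := fun s => fockIncl (Nat.zero_le k) (WeightedFock.toSeq k (u s)))
    (g := fun s => fockIncl (Nat.zero_le j) (WeightedFock.toSeq j (v s)))
    (fun s => by
      rw [← fockIncl_fockField]
      exact (hu' s).fockIncl _)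
    (fun s => by
      rw [← fockIncl_fockField]
      exact (hv' s).fockIncl _)
    (unweight_injective 0 (by
      dsimp only
      rw [unweight_fockIncl, unweight_fockIncl, WeightedFock.unweight_toSeq,
        WeightedFock.unweight_toSeq, hu0, hv0, h0]))
  have h1 := congrArg (fun d : Ell2 => unweight 0 d) (congrFun h t)
  dsimp only at h1
  rw [unweight_fockIncl, unweight_fockIncl, WeightedFock.unweight_toSeq,
    WeightedFock.unweight_toSeq] at h1
  exact Subtype.ext (fockCoeff_injOn (u t).toFock.2 (v t).toFock.2 (congrFun h1))

theorem exists_isLLLSolution (k : ℕ) (u₀ : WeightedFock k) :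
    ∃ u : ℝ → WeightedFock k, IsLLLSolution k u₀ u := by
  obtain ⟨γ, h0, hγ⟩ := exists_global_fockField k (WeightedFock.toSeq k u₀)
  refine ⟨fun t => (WeightedFock.equivSeq k).symm (γ t), (isLLLSolution_iff _ _ _).2 ⟨?_, ?_⟩⟩
  · rw [h0, ← WeightedFock.equivSeq_apply, ContinuousLinearEquiv.symm_apply_apply]
  · simpa only [WeightedFock.toSeq_equivSeq_symm] using hγ

theorem theoremB1 :
    ∃ (Ck : ℕ → ℝ) (C : ℝ), (∀ k, 0 < Ck k) ∧ 0 < C ∧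
      ∀ (k : ℕ), 1 ≤ k → ∀ u₀ : WeightedFock k,
        ∃ u : ℝ → WeightedFock k,
          IsLLLSolution k u₀ u ∧
          (∀ v : ℝ → WeightedFock k, IsLLLSolution k u₀ v → v = u) ∧
          ∀ t : ℝ,
            (3 ≤ k →
              weightedNorm k (u t).toFun ≤
                weightedNorm k u₀.toFun *
                  (1 + Ck k * weightedNorm 1 u₀.toFun ^ 2 * |t|) ^ (((k : ℝ) - 1) / 4)) ∧
            (k = 2 →
              weightedNorm 2 (u t).toFun ≤
                weightedNorm 2 u₀.toFun *
                  (1 + C * weightedNorm 0 u₀.toFun ^ 2 * |t|) ^ ((1 : ℝ) / 2)) ∧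
            (MemWeighted 3 u₀.toFun →
              MemWeighted 2 (u t).toFun ∧
              weightedNorm 2 (u t).toFun ≤
                weightedNorm 3 u₀.toFun *
                  (1 + C * weightedNorm 1 u₀.toFun ^ 2 * |t|) ^ ((1 : ℝ) / 4)) := by
  choose c hc hgrow using exists_growth_add_three
  obtain ⟨C₂, hC₂, hgrow2⟩ := exists_growth_two
  obtain ⟨C₃, hC₃, hgrow3⟩ := exists_growth_two_of_three
  -- The truncated difference k - 3 gives arbitrary positive constants for k < 3, where no estimate
  -- uses them. The maximum serves the two bounds that share C.
  refine ⟨fun k => c (k - 3), max C₂ C₃, fun k => hc _, lt_max_of_lt_left hC₂,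
    fun k hk u₀ => ?_⟩
  obtain ⟨u, hu⟩ := exists_isLLLSolution k u₀
  obtain ⟨hu0, hu'⟩ := (isLLLSolution_iff _ _ _).1 hu
  refine ⟨u, hu, fun v hv => funext fun t =>
    WeightedFock.toFock_injective (hv.toFock_eq hu rfl t), fun t => ⟨fun h3 => ?_, fun h2 => ?_,
      fun hmem => ?_⟩⟩
  · obtain ⟨m, rfl⟩ := Nat.exists_eq_add_of_le' h3
    have h := hgrow m _ hu' t
    rw [WeightedFock.norm_toSeq, WeightedFock.norm_toSeq, WeightedFock.norm_fockIncl_toSeq,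
      hu0] at h
    rw [show ((m + 3 : ℕ) : ℝ) - 1 = (m : ℝ) + 2 by push_cast; ring]
    exact h
  · subst h2
    have h := hgrow2 _ hu' t
    rw [WeightedFock.norm_toSeq, WeightedFock.norm_toSeq, WeightedFock.norm_fockIncl_toSeq,
      hu0] at h
    refine h.trans (mul_le_mul_of_nonneg_left ?_ ENNReal.toReal_nonneg)
    refine Real.rpow_le_rpow (by positivity) ?_ (by norm_num)
    gcongr
    exact le_max_left _ _
  -- The given order k may be below 3. The solution of order 3 with the same datum is constructed
  -- and identified with u by uniqueness.
  · obtain ⟨w, hw⟩ := exists_isLLLSolution 3 (⟨u₀.toFock, hmem⟩ : WeightedFock 3)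
    obtain ⟨hw0, hw'⟩ := (isLLLSolution_iff _ _ _).1 hw
    have huw : (u t).toFun = (w t).toFun := by
      unfold WeightedFock.toFun
      rw [hu.toFock_eq hw rfl t]
    have h := hgrow3 _ hw' t
    rw [WeightedFock.norm_toSeq, WeightedFock.norm_fockIncl_toSeq,
      WeightedFock.norm_fockIncl_toSeq, hw0] at h
    rw [huw]
    refine ⟨WeightedFock.memWeighted_of_le (by omega) (w t), h.trans ?_⟩
    refine mul_le_mul_of_nonneg_left ?_ ENNReal.toReal_nonneg
    refine Real.rpow_le_rpow (by positivity) ?_ (by norm_num)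
    have : C₃ ≤ max C₂ C₃ := le_max_right _ _
    change 1 + C₃ * weightedNorm 1 u₀.toFun ^ 2 * |t| ≤ _
    gcongr
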